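/- **Theorem.** Let $f:\mathbb R\times\mathbb R^d\to\mathbb R^d$ be $C^\infty$ and let $y:[t_0,T]\to\mathbb R^d$ be a solution of $y'=f(t,y)$. Let $\Phi_s^t$ be the flow of this equation, so that $t\mapsto\Phi_s^t(x)$ is the solution with value $x$ at time $s$, and let $D\Phi_s^t$ be the Jacobian of $x\mapsto\Phi_s^t(x)$. Consider a (possibly implicit) Runge–Kutta method with $m$ stages, with coefficients $a_{ij}$, $b_i$ and nodes $c_i=\sum_j a_{ij}$. With fixed step size $h>0$ and $t_k=t_0+kh$ it computes $y_0=y(t_0)$ and $$y_{k+1}=y_k+h\sum_i b_iK_i,\qquad K_i=f\Bigl(t_k+c_ih,\;y_k+h\sum_j a_{ij}K_j\Bigr);$$ if the stage equations have several solutions, the one closest to $(f(t_k,y_k),\dots,f(t_k,y_k))$ is taken. The global error is $E_h(t_k)=y_k-y(t_k)$. Suppose that the method has order $p$, i.e. for every $C^\infty$ differential equation in any dimension and every solution on a bounded interval $[t_0,T]$ there are $C$ and $h_0>0$ such that $\|E_h(t_k)\|\le Ch^p$ whenever $0<h\le h_0$ and $t_k\le T$. *Trees.* Let $\mathbb T$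 be the set of rooted trees, $\bullet$ the tree with one vertex, $\rho(\tau)$ the number of vertices of $\tau$, and $\alpha(\tau)$ the number of monotone labellings of $\tau$. For $\tau=[\tau_1,\dots,\tau_r]$ (a root with subtrees $\tau_1,\dots,\tau_r$) put $\gamma(\tau)=\rho(\tau)\gamma(\tau_1)\cdots\gamma(\tau_r)$. For a vector field $g$ the elementary differentials are $F(\tau)(x)=g^{(r)}(x)\bigl(F(\tau_1)(x),\dots,F(\tau_r)(x)\bigr)$, with $F(\bullet)=g$. For $y'=f(t,y)$, $F(\tau)(t,y)$ denotes the $y$-component of the elementary differential of the vector field $(t,y)\mapsto(1,f(t,y))$. The B-series of a coefficient function $c:\mathbb T\cup\{\emptyset\}\to\mathbb R$ is $B(c,y)=c(\emptyset)y+\sum_{\tau\in\mathbb T}\frac{h^{\rho(\tau)}}{\rho(\tau)!}\alpha(\tau)c(\tau)F(\tau)(y)$. *Coefficients.* Let $a$ be the B-series coefficient function of the method: $a(\emptyset)=1$ and $a(\tau)=\gamma(\tau)\sum_i b_i\varphi_i(\tau)$, where $\varphi_i([\tau_1,\dots,\tau_r])=\prod_{l=1}^r\sum_j a_{ij}\varphi_j(\tau_l)$.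 For $b(\emptyset)=0$ let $\partial_bc$ be the coefficient function of the Lie derivative of $B(c,y)$ along the vector field $B(b,y)$; explicitly $(\partial_bc)(\emptyset)=0$ and $$(\partial_bc)(\tau)=c(\emptyset)b(\tau)+\gamma(\tau)\sum_{e}\frac{c(\theta_e)}{\gamma(\theta_e)}\frac{b(\delta_e)}{\gamma(\delta_e)},$$ where $e$ runs through the edges of $\tau$, and removing $e$ splits $\tau$ into the part $\theta_e$ containing the root and the part $\delta_e$. Let $b$ be the coefficient function of the modified equation, defined recursively by $b(\emptyset)=0$, $b(\bullet)=1$ and $$b(\tau)=a(\tau)-\sum_{j=2}^{\rho(\tau)}\frac1{j!}(\partial_b^{\,j-1}b)(\tau)\qquad(\rho(\tau)\ge2).$$ *Conclusion.* For $t_0\le s\le t\le T$ the map $\Phi_s^t$ is differentiable at $y(s)$, and for every $\tau\in\mathbb T$ the integrand of the elementary integral $$I_\tau(t)=\int_{t_0}^tD\Phi_s^t(y(s))\,F(\tau)(s,y(s))\,ds$$ is integrable. Moreover $$E_h(t)=\sum_{\tau\in\mathbb T,\ \rho(\tau)\ge2}h^{\rho(\tau)-1}\,b(\tau)\,\frac{\alpha(\tau)}{\rho(\tau)!}\,I_\tau(t)+O(h^{2p}),$$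 where the (in general divergent) series is understood as an asymptotic expansion: for every $N\ge2p$ there are $C$ and $h_0>0$ such that for all $0<h\le h_0$ and all $k\ge0$ with $t_k=t_0+kh\le T$, $$\Bigl\|E_h(t_k)-\sum_{\tau\in\mathbb T,\ 2\le\rho(\tau)\le N}h^{\rho(\tau)-1}\,b(\tau)\,\frac{\alpha(\tau)}{\rho(\tau)!}\,I_\tau(t_k)\Bigr\|\le Ch^{2p}.$$ -/

import Mathlib

open Set
open scoped ContDiff

namespace BSeries

/-! ### Rooted trees -/

/-- Rooted trees whose vertices have ordered children. `leaf` is the one-vertex tree and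
`graft τ δ` is `τ` with `δ` attached as one further child of the root, so that
`[δ₁, …, δₘ]` is `graft (… (graft leaf δ₁) …) δₘ`. -/
inductive PTree : Type
  | leaf : PTree
  | graft : PTree → PTree → PTree

namespace PTree

/-- Isomorphism of rooted trees: the children of any vertex may be permuted. -/
inductive Iso : PTree → PTree → Prop
  | refl (τ : PTree) : Iso τ τ
  | symm {τ τ' : PTree} : Iso τ τ' → Iso τ' τ
  | trans {τ τ' τ'' : PTree} : Iso τ τ' → Iso τ' τ'' → Iso τ τ''
  | congr {τ τ' δ δ' : PTree} : Iso τ τ' → Iso δ δ' → Iso (graft τ δ) (graft τ' δ')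
  | swap (τ δ ε : PTree) : Iso (graft (graft τ δ) ε) (graft (graft τ ε) δ)

instance isoSetoid : Setoid PTree := ⟨Iso, Iso.refl, Iso.symm, Iso.trans⟩

/-- The order (number of vertices). -/
def order : PTree → ℕ
  | leaf => 1
  | graft τ δ => order τ + order δ

/-- The product of the densities `γ(δᵢ)` of the children of the root of `τ = [δ₁, …, δₘ]`,
where `γ([δ₁, …, δₘ]) = ρ(τ) γ(δ₁) ⋯ γ(δₘ)`. -/
def childDensity : PTree → ℕ
  | leaf => 1
  | graft τ δ => childDensity τ * (order δ * childDensity δ)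

/-- The density `γ(τ) = ρ(τ) γ(δ₁) ⋯ γ(δₘ)` of `τ = [δ₁, …, δₘ]`. -/
def density (τ : PTree) : ℕ := order τ * childDensity τ

/-- All trees that arise from `τ` by attaching one new leaf to a vertex of `τ`, listed once for
each vertex of `τ`. -/
def grow : PTree → List PTree
  | leaf => [graft leaf leaf]
  | graft τ δ => (grow τ).map (fun θ => graft θ δ) ++ (grow δ).map (fun θ => graft τ θ)

/-- The underlying trees of all monotonically labelled trees with `n` vertices, listed once for
each labelled tree. In a tree with vertices `1, …, n + 1` whose labels increase along every branch,
the vertex `n + 1` is a leaf, attached to one of the vertices of a monotonically labelled tree with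
vertices `1, …, n`. (There are `(n - 1)!` entries.) -/
def monotoneTrees : ℕ → List PTree
  | 0 => []
  | 1 => [leaf]
  | n + 2 => (monotoneTrees (n + 1)).flatMap grow

theorem order_pos (τ : PTree) : 0 < τ.order := by
  induction τ with
  | leaf => simp [order]
  | graft τ δ h _ => simp only [order]; omega

theorem Iso.order_eq {τ τ' : PTree} (h : Iso τ τ') : τ.order = τ'.order := by
  induction h with
  | refl => rfl
  | symm _ ih => exact ih.symm
  | trans _ _ ih ih' => exact ih.trans ih'
  | congr _ _ ih ih' => simp only [order, ih, ih']
  | swap τ δ ε => simp only [order]; omega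

theorem Iso.childDensity_eq {τ τ' : PTree} (h : Iso τ τ') :
    τ.childDensity = τ'.childDensity := by
  induction h with
  | refl => rfl
  | symm _ ih => exact ih.symm
  | trans _ _ ih ih' => exact ih.trans ih'
  | congr h h' ih ih' => simp only [childDensity, ih, ih', h'.order_eq]
  | swap τ δ ε => simp only [childDensity]; ring

theorem Iso.density_eq {τ τ' : PTree} (h : Iso τ τ') : τ.density = τ'.density := by
  simp only [density, h.order_eq, h.childDensity_eq]

theorem finite_order_le (n : ℕ) : {τ : PTree | τ.order ≤ n}.Finite := by
  induction n with
  | zero =>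
    refine Set.Finite.subset Set.finite_empty fun τ hτ => ?_
    have h := order_pos τ
    simp only [mem_ofPred_eq] at hτ
    omega
  | succ n ih =>
    refine ((Set.finite_singleton leaf).union (Set.Finite.image2 graft ih ih)).subset ?_
    intro τ hτ
    cases τ with
    | leaf => exact Or.inl rfl
    | graft τ δ =>
      simp only [mem_ofPred_eq, order] at hτ
      have h1 := order_pos τ
      have h2 := order_pos δ
      exact Or.inr ⟨τ, by simp only [mem_ofPred_eq]; omega, δ, by simp only [mem_ofPred_eq]; omega,
        rfl⟩

end PTree

/-- The set `𝕋` of rooted trees (without an ordering of the children). -/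
def RTree : Type := Quotient PTree.isoSetoid

namespace RTree

def mk (τ : PTree) : RTree := Quotient.mk PTree.isoSetoid τ

theorem mk_eq {τ τ' : PTree} (h : PTree.Iso τ τ') : mk τ = mk τ' := Quotient.sound h

def leaf : RTree := mk PTree.leaf

def graft (τ δ : RTree) : RTree :=
  Quotient.liftOn₂ τ δ (fun τ δ => mk (PTree.graft τ δ))
    fun _ _ _ _ h h' => mk_eq (PTree.Iso.congr h h')

theorem graft_swap (τ δ ε : RTree) : (τ.graft δ).graft ε = (τ.graft ε).graft δ := by
  refine Quotient.inductionOn₃ τ δ ε fun τ δ ε => ?_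
  exact mk_eq (PTree.Iso.swap τ δ ε)

/-- The order `ρ(τ)`. -/
def order (τ : RTree) : ℕ := Quotient.liftOn τ PTree.order fun _ _ h => PTree.Iso.order_eq h

/-- The density `γ(τ)`. -/
def density (τ : RTree) : ℕ := Quotient.liftOn τ PTree.density fun _ _ h => PTree.Iso.density_eq h

open Classical in
/-- `α(τ)`, the number of monotone labellings of `τ`: the number of monotonically labelled trees
with `ρ(τ)` vertices whose underlying rooted tree is `τ`. -/
noncomputable def numLabellings (τ : RTree) : ℕ :=
  (PTree.monotoneTrees τ.order).countP fun σ => mk σ = τ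

theorem finite_order_le (n : ℕ) : {τ : RTree | τ.order ≤ n}.Finite := by
  refine ((PTree.finite_order_le n).image mk).subset fun τ hτ => ?_
  revert hτ
  refine Quotient.inductionOn τ fun τ hτ => ?_
  exact ⟨τ, hτ, rfl⟩

/-- The finite set of rooted trees `τ` with `2 ≤ ρ(τ) ≤ N`. -/
noncomputable def treesTwoTo (N : ℕ) : Finset RTree :=
  ((finite_order_le N).subset (fun _ h => h.2 :
    {τ : RTree | 2 ≤ τ.order ∧ τ.order ≤ N} ⊆ {τ | τ.order ≤ N})).toFinset

theorem mem_treesTwoTo {N : ℕ} {τ : RTree} : τ ∈ treesTwoTo N ↔ 2 ≤ τ.order ∧ τ.order ≤ N := by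
  simp [treesTwoTo]

end RTree

/-- All ways to cut `τ` along one edge, listed once for each edge, as pairs `(θ, δ)` of the part `θ`
that contains the root and the part `δ` that is cut off. -/
def PTree.cuts : PTree → Multiset (RTree × RTree)
  | .leaf => 0
  | .graft τ δ => (RTree.mk τ, RTree.mk δ) ::ₘ
      ((PTree.cuts τ).map (fun q => (q.1.graft (RTree.mk δ), q.2)) +
        (PTree.cuts δ).map (fun q => ((RTree.mk τ).graft q.1, q.2)))

theorem PTree.Iso.cuts_eq {τ τ' : PTree} (h : PTree.Iso τ τ') : τ.cuts = τ'.cuts := by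
  induction h with
  | refl => rfl
  | symm _ ih => exact ih.symm
  | trans _ _ ih ih' => exact ih.trans ih'
  | congr h h' ih ih' => simp only [PTree.cuts, ih, ih', RTree.mk_eq h, RTree.mk_eq h']
  | swap τ δ ε =>
    have key : ∀ x y : PTree, RTree.mk (.graft x y) = (RTree.mk x).graft (RTree.mk y) :=
      fun _ _ => rfl
    have hsw : ∀ a b : RTree, ∀ m : Multiset (RTree × RTree),
        m.map (fun q => ((a.graft q.1).graft b, q.2)) =
          m.map (fun q => ((a.graft b).graft q.1, q.2)) := fun a b m =>
      Multiset.map_congr rfl fun q _ => by rw [RTree.graft_swap]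
    have hsw' : ∀ m : Multiset (RTree × RTree),
        m.map (fun q => ((q.1.graft (RTree.mk δ)).graft (RTree.mk ε), q.2)) =
          m.map (fun q => ((q.1.graft (RTree.mk ε)).graft (RTree.mk δ), q.2)) := fun m =>
      Multiset.map_congr rfl fun q _ => by rw [RTree.graft_swap]
    simp only [PTree.cuts, Multiset.map_cons, Multiset.map_add, Multiset.map_map,
      Function.comp_def, key, hsw, hsw']
    simp only [← Multiset.singleton_add]
    abel

/-- All ways to cut `τ` along one edge: `(part with the root, part cut off)`. -/
def RTree.cuts (τ : RTree) : Multiset (RTree × RTree) :=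
  Quotient.liftOn τ PTree.cuts fun _ _ h => PTree.Iso.cuts_eq h

theorem PTree.order_of_mem_cuts (τ : PTree) :
    ∀ q ∈ τ.cuts, q.1.order < τ.order ∧ q.2.order < τ.order := by
  have hg : ∀ x y : RTree, (x.graft y).order = x.order + y.order := fun x y =>
    Quotient.inductionOn₂ x y fun _ _ => rfl
  have hm : ∀ x : PTree, (RTree.mk x).order = x.order := fun _ => rfl
  induction τ with
  | leaf => simp [PTree.cuts]
  | graft τ δ h h' =>
    intro q hq
    have h1 := PTree.order_pos τ
    have h2 := PTree.order_pos δ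
    simp only [PTree.cuts, Multiset.mem_cons, Multiset.mem_add, Multiset.mem_map] at hq
    simp only [PTree.order]
    rcases hq with rfl | ⟨r, hr, rfl⟩ | ⟨r, hr, rfl⟩
    · simp only [hm]; omega
    · have := h r hr
      simp only [hg, hm]; omega
    · have := h' r hr
      simp only [hg, hm]; omega

theorem RTree.order_of_mem_cuts (τ : RTree) :
    ∀ q ∈ τ.cuts, q.1.order < τ.order ∧ q.2.order < τ.order :=
  Quotient.inductionOn τ PTree.order_of_mem_cuts

/-! ### Coefficient functions -/

/-- Coefficient functions on `𝕋 ∪ {∅}`; `none` is the empty tree. The B-series of `a` is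
`B(a, y) = a(∅) y + ∑_τ (h ^ ρ(τ) / ρ(τ)!) α(τ) a(τ) F(τ)(y)`. -/
abbrev Coeff : Type := Option RTree → ℝ

/-- The Lie derivative `∂_b c` for `b(∅) = 0`: the coefficient function of the B-series
`d/dt B(c, y(t))`, where `y' = B(b, y)`. Each term `c(θ) F(θ)` contributes, for each vertex of `θ`,
the terms in which a tree `δ` with factor `b(δ)` is attached to that vertex; with the weights
`α(τ) / ρ(τ)! = 1 / (γ(τ) σ(τ))` of the B-series (`σ` is the symmetry) this reads
`(∂_b c)(τ) = c(∅) b(τ) + γ(τ) ∑ (c(θ) / γ(θ)) (b(δ) / γ(δ))`, the sum being over all edges of `τ`,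
and `θ`, `δ` the two parts into which the removal of the edge splits `τ`. -/
noncomputable def lieDeriv (b c : Coeff) : Coeff
  | none => 0
  | some τ => c none * b (some τ) + τ.density * (τ.cuts.map fun q =>
      c (some q.1) / q.1.density * (b (some q.2) / q.2.density)).sum

/-- Successive approximations to the coefficients of the modified equation; the `n`-th one is
correct on trees with at most `n` vertices. -/
noncomputable def modifiedAux (a : Coeff) : ℕ → Coeff
  | 0 => fun _ => 0
  | n + 1 => fun
    | none => 0
    | some τ => if τ.order = 1 then 1 else
        a (some τ) - ∑ j ∈ Finset.Icc 2 τ.order,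
          1 / (j.factorial : ℝ) * ((lieDeriv (modifiedAux a n))^[j - 1] (modifiedAux a n)) (some τ)

/-- The coefficient function `b` of the modified equation `z' = (1 / h) B(b, z)` of a method with
B-series coefficients `a`. It is determined by the recursion `b(∅) = 0`, `b(leaf) = 1` and
`b(τ) = a(τ) - ∑_{j = 2}^{ρ(τ)} (1 / j!) (∂_b^{j - 1} b)(τ)` for `ρ(τ) ≥ 2`, which is proved below
(`modifiedCoeff_none`, `modifiedCoeff_leaf`, `modifiedCoeff_rec`). -/
noncomputable def modifiedCoeff (a : Coeff) : Coeff
  | none => 0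
  | some τ => modifiedAux a τ.order (some τ)

theorem lieDeriv_congr {b b' c c' : Coeff} {n : ℕ} (hc0 : c none = 0) (hc0' : c' none = 0)
    (hb : ∀ τ : RTree, τ.order ≤ n → b (some τ) = b' (some τ))
    (hc : ∀ τ : RTree, τ.order ≤ n → c (some τ) = c' (some τ)) (τ : RTree)
    (hτ : τ.order ≤ n + 1) : lieDeriv b c (some τ) = lieDeriv b' c' (some τ) := by
  simp only [lieDeriv, hc0, hc0', zero_mul, zero_add]
  congr 2
  refine Multiset.map_congr rfl fun q hq => ?_
  have h := τ.order_of_mem_cuts q hq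
  rw [hc q.1 (by omega), hb q.2 (by omega)]

theorem lieDeriv_iterate_congr {b b' : Coeff} {n : ℕ} (h0 : b none = 0) (h0' : b' none = 0)
    (hb : ∀ τ : RTree, τ.order ≤ n → b (some τ) = b' (some τ)) (k : ℕ) (τ : RTree)
    (hτ : τ.order ≤ n + 1) :
    ((lieDeriv b)^[k + 1] b) (some τ) = ((lieDeriv b')^[k + 1] b') (some τ) := by
  have hz : ∀ (b : Coeff) (k : ℕ), b none = 0 → ((lieDeriv b)^[k] b) none = 0 := by
    intro b k hb
    cases k with
    | zero => exact hb
    | succ k => rw [Function.iterate_succ_apply']; rfl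
  induction k generalizing τ with
  | zero => exact lieDeriv_congr h0 h0' hb hb τ hτ
  | succ k ih =>
    rw [Function.iterate_succ_apply', Function.iterate_succ_apply' (lieDeriv b')]
    exact lieDeriv_congr (hz _ _ h0) (hz _ _ h0') hb (fun σ hσ => ih σ (by omega)) τ hτ

theorem modifiedAux_none (a : Coeff) (n : ℕ) : modifiedAux a n none = 0 := by
  cases n <;> rfl

theorem RTree.order_pos (τ : RTree) : 0 < τ.order := Quotient.inductionOn τ PTree.order_pos

theorem modifiedAux_eq (a : Coeff) (n : ℕ) (τ : RTree) (hτ : τ.order ≤ n) :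
    modifiedAux a n (some τ) = modifiedCoeff a (some τ) := by
  induction n using Nat.strong_induction_on generalizing τ with
  | _ n ih =>
    have hp := τ.order_pos
    obtain ⟨m, hm⟩ : ∃ m, τ.order = m + 1 := ⟨τ.order - 1, by omega⟩
    obtain ⟨n, rfl⟩ : ∃ n', n = n' + 1 := ⟨n - 1, by omega⟩
    change _ = modifiedAux a τ.order (some τ)
    rw [hm]
    simp only [modifiedAux]
    split_ifs with h
    · rfl
    · congr 1
      refine Finset.sum_congr rfl fun j hj => ?_
      obtain ⟨k, rfl⟩ : ∃ k, j = k + 2 := ⟨j - 2, by have := (Finset.mem_Icc.1 hj).1; omega⟩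
      congr 1
      refine lieDeriv_iterate_congr (n := m) (modifiedAux_none _ _) (modifiedAux_none _ _) ?_ k τ
        (by omega)
      intro σ hσ
      rw [ih n (by omega) σ (by omega), ih m (by omega) σ hσ]

theorem modifiedCoeff_none (a : Coeff) : modifiedCoeff a none = 0 := rfl

theorem modifiedCoeff_leaf (a : Coeff) : modifiedCoeff a (some RTree.leaf) = 1 := by
  change modifiedAux a 1 (some RTree.leaf) = 1
  simp only [modifiedAux]
  exact if_pos rfl

theorem modifiedCoeff_rec (a : Coeff) (τ : RTree) (hτ : 2 ≤ τ.order) :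
    modifiedCoeff a (some τ) = a (some τ) - ∑ j ∈ Finset.Icc 2 τ.order, 1 / (j.factorial : ℝ) *
      ((lieDeriv (modifiedCoeff a))^[j - 1] (modifiedCoeff a)) (some τ) := by
  obtain ⟨m, hm⟩ : ∃ m, τ.order = m + 1 := ⟨τ.order - 1, by omega⟩
  rw [← modifiedAux_eq a (m + 1) τ hm.le]
  simp only [modifiedAux]
  rw [if_neg (by omega)]
  congr 1
  refine Finset.sum_congr rfl fun j hj => ?_
  obtain ⟨k, rfl⟩ : ∃ k, j = k + 2 := ⟨j - 2, by have := (Finset.mem_Icc.1 hj).1; omega⟩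
  congr 1
  exact lieDeriv_iterate_congr (n := m) (modifiedAux_none _ _) rfl
    (fun σ hσ => modifiedAux_eq a m σ hσ) k τ hm.le

/-! ### Elementary differentials -/

section ElementaryDifferentials

variable {V : Type*} [NormedAddCommGroup V] [NormedSpace ℝ V]

/-- The list of the vectors `F(δᵢ)(y)`, where `δᵢ` runs through the children of the root. -/
noncomputable def childDiffs (g : V → V) (y : V) : PTree → List V
  | .leaf => []
  | .graft τ δ =>
      iteratedFDeriv ℝ (childDiffs g y δ).length g y (childDiffs g y δ).get :: childDiffs g y τ

/-- The elementary differential of the vector field `g` for a tree with ordered children: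
`F([δ₁, …, δₘ])(y) = g⁽ᵐ⁾(y)(F(δ₁)(y), …, F(δₘ)(y))`, in particular `F(leaf) = g`. -/
noncomputable def elemDiffP (g : V → V) (τ : PTree) (y : V) : V :=
  iteratedFDeriv ℝ (childDiffs g y τ).length g y (childDiffs g y τ).get

/-- The elementary differential `F(τ)(y)` of the vector field `g`, evaluated with an arbitrary
ordering of the children; for smooth `g` the ordering is irrelevant, see `elemDiff_mk`. -/
noncomputable def elemDiff (g : V → V) (τ : RTree) (y : V) : V := elemDiffP g (Quotient.out τ) y

theorem iteratedFDeriv_cons {g : V → V} (hg : ContDiff ℝ ∞ g) (y v : V) (l : List V) :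
    iteratedFDeriv ℝ (v :: l).length g y (v :: l).get =
      fderiv ℝ (fun x => iteratedFDeriv ℝ l.length g x l.get) y v := by
  have hd : DifferentiableAt ℝ (iteratedFDeriv ℝ l.length g) y :=
    (hg.differentiable_iteratedFDeriv (by exact_mod_cast WithTop.coe_lt_top _)) y
  have h1 : iteratedFDeriv ℝ (v :: l).length g y (v :: l).get =
      (fderiv ℝ (iteratedFDeriv ℝ l.length g) y v) l.get := rfl
  rw [h1]
  exact (congrArg (fun L : V →L[ℝ] V => L v) (hd.hasFDerivAt.continuousMultilinear_apply_const
    l.get).fderiv).symm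

theorem iteratedFDeriv_perm {g : V → V} (hg : ContDiff ℝ ∞ g) (y : V) {l l' : List V}
    (h : l.Perm l') :
    iteratedFDeriv ℝ l.length g y l.get = iteratedFDeriv ℝ l'.length g y l'.get := by
  induction h generalizing y with
  | nil => rfl
  | cons v _ ih => simp only [iteratedFDeriv_cons hg, ih]
  | trans _ _ ih ih' => exact (ih y).trans (ih' y)
  | swap v w l =>
    rw [iteratedFDeriv_cons hg, iteratedFDeriv_cons hg]
    simp only [iteratedFDeriv_cons hg]
    have hG : ContDiff ℝ ∞ (fun x => iteratedFDeriv ℝ l.length g x l.get) := by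
      have h1 : ContDiff ℝ ∞ (iteratedFDeriv ℝ l.length g) :=
        hg.iteratedFDeriv_right (by exact_mod_cast le_top)
      exact (ContinuousMultilinearMap.apply ℝ (fun _ : Fin l.length => V) V l.get).contDiff.comp h1
    have h2' : (2 : WithTop ℕ∞) ≤ ∞ := WithTop.coe_le_coe.2 (le_top : (2 : ℕ∞) ≤ ⊤)
    have h2 : (1 + 1 : WithTop ℕ∞) ≤ ∞ := by rw [one_add_one_eq_two]; exact h2'
    have hd : DifferentiableAt ℝ (fderiv ℝ (fun x => iteratedFDeriv ℝ l.length g x l.get)) y :=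
      ((hG.fderiv_right (m := 1) h2).differentiable (by simp)) y
    have hs : IsSymmSndFDerivAt ℝ (fun x => iteratedFDeriv ℝ l.length g x l.get) y :=
      hG.contDiffAt.isSymmSndFDerivAt (by simpa using h2')
    have key : ∀ a b : V,
        fderiv ℝ (fun x => fderiv ℝ (fun x => iteratedFDeriv ℝ l.length g x l.get) x a) y b =
          fderiv ℝ (fderiv ℝ (fun x => iteratedFDeriv ℝ l.length g x l.get)) y b a := by
      intro a b
      rw [fderiv_clm_apply hd (differentiableAt_const a)]
      simp
    rw [key, key]
    exact hs.eq _ _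

theorem childDiffs_perm {g : V → V} (hg : ContDiff ℝ ∞ g) (y : V) {τ τ' : PTree}
    (h : PTree.Iso τ τ') : (childDiffs g y τ).Perm (childDiffs g y τ') := by
  induction h with
  | refl => exact List.Perm.refl _
  | symm _ ih => exact ih.symm
  | trans _ _ ih ih' => exact ih.trans ih'
  | congr h h' ih ih' =>
    simp only [childDiffs, iteratedFDeriv_perm hg y ih']
    exact ih.cons _
  | swap τ δ ε => exact List.Perm.swap _ _ _

theorem elemDiff_mk {g : V → V} (hg : ContDiff ℝ ∞ g) (τ : PTree) (y : V) :
    elemDiff g (RTree.mk τ) y = elemDiffP g τ y :=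
  iteratedFDeriv_perm hg y (childDiffs_perm hg y (Quotient.mk_out (s := PTree.isoSetoid) τ))

end ElementaryDifferentials

/-! ### Differential equations and their flow -/

section Flow

variable {V : Type*} [NormedAddCommGroup V] [NormedSpace ℝ V]

/-- `u` solves `u' = f(t, u)` on the set `S` (one-sided derivatives at end points). -/
def IsSolutionOn (f : ℝ → V → V) (u : ℝ → V) (S : Set ℝ) : Prop :=
  ∀ r ∈ S, HasDerivWithinAt u (f r (u r)) S r

open Classical in
/-- The flow map `Φ_s^t(x)`: the value at time `t` of the solution of `u' = f(t, u)`, `u(s) = x`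
(with an arbitrary value if this solution does not exist up to time `t`). -/
noncomputable def flowMap (f : ℝ → V → V) (s t : ℝ) (x : V) : V :=
  Classical.epsilon fun z => ∃ u : ℝ → V, IsSolutionOn f u (uIcc s t) ∧ u s = x ∧ u t = z

/-- The elementary differential `F(τ)(t, y)` of the right-hand side of `y' = f(t, y)`: the
`y`-component of the elementary differential of the vector field `(t, y) ↦ (1, f(t, y))` of the
autonomous system `t' = 1`, `y' = f(t, y)`. -/
noncomputable def odeElemDiff (f : ℝ → V → V) (τ : RTree) (t : ℝ) (y : V) : V :=
  (elemDiff (fun q : ℝ × V => ((1 : ℝ), f q.1 q.2)) τ (t, y)).2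

/-- The integrand `DΦ_s^t(y(s)) F(τ)(s, y(s))` of the elementary integral. -/
noncomputable def elemIntegrand (f : ℝ → V → V) (y : ℝ → V) (τ : RTree) (t s : ℝ) : V :=
  fderiv ℝ (flowMap f s t) (y s) (odeElemDiff f τ s (y s))

/-- The elementary integral `I_τ(t) = ∫_{t₀}^t DΦ_s^t(y(s)) F(τ)(s, y(s)) ds`. -/
noncomputable def elemIntegral (f : ℝ → V → V) (y : ℝ → V) (t₀ : ℝ) (τ : RTree) (t : ℝ) : V :=
  ∫ s in t₀..t, elemIntegrand f y τ t s

end Flow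

/-! ### Runge–Kutta methods -/

/-- The coefficients `(A, b)` of a Runge–Kutta method with `s` stages (explicit or implicit). The
nodes are `cᵢ = ∑ⱼ aᵢⱼ`. -/
structure RungeKutta (s : ℕ) where
  A : Matrix (Fin s) (Fin s) ℝ
  b : Fin s → ℝ

namespace RungeKutta

variable {s : ℕ} (M : RungeKutta s)

/-- The nodes `cᵢ = ∑ⱼ aᵢⱼ`. -/
def c (i : Fin s) : ℝ := ∑ j, M.A i j

/-- `φᵢ(τ) = ∏ₗ ∑ⱼ aᵢⱼ φⱼ(δₗ)` for `τ = [δ₁, …, δₘ]`. -/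
def stageWeightP : PTree → Fin s → ℝ
  | .leaf, _ => 1
  | .graft τ δ, i => stageWeightP τ i * ∑ j, M.A i j * stageWeightP δ j

theorem stageWeightP_eq {τ τ' : PTree} (h : PTree.Iso τ τ') :
    M.stageWeightP τ = M.stageWeightP τ' := by
  induction h with
  | refl => rfl
  | symm _ ih => exact ih.symm
  | trans _ _ ih ih' => exact ih.trans ih'
  | congr _ _ ih ih' => funext i; simp only [stageWeightP, ih, ih']
  | swap τ δ ε => funext i; simp only [stageWeightP]; ring

def stageWeight (τ : RTree) : Fin s → ℝ :=
  Quotient.liftOn τ M.stageWeightP fun _ _ h => M.stageWeightP_eq h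

/-- The B-series coefficient function of the method: `a(∅) = 1`, `a(τ) = γ(τ) ∑ᵢ bᵢ φᵢ(τ)`. -/
def coeff : Coeff
  | none => 1
  | some τ => τ.density * ∑ i, M.b i * M.stageWeight τ i

section Numerical

variable {V : Type*} [NormedAddCommGroup V] [NormedSpace ℝ V]

/-- The stage equations `kᵢ = f(t + cᵢ h, y + h ∑ⱼ aᵢⱼ kⱼ)`. -/
def IsStages (f : ℝ → V → V) (h t : ℝ) (y : V) (k : Fin s → V) : Prop :=
  ∀ i, k i = f (t + M.c i * h) (y + h • ∑ j, M.A i j • k j)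

open Classical in
/-- The stages: the solution of the stage equations, and if an implicit method has several ones,
the one that is closest to `kᵢ = f(t, y)`. (For explicit methods there is exactly one solution;
for implicit ones and small `h` this is the branch that is continuous at `h = 0`.) -/
noncomputable def stages (f : ℝ → V → V) (h t : ℝ) (y : V) : Fin s → V :=
  Classical.epsilon fun k => M.IsStages f h t y k ∧
    ∀ k', M.IsStages f h t y k' → ‖k - fun _ => f t y‖ ≤ ‖k' - fun _ => f t y‖

/-- One step of the method with step size `h`. -/
noncomputable def step (f : ℝ → V → V) (h t : ℝ) (y : V) : V :=
  y + h • ∑ i, M.b i • M.stages f h t y i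

/-- The numerical results `y₀, y₁, y₂, …` with step size `h`. -/
noncomputable def results (f : ℝ → V → V) (t₀ : ℝ) (y₀ : V) (h : ℝ) : ℕ → V
  | 0 => y₀
  | k + 1 => M.step f h (t₀ + k * h) (results f t₀ y₀ h k)

/-- The global error `E_h(t_k) = y_k - y(t_k)` at `t_k = t₀ + k h`. -/
noncomputable def globalError (f : ℝ → V → V) (y : ℝ → V) (t₀ h : ℝ) (k : ℕ) : V :=
  M.results f t₀ (y t₀) h k - y (t₀ + k * h)

end Numerical

/-- The method has order `p`: for every smooth differential equation and every solution on a
bounded interval, the global error is `O(h ^ p)` on this interval. -/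
def HasOrder (p : ℕ) : Prop :=
  ∀ (d : ℕ) (f : ℝ → EuclideanSpace ℝ (Fin d) → EuclideanSpace ℝ (Fin d)),
    ContDiff ℝ ∞ (fun q : ℝ × EuclideanSpace ℝ (Fin d) => f q.1 q.2) →
    ∀ (t₀ T : ℝ) (y : ℝ → EuclideanSpace ℝ (Fin d)), IsSolutionOn f y (Icc t₀ T) →
    ∃ C : ℝ, ∃ h₀ > 0, ∀ h : ℝ, 0 < h → h ≤ h₀ → ∀ k : ℕ, t₀ + k * h ≤ T →
      ‖M.globalError f y t₀ h k‖ ≤ C * h ^ p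

end RungeKutta

end BSeries

/-!
The global error of a method of order `p` is compared with the solution `e` of the linearized
equation `e' = f_y(t, y) e + r_h(t, y)`, `e(t₀) = 0`, where `f + r_h` is the vector field of the
truncated modified equation of the method.

*The error expansion as a variation of constants.* The coefficient of `h ^ j` in `r_h` is a sum over
the trees with `j + 1` vertices. The derivative of the flow along `y` is `X t * Y s`
(`hasFDerivAt_flowMap`), where `X` is a fundamental solution of the linearized equation and `Y` its
inverse. Hence the sum of elementary integrals is exactly `e` (`sum_elemIntegral_eq_duhamel`).

*The modified equation.* The recursion for its coefficients says that its time-`h` map has the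
B-series of the method (`highOrder_modified`). This rests on the fact that Lie derivatives of
B-series are B-series with the coefficients `lieDeriv` (`highOrder_lieDeriv`). All sums over rooted
trees are turned into sums over trees with ordered children, where the symmetry coefficient becomes
the product `PTree.weight` of reciprocal factorials. The combinatorial facts needed are that cutting
an edge is adjoint to attaching a subtree (`PTree.sum_cuts`), and that `α(τ) / ρ(τ)!` is the sum of
`weight / γ(τ)` over the orderings of `τ` (`RTree.numLabellings_div_factorial`). A step of the
method, including the choice of the branch of the stage equations, agrees with its B-series up to a
power of `h` (`RungeKutta.exists_step_sub_bSeries_le`).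

*The estimate.* If `r_h = O(h ^ q)`, then `e = O(h ^ q)`, and `y + e` solves the modified equation
up to the quadratic term of `f` and the variation of `r_h`, hence up to `O(h ^ (2 q))`. So the
method reproduces `y + e` up to `O(h ^ (2 q + 1))` in every step, apart from the truncation error,
and stability gives the global error up to `O(h ^ (2 q))` (`exists_globalError_sub_duhamel_le`).

*The order.* It remains to see that `r_h = O(h ^ p)` for a method of order `p`. If the terms of
`r_h` below `h ^ q` vanish, where `q < p`, then the estimate shows that the part of `e` in `h ^ q`
vanishes along every solution; its derivative at the starting point is the coefficient of
`h ^ q` in `r_h`, which is therefore zero (`RungeKutta.HasOrder.perturbationTerm_eq_zero`).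
-/

namespace BSeries

universe u

open RTree (mk)

/-! ### Sums over ordered trees -/

namespace PTree

/-- The finite set of ordered trees with at most `N` vertices. -/
noncomputable def treesLE (N : ℕ) : Finset PTree := (finite_order_le N).toFinset

theorem mem_treesLE {N : ℕ} {τ : PTree} : τ ∈ treesLE N ↔ τ.order ≤ N := by
  simp [treesLE]

theorem graft_injective : Function.Injective (fun q : PTree × PTree => graft q.1 q.2) := by
  rintro ⟨a, b⟩ ⟨c, d⟩ h
  simp only [graft.injEq] at h
  exact Prod.ext h.1 h.2

/-- A tree is a leaf or a graft of two smaller trees. The summation bound need not be lowered on the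
right-hand side, since `f` vanishes on large trees. -/
theorem sum_treesLE {E : Type*} [AddCommMonoid E] (N : ℕ) (f : PTree → E)
    (hf : ∀ τ : PTree, N < τ.order → f τ = 0) :
    ∑ τ ∈ treesLE N, f τ = f leaf + ∑ θ ∈ treesLE N, ∑ δ ∈ treesLE N, f (graft θ δ) := by
  classical
  have hmap := Finset.sum_map (treesLE N ×ˢ treesLE N) ⟨_, graft_injective⟩ f
  simp only [Function.Embedding.coeFn_mk] at hmap
  rw [← Finset.sum_product', ← hmap,
    ← Finset.sum_cons (s := Finset.map _ _) (a := leaf) (f := f) (by simp)]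
  refine Finset.sum_subset (fun τ hτ => ?_) fun τ _ hτ => hf τ ?_
  · cases τ with
    | leaf => simp
    | graft θ δ =>
      have h1 := θ.order_pos
      have h2 := δ.order_pos
      simp only [mem_treesLE, order] at hτ
      simp only [Finset.mem_cons, Finset.mem_map, Finset.mem_product, mem_treesLE]
      exact Or.inr ⟨(θ, δ), ⟨by simp only; omega, by simp only; omega⟩, rfl⟩
  · simpa [mem_treesLE] using hτ

/-- The number of children of the root. -/
def numChildren : PTree → ℕ
  | leaf => 0
  | graft θ _ => numChildren θ + 1

/-- The product of the factors `1 / m!` over all vertices, `m` being the number of children of the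
vertex. Summed over all orderings of a rooted tree `τ`, this gives the reciprocal of the symmetry
number of `τ`. -/
noncomputable def weight : PTree → ℝ
  | leaf => 1
  | graft θ δ => weight θ * weight δ / (numChildren θ + 1)

/-- All trees that arise by attaching `δ` as a new child to a vertex of a tree, listed once for
each vertex. -/
def attach : PTree → PTree → List PTree
  | leaf, δ => [graft leaf δ]
  | graft τ ε, δ => (attach τ δ).map (fun θ => graft θ ε) ++ (attach ε δ).map (fun θ => graft τ θ)

/-- As `attach`, but `δ` is attached only to vertices different from the root. -/
def innerAttach : PTree → PTree → List PTree
  | leaf, _ => []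
  | graft τ ε, δ =>
      (innerAttach τ δ).map (fun θ => graft θ ε) ++ (attach ε δ).map (fun θ => graft τ θ)

/-- The cuts along edges at the root. -/
def rootCuts : PTree → Multiset (RTree × RTree)
  | leaf => 0
  | graft τ δ => (RTree.mk τ, RTree.mk δ) ::ₘ
      (rootCuts τ).map (fun q => (q.1.graft (RTree.mk δ), q.2))

/-- The cuts along edges away from the root. -/
def innerCuts : PTree → Multiset (RTree × RTree)
  | leaf => 0
  | graft τ δ => (innerCuts τ).map (fun q => (q.1.graft (RTree.mk δ), q.2)) +
      (cuts δ).map (fun q => ((RTree.mk τ).graft q.1, q.2))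

theorem cuts_eq_add (τ : PTree) : τ.cuts = τ.rootCuts + τ.innerCuts := by
  induction τ with
  | leaf => rfl
  | graft τ δ h _ =>
    simp only [cuts, rootCuts, innerCuts, h, Multiset.map_add, Multiset.cons_add]
    abel_nf

theorem order_of_mem_attach {θ δ τ : PTree} (h : τ ∈ θ.attach δ) :
    τ.order = θ.order + δ.order := by
  induction θ generalizing τ with
  | leaf => simp only [attach, List.mem_singleton] at h; subst h; rfl
  | graft θ ε ih ih' =>
    simp only [attach, List.mem_append, List.mem_map] at h
    rcases h with ⟨σ, hσ, rfl⟩ | ⟨σ, hσ, rfl⟩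
    · simp only [order, ih hσ]; omega
    · simp only [order, ih' hσ]; omega

theorem innerAttach_subset {θ δ τ : PTree} (h : τ ∈ θ.innerAttach δ) : τ ∈ θ.attach δ := by
  induction θ generalizing τ with
  | leaf => simp [innerAttach] at h
  | graft θ ε ih _ =>
    simp only [attach, innerAttach, List.mem_append, List.mem_map] at h ⊢
    rcases h with ⟨σ, hσ, rfl⟩ | h
    · exact Or.inl ⟨σ, ih hσ, rfl⟩
    · exact Or.inr h

theorem grow_eq_attach (τ : PTree) : τ.grow = τ.attach leaf := by
  induction τ with
  | leaf => rfl
  | graft τ δ h h' => simp only [grow, attach, h, h']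

end PTree

namespace RTree

theorem order_mk (τ : PTree) : (mk τ).order = τ.order := rfl

theorem density_mk (τ : PTree) : (mk τ).density = τ.density := rfl

theorem mk_graft (τ δ : PTree) : mk (PTree.graft τ δ) = (mk τ).graft (mk δ) := rfl

theorem order_graft (τ δ : RTree) : (τ.graft δ).order = τ.order + δ.order :=
  Quotient.inductionOn₂ τ δ fun _ _ => rfl

theorem order_leaf : leaf.order = 1 := rfl

theorem eq_leaf_of_order {τ : RTree} (h : τ.order = 1) : τ = leaf := by
  revert h
  refine Quotient.inductionOn τ fun τ h => ?_
  cases τ with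
  | leaf => rfl
  | graft θ δ =>
    have h1 := θ.order_pos
    have h2 := δ.order_pos
    change θ.order + δ.order = 1 at h
    omega

theorem cuts_mk (τ : PTree) : (mk τ).cuts = τ.cuts := rfl

end RTree

namespace PTree

theorem order_add_of_mem_cuts (τ : PTree) : ∀ q ∈ τ.cuts, q.1.order + q.2.order = τ.order := by
  induction τ with
  | leaf => simp [cuts]
  | graft τ δ h h' =>
    intro q hq
    simp only [cuts, Multiset.mem_cons, Multiset.mem_add, Multiset.mem_map] at hq
    simp only [order]
    rcases hq with rfl | ⟨r, hr, rfl⟩ | ⟨r, hr, rfl⟩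
    · rfl
    · have := h r hr
      simp only [RTree.order_graft, RTree.order_mk]; omega
    · have := h' r hr
      simp only [RTree.order_graft, RTree.order_mk]; omega

/-- Attaching `δ` to the root gives, up to the order of the children, the tree `graft θ δ`. -/
theorem sum_attach {E : Type*} [AddCommGroup E] (φ : RTree → E) (θ δ : PTree) :
    ((θ.attach δ).map fun τ => φ (mk τ)).sum =
      φ (mk (graft θ δ)) + ((θ.innerAttach δ).map fun τ => φ (mk τ)).sum := by
  induction θ generalizing φ with
  | leaf => simp [attach, innerAttach]
  | graft θ ε ih _ =>
    have := ih fun t => φ (t.graft (mk ε))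
    simp only [attach, innerAttach, List.map_append, List.map_map, List.sum_append,
      Function.comp_def, RTree.mk_graft] at this ⊢
    rw [this, RTree.graft_swap (mk θ) (mk δ) (mk ε), add_assoc]

section Sums

variable {E : Type*} [AddCommGroup E] [Module ℝ E]

/-- The sum over the cuts at the root, rewritten as a sum over pairs of trees. The factor `l` of
the number of children is what makes the induction work. -/
theorem sum_rootCuts (M : ℕ) (N : ℕ) (hN : N ≤ M) (l : ℕ → ℝ) (Z : RTree → RTree → RTree → E)
    (hZ : ∀ a b c, N < RTree.order c → Z a b c = 0) :
    ∑ τ ∈ treesLE M, (l τ.numChildren * τ.weight) •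
        (τ.rootCuts.map fun q => Z q.1 q.2 (mk τ)).sum =
      ∑ θ ∈ treesLE M, ∑ δ ∈ treesLE M, (l (θ.numChildren + 1) * (θ.weight * δ.weight)) •
        Z (mk θ) (mk δ) (mk (graft θ δ)) := by
  induction N generalizing l Z with
  | zero =>
    have h0 : ∀ a b c, Z a b c = 0 := fun a b c => hZ a b c c.order_pos
    simp [h0]
  | succ N ih =>
    have ihδ : ∀ δ : PTree, _ := fun δ =>
      ih (by omega) (fun n => l (n + 1) / (n + 1))
        (fun a b c => Z (a.graft (mk δ)) b (c.graft (mk δ))) fun a b c hc => hZ _ _ _ (by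
          have := δ.order_pos
          rw [RTree.order_graft, RTree.order_mk]; omega)
    rw [sum_treesLE M]
    swap
    · intro τ hτ
      have h0 : ∀ a b, Z a b (mk τ) = 0 := fun a b => hZ _ _ _ (by rw [RTree.order_mk]; omega)
      simp [h0]
    simp only [rootCuts, numChildren, weight, Multiset.map_zero, Multiset.sum_zero, smul_zero,
      zero_add, Multiset.map_cons, Multiset.sum_cons, Multiset.map_map, Function.comp_def, smul_add,
      Finset.sum_add_distrib]
    have h1 : ∑ θ ∈ treesLE M, ∑ δ ∈ treesLE M,
        (l (θ.numChildren + 1) * (θ.weight * δ.weight / (θ.numChildren + 1))) •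
          (θ.rootCuts.map fun q => Z (q.1.graft (mk δ)) q.2 (mk (graft θ δ))).sum =
        ∑ θ ∈ treesLE M, ∑ δ ∈ treesLE M, (l (θ.numChildren + 1) * (θ.weight * δ.weight) *
          (θ.numChildren / (θ.numChildren + 1))) • Z (mk θ) (mk δ) (mk (graft θ δ)) := by
      rw [sum_treesLE M (fun θ => ∑ δ ∈ treesLE M, (l (θ.numChildren + 1) *
        (θ.weight * δ.weight) * (θ.numChildren / (θ.numChildren + 1))) •
          Z (mk θ) (mk δ) (mk (graft θ δ)))]
      swap
      · intro τ hτ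
        refine Finset.sum_eq_zero fun δ _ => ?_
        rw [hZ, smul_zero]
        rw [RTree.order_mk, order]; omega
      simp only [numChildren, CharP.cast_eq_zero, zero_div, mul_zero, zero_smul,
        Finset.sum_const_zero, zero_add]
      rw [Finset.sum_comm]
      conv_rhs => rw [Finset.sum_comm]
      refine Finset.sum_congr rfl fun δ _ => ?_
      have h2 := congrArg (fun e => δ.weight • e) (ihδ δ)
      simp only [Finset.smul_sum, smul_smul] at h2
      refine Eq.trans (Finset.sum_congr rfl fun θ _ => ?_) (h2.trans ?_)
      · rw [RTree.mk_graft]; congr 1; ring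
      · refine Finset.sum_congr rfl fun θ _ => Finset.sum_congr rfl fun ε _ => ?_
        simp only [RTree.mk_graft, RTree.graft_swap (mk θ) (mk δ) (mk ε)]
        congr 1
        simp only [weight]
        push_cast
        field_simp
    rw [h1, ← Finset.sum_add_distrib]
    refine Finset.sum_congr rfl fun θ _ => ?_
    rw [← Finset.sum_add_distrib]
    refine Finset.sum_congr rfl fun δ _ => ?_
    rw [← add_smul]
    congr 1
    field_simp
    ring

theorem sum_cuts_of_inner (M : ℕ) (N : ℕ) (hN : N ≤ M) (Z : RTree → RTree → RTree → E)
    (hZ : ∀ a b c, N < RTree.order c → Z a b c = 0)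
    (h : ∑ τ ∈ treesLE M, τ.weight • (τ.innerCuts.map fun q => Z q.1 q.2 (mk τ)).sum =
      ∑ θ ∈ treesLE M, ∑ δ ∈ treesLE M, (θ.weight * δ.weight) •
        ((θ.innerAttach δ).map fun τ => Z (mk θ) (mk δ) (mk τ)).sum) :
    ∑ τ ∈ treesLE M, τ.weight • (τ.cuts.map fun q => Z q.1 q.2 (mk τ)).sum =
      ∑ θ ∈ treesLE M, ∑ δ ∈ treesLE M, (θ.weight * δ.weight) •
        ((θ.attach δ).map fun τ => Z (mk θ) (mk δ) (mk τ)).sum := by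
  have hr := sum_rootCuts M N hN (fun _ => 1) Z hZ
  simp only [one_mul] at hr
  simp only [cuts_eq_add, Multiset.map_add, Multiset.sum_add, smul_add, Finset.sum_add_distrib,
    sum_attach, hr, h]

/-- The sum over the cuts away from the root. An inner edge of `graft θ δ` is an inner edge of `θ`
or any edge of `δ`, so that the induction on the size of the trees also uses the statement for all
cuts, `sum_cuts_of_inner`. -/
theorem sum_innerCuts (M : ℕ) (N : ℕ) (hN : N ≤ M) (l : ℕ → ℝ) (Z : RTree → RTree → RTree → E)
    (hZ : ∀ a b c, N < RTree.order c → Z a b c = 0) :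
    ∑ τ ∈ treesLE M, (l τ.numChildren * τ.weight) •
        (τ.innerCuts.map fun q => Z q.1 q.2 (mk τ)).sum =
      ∑ θ ∈ treesLE M, ∑ δ ∈ treesLE M, (l θ.numChildren * (θ.weight * δ.weight)) •
        ((θ.innerAttach δ).map fun τ => Z (mk θ) (mk δ) (mk τ)).sum := by
  induction N generalizing l Z with
  | zero =>
    have h0 : ∀ a b c, Z a b c = 0 := fun a b c => hZ a b c c.order_pos
    simp [h0]
  | succ N ih =>
    have full : ∀ Z : RTree → RTree → RTree → E, (∀ a b c, N < RTree.order c → Z a b c = 0) →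
        ∑ τ ∈ treesLE M, τ.weight • (τ.cuts.map fun q => Z q.1 q.2 (mk τ)).sum =
          ∑ θ ∈ treesLE M, ∑ δ ∈ treesLE M, (θ.weight * δ.weight) •
            ((θ.attach δ).map fun τ => Z (mk θ) (mk δ) (mk τ)).sum := fun Z hZ =>
      sum_cuts_of_inner M N (by omega) Z hZ (by simpa using ih (by omega) (fun _ => 1) Z hZ)
    have hR := sum_treesLE M (fun θ => ∑ δ ∈ treesLE M, (l θ.numChildren *
      (θ.weight * δ.weight)) • ((θ.innerAttach δ).map fun τ => Z (mk θ) (mk δ) (mk τ)).sum) (by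
        intro τ hτ
        refine Finset.sum_eq_zero fun δ _ => ?_
        rw [List.map_congr_left (g := fun _ => (0 : E))]
        · simp
        · intro σ hσ
          have := order_of_mem_attach (innerAttach_subset hσ)
          exact hZ _ _ _ (by rw [RTree.order_mk]; omega))
    rw [hR, sum_treesLE M]
    swap
    · intro τ hτ
      have h0 : ∀ a b, Z a b (mk τ) = 0 := fun a b => hZ _ _ _ (by rw [RTree.order_mk]; omega)
      simp [h0]
    simp only [innerCuts, innerAttach, numChildren, weight, Multiset.map_zero, Multiset.sum_zero,
      smul_zero, zero_add, List.map_nil, List.sum_nil, Finset.sum_const_zero,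
      Multiset.map_add, Multiset.sum_add, Multiset.map_map, Function.comp_def, smul_add,
      Finset.sum_add_distrib, List.map_append, List.map_map, List.sum_append]
    congr 1
    · rw [Finset.sum_comm]
      conv_rhs => rw [Finset.sum_comm]
      refine Finset.sum_congr rfl fun ε _ => ?_
      have h2 := congrArg (fun e => ε.weight • e) (ih (by omega) (fun n => l (n + 1) / (n + 1))
        (fun a b c => Z (a.graft (mk ε)) b (c.graft (mk ε))) fun a b c hc => hZ _ _ _ (by
          have := ε.order_pos
          rw [RTree.order_graft, RTree.order_mk]; omega))
      simp only [Finset.smul_sum, smul_smul] at h2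
      refine Eq.trans (Finset.sum_congr rfl fun θ _ => ?_) (h2.trans ?_)
      · rw [RTree.mk_graft]; congr 1; ring
      · refine Finset.sum_congr rfl fun θ _ => Finset.sum_congr rfl fun δ _ => ?_
        simp only [RTree.mk_graft]
        congr 1
        ring
    · refine Finset.sum_congr rfl fun θ _ => ?_
      have h2 := congrArg (fun e => (l (θ.numChildren + 1) / (θ.numChildren + 1) * θ.weight) • e)
        (full (fun a b c => Z ((mk θ).graft a) b ((mk θ).graft c)) fun a b c hc => hZ _ _ _ (by
          have := θ.order_pos
          rw [RTree.order_graft, RTree.order_mk]; omega))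
      simp only [Finset.smul_sum, smul_smul] at h2
      refine Eq.trans (Finset.sum_congr rfl fun ε _ => ?_) (h2.trans ?_)
      · rw [RTree.mk_graft]; congr 1; ring
      · refine Finset.sum_congr rfl fun ε _ => Finset.sum_congr rfl fun δ _ => ?_
        simp only [RTree.mk_graft]
        congr 1
        ring

/-- Cutting is adjoint to attaching: the sum over all trees `τ` and all edges of `τ` equals the sum
over all pairs of trees and all ways to attach the second one to the first one. -/
theorem sum_cuts (N : ℕ) (Z : RTree → RTree → RTree → E)
    (hZ : ∀ a b c, N < RTree.order c → Z a b c = 0) :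
    ∑ τ ∈ treesLE N, τ.weight • (τ.cuts.map fun q => Z q.1 q.2 (mk τ)).sum =
      ∑ θ ∈ treesLE N, ∑ δ ∈ treesLE N, (θ.weight * δ.weight) •
        ((θ.attach δ).map fun τ => Z (mk θ) (mk δ) (mk τ)).sum :=
  sum_cuts_of_inner N N le_rfl Z hZ (by simpa using sum_innerCuts N N le_rfl (fun _ => 1) Z hZ)

end Sums

end PTree

/-! ### Counting monotone labellings -/

namespace PTree

theorem childDensity_pos (τ : PTree) : 0 < τ.childDensity := by
  induction τ with
  | leaf => simp [childDensity]
  | graft τ δ h h' => exact Nat.mul_pos h (Nat.mul_pos δ.order_pos h')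

theorem density_pos (τ : PTree) : 0 < τ.density := Nat.mul_pos τ.order_pos τ.childDensity_pos

theorem Iso.grow_map_mk {τ τ' : PTree} (h : Iso τ τ') :
    (τ.grow.map mk : Multiset RTree) = τ'.grow.map mk := by
  induction h with
  | refl => rfl
  | symm _ ih => exact ih.symm
  | trans _ _ ih ih' => exact ih.trans ih'
  | @congr τ τ' δ δ' h h' ih ih' =>
    have key : ∀ τ δ : PTree, ((graft τ δ).grow.map mk : Multiset RTree) =
        (τ.grow.map mk : Multiset RTree).map (fun θ => θ.graft (mk δ)) +
          (δ.grow.map mk : Multiset RTree).map (fun θ => (mk τ).graft θ) := by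
      intro τ δ
      simp only [grow, List.map_append, List.map_map, Multiset.map_coe, Multiset.coe_add]
      rfl
    rw [key, key, ih, ih', RTree.mk_eq h, RTree.mk_eq h']
  | swap τ δ ε =>
    simp only [grow, List.map_append, List.map_map, Function.comp_def, RTree.mk_graft,
      ← Multiset.coe_add, RTree.graft_swap (mk τ) _ (mk ε), RTree.graft_swap _ (mk ε) (mk δ)]
    simp only [RTree.graft_swap (mk τ) (mk δ)]
    abel

end PTree

theorem RTree.density_pos (τ : RTree) : 0 < τ.density := Quotient.inductionOn τ PTree.density_pos

/-- The sum of `φ` over all trees that arise from `τ` by attaching one leaf depends only on the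
isomorphism class of `τ`. -/
theorem exists_sum_grow {E : Type*} [AddCommMonoid E] (φ : RTree → E) :
    ∃ ψ : RTree → E, ∀ τ : PTree, ψ (mk τ) = (τ.grow.map fun θ => φ (mk θ)).sum := by
  refine ⟨fun τ => Quotient.liftOn τ (fun τ => ((τ.grow.map mk : Multiset RTree).map φ).sum)
    fun _ _ h => by rw [PTree.Iso.grow_map_mk h], fun τ => ?_⟩
  change ((τ.grow.map mk : Multiset RTree).map φ).sum = _
  simp [Function.comp_def]

namespace PTree

theorem one_div_childDensity (τ : PTree) :
    1 / (τ.childDensity : ℝ) = τ.order / (τ.density : ℝ) := by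
  have h1 := τ.order_pos
  have h2 := τ.childDensity_pos
  rw [density]
  push_cast
  field_simp

theorem order_div_density_graft (θ δ : RTree) :
    ((θ.graft δ).order : ℝ) / (θ.graft δ).density =
      (θ.order / θ.density) * (1 / (δ.density : ℝ)) := by
  refine Quotient.inductionOn₂ θ δ fun θ δ => ?_
  change ((graft θ δ).order : ℝ) / (graft θ δ).density =
    (θ.order / θ.density) * (1 / (δ.density : ℝ))
  rw [← one_div_childDensity, ← one_div_childDensity, childDensity, density]
  push_cast
  rw [one_div_mul_one_div]

open Classical in
/-- Removing, in all possible ways, a leaf other than the root. The function `ρ(τ) / γ(τ)`, the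
product of the reciprocal densities of the children of the root, is multiplicative under grafting,
which gives the claim by induction on `τ`. -/
theorem sum_leaf_cuts_aux (τ : PTree) :
    (τ.cuts.map fun q => if q.2 = RTree.leaf then (q.1.order : ℝ) / q.1.density else 0).sum =
      (τ.order - 1) * (τ.order / τ.density) := by
  induction τ with
  | leaf => simp [cuts, order]
  | graft θ δ ih ih' =>
    have h1 : ((graft θ δ).order : ℝ) / (graft θ δ).density =
      (θ.order / θ.density) * (1 / (δ.density : ℝ)) := order_div_density_graft (mk θ) (mk δ)
    have hθ : (θ.cuts.map fun q => if q.2 = RTree.leaf then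
        ((q.1.graft (mk δ)).order : ℝ) / (q.1.graft (mk δ)).density else 0).sum =
        (θ.order - 1) * (θ.order / θ.density) * (1 / (δ.density : ℝ)) := by
      rw [← ih, ← Multiset.sum_map_mul_right]
      refine congrArg _ (Multiset.map_congr rfl fun q _ => ?_)
      split_ifs
      · rw [order_div_density_graft]; rfl
      · simp
    simp only [cuts, Multiset.map_cons, Multiset.sum_cons, Multiset.map_add, Multiset.sum_add,
      Multiset.map_map, Function.comp_def, hθ, h1]
    simp only [order, RTree.order_mk, RTree.density_mk]
    by_cases hδ : mk δ = RTree.leaf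
    · have hδ1 : δ.order = 1 := by rw [← RTree.order_mk, hδ]; rfl
      have hδ2 : δ = leaf := by
        cases δ with
        | leaf => rfl
        | graft a b =>
          have := a.order_pos
          have := b.order_pos
          simp only [order] at hδ1
          omega
      subst hδ2
      simp [cuts, order, density, childDensity, RTree.leaf]
      ring
    · have hδ1 : δ.order ≠ 1 := fun h => hδ (RTree.eq_leaf_of_order h)
      have hδ2 := δ.order_pos
      have hδ3 : (δ.order : ℝ) - 1 ≠ 0 := by
        rw [sub_ne_zero]; exact_mod_cast hδ1
      have hδ' : (δ.cuts.map fun q => if q.2 = RTree.leaf then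
          (((mk θ).graft q.1).order : ℝ) / ((mk θ).graft q.1).density else 0).sum =
          (δ.order - 1) * (δ.order / δ.density) * (θ.order / θ.density / (δ.order - 1)) := by
        rw [← ih', ← Multiset.sum_map_mul_right]
        refine congrArg _ (Multiset.map_congr rfl fun q hq => ?_)
        split_ifs with hq2
        · have h2 := order_add_of_mem_cuts δ q hq
          rw [hq2, RTree.order_leaf] at h2
          have h3 : (δ.order : ℝ) - 1 = q.1.order := by rw [← h2]; push_cast; ring
          have h4 := q.1.order_pos
          have h5 := q.1.density_pos
          rw [order_div_density_graft, h3]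
          simp only [RTree.order_mk, RTree.density_mk]
          field_simp
        · simp
      rw [if_neg hδ, hδ']
      push_cast
      field_simp
      ring

open Classical in
/-- The recursion `ρ(τ) / γ(τ) = ∑ 1 / γ(τ')`, where `τ'` runs through the trees left over when a
leaf is removed from `τ`: in a monotone labelling, the last vertex is a leaf. -/
theorem sum_leaf_cuts (τ : PTree) (hτ : 2 ≤ τ.order) :
    (τ.cuts.map fun q => if q.2 = RTree.leaf then 1 / (q.1.density : ℝ) else 0).sum =
      τ.order / τ.density := by
  have h0 : (τ.order : ℝ) - 1 ≠ 0 := by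
    rw [sub_ne_zero]
    exact_mod_cast (by omega : τ.order ≠ 1)
  rw [← mul_right_inj' h0, ← sum_leaf_cuts_aux, ← Multiset.sum_map_mul_left]
  refine congrArg _ (Multiset.map_congr rfl fun q hq => ?_)
  split_ifs with hq2
  · have h2 := order_add_of_mem_cuts τ q hq
    rw [hq2, RTree.order_leaf] at h2
    rw [← h2]
    push_cast
    ring
  · simp

open Classical in
/-- The sum over all monotonically labelled trees with `n + 1` vertices. The induction removes the
vertex with the last label; `sum_cuts` turns growing trees by a leaf into cutting off leaves. -/
theorem sum_monotoneTrees {E : Type*} [AddCommGroup E] [Module ℝ E] (n : ℕ) (φ : RTree → E) (M : ℕ)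
    (hM : n + 1 ≤ M) :
    ((monotoneTrees (n + 1)).map fun τ => φ (mk τ)).sum =
      ((n + 1).factorial : ℝ) • ∑ τ ∈ treesLE M,
        if τ.order = n + 1 then (τ.weight / τ.density) • φ (mk τ) else 0 := by
  induction n generalizing φ with
  | zero =>
    rw [Finset.sum_eq_single leaf]
    · simp [monotoneTrees, order, weight, density, childDensity]
    · intro τ _ hτ
      refine if_neg fun h => hτ ?_
      cases τ with
      | leaf => rfl
      | graft a b =>
        have := a.order_pos
        have := b.order_pos
        simp only [order] at h
        omega
    · intro h
      exact absurd (mem_treesLE.2 (by simp only [order]; omega)) h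
  | succ n ih =>
    obtain ⟨ψ, hψ⟩ := exists_sum_grow φ
    have h1 : ((monotoneTrees (n + 1 + 1)).map fun τ => φ (mk τ)).sum =
        ((monotoneTrees (n + 1)).map fun τ => ψ (mk τ)).sum := by
      have hl : ∀ l : List PTree, ((l.flatMap grow).map fun τ => φ (mk τ)).sum =
          (l.map fun τ => ψ (mk τ)).sum := by
        intro l
        induction l with
        | nil => rfl
        | cons a l ihl => simp only [List.flatMap_cons, List.map_append, List.sum_append, ihl, hψ,
            List.map_cons, List.sum_cons]
      exact hl _
    have h2 := sum_cuts M (fun a b c => if b = RTree.leaf ∧ RTree.order c = n + 1 + 1 then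
      (1 / (a.density : ℝ)) • φ c else 0) (by
        intro a b c hc
        exact if_neg fun h => by omega)
    have h3 : ∀ τ : PTree, (τ.cuts.map fun q => if q.2 = RTree.leaf ∧
        (mk τ).order = n + 1 + 1 then (1 / (q.1.density : ℝ)) • φ (mk τ) else 0).sum =
        if τ.order = n + 1 + 1 then ((n + 1 + 1 : ℕ) / (τ.density : ℝ)) • φ (mk τ) else 0 := by
      intro τ
      rw [RTree.order_mk]
      split_ifs with hτ
      · rw [← hτ, ← sum_leaf_cuts τ (by omega), Multiset.sum_smul, Multiset.map_map]
        refine congrArg _ (Multiset.map_congr rfl fun q _ => ?_)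
        simp only [and_true, ite_smul, zero_smul, Function.comp_def]
      · simp [hτ]
    have h4 : ∀ θ : PTree, ∑ δ ∈ treesLE M, (θ.weight * δ.weight) •
        ((θ.attach δ).map fun τ => if mk δ = RTree.leaf ∧ (mk τ).order = n + 1 + 1 then
          (1 / ((mk θ).density : ℝ)) • φ (mk τ) else 0).sum =
        if θ.order = n + 1 then (θ.weight / θ.density) • ψ (mk θ) else 0 := by
      intro θ
      rw [Finset.sum_eq_single leaf]
      · rw [List.map_congr_left (g := fun τ => if θ.order = n + 1 then
          (1 / (θ.density : ℝ)) • φ (mk τ) else 0)]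
        · split_ifs
          · rw [hψ, grow_eq_attach, weight, mul_one, div_eq_mul_one_div θ.weight, mul_smul,
              List.smul_sum (r := 1 / (θ.density : ℝ)), List.map_map]
            rfl
          · simp
        · intro τ hτ
          have := order_of_mem_attach hτ
          simp only [order] at this
          have h5 : mk leaf = RTree.leaf := rfl
          simp only [RTree.order_mk, this, h5, true_and, add_left_inj, RTree.density_mk]
      · intro δ _ hδ
        have : mk δ ≠ RTree.leaf := by
          intro h
          refine hδ ?_
          cases δ with
          | leaf => rfl
          | graft a b =>
            have h1 := a.order_pos
            have h2 := b.order_pos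
            have h3 := congrArg RTree.order h
            rw [RTree.order_mk, RTree.order_leaf, order] at h3
            omega
        simp [this]
      · intro h
        exact absurd (mem_treesLE.2 (by simp only [order]; omega)) h
    simp only [h3, h4] at h2
    rw [h1, ih ψ (by omega), ← h2, Finset.smul_sum, Finset.smul_sum]
    refine Finset.sum_congr rfl fun τ _ => ?_
    split_ifs
    · simp only [smul_smul, Nat.factorial_succ (n + 1)]
      congr 1
      push_cast
      ring
    · simp

end PTree

open PTree in
open Classical in
/-- The weight `α(τ) / ρ(τ)!` of a B-series, as a sum over the orderings of `τ`. -/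
theorem RTree.numLabellings_div_factorial (τ : RTree) (N : ℕ) (hN : τ.order ≤ N) :
    (τ.numLabellings : ℝ) / τ.order.factorial =
      ∑ σ ∈ treesLE N, if mk σ = τ then σ.weight / σ.density else 0 := by
  have hp := τ.order_pos
  obtain ⟨n, hn⟩ : ∃ n, τ.order = n + 1 := ⟨τ.order - 1, by omega⟩
  have h := sum_monotoneTrees n (fun σ => if σ = τ then (1 : ℝ) else 0) N (by omega)
  have hc : ∀ l : List PTree, (l.map fun σ => if mk σ = τ then (1 : ℝ) else 0).sum =
      l.countP fun σ => mk σ = τ := by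
    intro l
    induction l with
    | nil => simp
    | cons a l ihl =>
      rw [List.map_cons, List.sum_cons, ihl, List.countP_cons]
      by_cases h : mk a = τ <;> simp [h, add_comm]
  rw [hc] at h
  rw [numLabellings, hn, h, smul_eq_mul, mul_div_cancel_left₀ _ (by positivity)]
  refine Finset.sum_congr rfl fun σ _ => ?_
  by_cases hσ : mk σ = τ
  · have : σ.order = n + 1 := by rw [← hn, ← hσ]; rfl
    simp [hσ, this]
  · simp [hσ]

open PTree in
/-- A sum over rooted trees with the weights `α(τ) / ρ(τ)!` as a sum over ordered trees. -/
theorem RTree.sum_treesTwoTo {E : Type*} [AddCommGroup E] [Module ℝ E] (N : ℕ) (φ : RTree → E) :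
    ∑ τ ∈ treesTwoTo N, ((τ.numLabellings : ℝ) / τ.order.factorial) • φ τ =
      ∑ σ ∈ treesLE N, if 2 ≤ σ.order then (σ.weight / σ.density) • φ (mk σ) else 0 := by
  classical
  have h : ∀ τ ∈ treesTwoTo N, ((τ.numLabellings : ℝ) / τ.order.factorial) • φ τ =
      ∑ σ ∈ treesLE N, if mk σ = τ then (σ.weight / σ.density) • φ τ else 0 := by
    intro τ hτ
    rw [RTree.numLabellings_div_factorial τ N (mem_treesTwoTo.1 hτ).2, Finset.sum_smul]
    simp only [ite_smul, zero_smul]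
  rw [Finset.sum_congr rfl h, Finset.sum_comm]
  refine Finset.sum_congr rfl fun σ hσ => ?_
  rw [Finset.sum_ite_eq]
  simp only [mem_treesTwoTo, RTree.order_mk, mem_treesLE.1 hσ, and_true]

/-! ### Derivatives of elementary differentials -/

section ListDeriv

variable {W : Type u} [NormedAddCommGroup W] [NormedSpace ℝ W]

/-- The iterated derivative `g⁽ᵐ⁾(y)(v₁, …, vₘ)` for a list `v₁, …, vₘ` of directions. -/
noncomputable def listDeriv (g : W → W) (y : W) (l : List W) : W :=
  iteratedFDeriv ℝ l.length g y l.get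

theorem elemDiffP_eq (g : W → W) (τ : PTree) (y : W) :
    elemDiffP g τ y = listDeriv g y (childDiffs g y τ) := rfl

theorem childDiffs_graft (g : W → W) (τ δ : PTree) (y : W) :
    childDiffs g y (.graft τ δ) = elemDiffP g δ y :: childDiffs g y τ := rfl

theorem listDeriv_nil (g : W → W) (y : W) : listDeriv g y [] = g y := by
  simp [listDeriv]

theorem norm_listDeriv_replicate_le (g : W → W) (y u : W) (m : ℕ) :
    ‖listDeriv g y (List.replicate m u)‖ ≤ ‖iteratedFDeriv ℝ m g y‖ * ‖u‖ ^ m := by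
  have h := (iteratedFDeriv ℝ (List.replicate m u).length g y).le_opNorm (List.replicate m u).get
  simp only [List.get_eq_getElem, List.getElem_replicate, Finset.prod_const, Finset.card_univ,
    Fintype.card_fin, List.length_replicate] at h
  exact h.trans_eq (by rw [List.length_replicate])

theorem elemDiffP_leaf (g : W → W) (y : W) : elemDiffP g .leaf y = g y := listDeriv_nil g y

variable {g : W → W}

theorem listDeriv_cons (hg : ContDiff ℝ ∞ g) (y v : W) (l : List W) :
    listDeriv g y (v :: l) = fderiv ℝ (fun x => listDeriv g x l) y v := iteratedFDeriv_cons hg y v l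

theorem listDeriv_perm (hg : ContDiff ℝ ∞ g) (y : W) {l l' : List W} (h : l.Perm l') :
    listDeriv g y l = listDeriv g y l' := iteratedFDeriv_perm hg y h

/-- `listDeriv` is smooth in the base point and in all directions. -/
theorem contDiff_listDeriv (hg : ContDiff ℝ ∞ g) (n : ℕ) :
    ∀ {E : Type u} [NormedAddCommGroup E] [NormedSpace ℝ E] (l : List (E → W)), l.length = n →
      (∀ f ∈ l, ContDiff ℝ ∞ f) → ∀ {φ : E → W}, ContDiff ℝ ∞ φ →
        ContDiff ℝ ∞ fun z => listDeriv g (φ z) (l.map fun f => f z) := by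
  induction n with
  | zero =>
    intro E _ _ l hl _ φ hφ
    rw [List.length_eq_zero_iff] at hl
    subst hl
    simp only [List.map_nil, listDeriv_nil]
    exact hg.comp hφ
  | succ n ih =>
    intro E _ _ l hl hs φ hφ
    obtain ⟨f, l, rfl⟩ := List.exists_cons_of_length_eq_add_one hl
    simp only [List.map_cons, listDeriv_cons hg]
    have h1 : ContDiff ℝ ∞ (fun z : E × W => listDeriv g z.2 (l.map fun f => f z.1)) := by
      have := ih (E := E × W) (l.map fun f => fun z => f z.1) (by simpa using hl) (by
        intro f' hf'
        obtain ⟨f, hf, rfl⟩ := List.mem_map.1 hf'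
        exact (hs f (by simp [hf])).comp contDiff_fst) contDiff_snd
      simpa [List.map_map, Function.comp_def] using this
    exact (ContDiff.fderiv (n := ∞) (m := ∞)
      (f := fun z x => listDeriv g x (l.map fun f => f z)) h1 hφ (by simp)).clm_apply
      (hs f (by simp))

theorem contDiff_elemDiffP_aux (hg : ContDiff ℝ ∞ g) (τ : PTree) :
    ∃ l : List (W → W), (∀ f ∈ l, ContDiff ℝ ∞ f) ∧
      ∀ y, childDiffs g y τ = l.map fun f => f y := by
  induction τ with
  | leaf => exact ⟨[], by simp, fun y => rfl⟩
  | graft τ δ ih ih' =>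
    obtain ⟨l, hl, h⟩ := ih
    obtain ⟨l', hl', h'⟩ := ih'
    refine ⟨elemDiffP g δ :: l, ?_, fun y => by rw [childDiffs_graft, h]; rfl⟩
    intro f hf
    rcases List.mem_cons.1 hf with rfl | hf
    · have := contDiff_listDeriv hg _ l' rfl hl' (contDiff_id (𝕜 := ℝ) (E := W))
      simp only [← h', id] at this
      exact this
    · exact hl f hf

theorem contDiff_elemDiffP (hg : ContDiff ℝ ∞ g) (τ : PTree) : ContDiff ℝ ∞ (elemDiffP g τ) := by
  obtain ⟨l, hl, h⟩ := contDiff_elemDiffP_aux hg τ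
  have := contDiff_listDeriv hg _ l rfl hl (contDiff_id (𝕜 := ℝ) (E := W))
  simp only [← h, id] at this
  exact this

theorem fderiv_diag {F : W × W → W} (hF : ContDiff ℝ ∞ F) (x v : W) :
    fderiv ℝ (fun b => F (b, b)) x v =
      fderiv ℝ (fun b => F (b, x)) x v + fderiv ℝ (fun b => F (x, b)) x v := by
  have hd := (hF.differentiable (by simp) (x, x)).hasFDerivAt
  have h1 : HasFDerivAt (fun b => F (b, b)) _ x :=
    HasFDerivAt.comp (f := fun b => (b, b)) x hd ((hasFDerivAt_id x).prodMk (hasFDerivAt_id x))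
  have h2 : HasFDerivAt (fun b => F (b, x)) _ x :=
    HasFDerivAt.comp (f := fun b => (b, x)) x hd ((hasFDerivAt_id x).prodMk (hasFDerivAt_const x x))
  have h3 : HasFDerivAt (fun b => F (x, b)) _ x :=
    HasFDerivAt.comp (f := fun b => (x, b)) x hd ((hasFDerivAt_const x x).prodMk (hasFDerivAt_id x))
  rw [h1.fderiv, h2.fderiv, h3.fderiv]
  simp only [ContinuousLinearMap.comp_apply, ContinuousLinearMap.prod_apply, ← map_add]
  simp

theorem listDeriv_slot (hg : ContDiff ℝ ∞ g) (a v : W) (l l' : List W) :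
    listDeriv g a (l ++ v :: l') = fderiv ℝ (fun x => listDeriv g x (l ++ l')) a v := by
  rw [listDeriv_perm hg a List.perm_middle, listDeriv_cons hg]

theorem contDiff_listDeriv_childDiffs (hg : ContDiff ℝ ∞ g) {E : Type u} [NormedAddCommGroup E]
    [NormedSpace ℝ E] {φ χ : E → W} (hφ : ContDiff ℝ ∞ φ) (hχ : ContDiff ℝ ∞ χ) (l : List (E → W))
    (hl : ∀ f ∈ l, ContDiff ℝ ∞ f) (τ : PTree) :
    ContDiff ℝ ∞ fun z => listDeriv g (φ z) (l.map (fun f => f z) ++ childDiffs g (χ z) τ) := by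
  obtain ⟨l', hl', h⟩ := contDiff_elemDiffP_aux hg τ
  have := contDiff_listDeriv hg _ (l ++ l'.map fun f => f ∘ χ) rfl (by
    intro f hf
    rcases List.mem_append.1 hf with hf | hf
    · exact hl f hf
    · obtain ⟨f', hf', rfl⟩ := List.mem_map.1 hf
      exact (hl' f' hf').comp hχ) hφ
  simpa [h, List.map_append, List.map_map, Function.comp_def] using this

/-- The derivative of `F(τ)` in the direction `F(δ)` is the sum of `F` over all trees that arise by
attaching `δ` to `τ`; the second claim concerns the derivative through the inner vertices. -/
theorem fderiv_elemDiffP_aux (hg : ContDiff ℝ ∞ g) (x : W) (τ δ : PTree) :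
    fderiv ℝ (elemDiffP g τ) x (elemDiffP g δ x) =
        ((τ.attach δ).map fun σ => elemDiffP g σ x).sum ∧
      ∀ (a : W) (l : List W),
        fderiv ℝ (fun b => listDeriv g a (l ++ childDiffs g b τ)) x (elemDiffP g δ x) =
          ((τ.innerAttach δ).map fun σ => listDeriv g a (l ++ childDiffs g x σ)).sum := by
  have hmain : ∀ τ : PTree, (∀ (a : W) (l : List W),
      fderiv ℝ (fun b => listDeriv g a (l ++ childDiffs g b τ)) x (elemDiffP g δ x) =
        ((τ.innerAttach δ).map fun σ => listDeriv g a (l ++ childDiffs g x σ)).sum) →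
      fderiv ℝ (elemDiffP g τ) x (elemDiffP g δ x) =
        ((τ.attach δ).map fun σ => elemDiffP g σ x).sum := by
    intro τ h
    have h1 := PTree.sum_attach (fun σ => elemDiff g σ x) τ δ
    simp only [elemDiff_mk hg] at h1
    have hs := contDiff_listDeriv_childDiffs hg (E := W × W) contDiff_fst contDiff_snd []
      (by simp) τ
    simp only [List.map_nil, List.nil_append] at hs
    have h2 := fderiv_diag hs x (elemDiffP g δ x)
    have h3 := h x []
    simp only [List.nil_append] at h3
    rw [h1]
    refine h2.trans ?_
    simp only [h3]
    rw [← listDeriv_cons hg, elemDiffP_eq g (.graft τ δ), childDiffs_graft]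
    rfl
  induction τ with
  | leaf =>
    have h : ∀ (a : W) (l : List W),
        fderiv ℝ (fun b => listDeriv g a (l ++ childDiffs g b .leaf)) x (elemDiffP g δ x) =
          ((PTree.leaf.innerAttach δ).map fun σ => listDeriv g a (l ++ childDiffs g x σ)).sum := by
      intro a l
      simp [childDiffs, PTree.innerAttach]
    exact ⟨hmain _ h, h⟩
  | graft τ ε ih ih' =>
    refine (and_iff_right_of_imp (hmain _)).2 fun a l => ?_
    have h2 := fderiv_diag (F := fun z : W × W => listDeriv g a
      (l ++ elemDiffP g ε z.1 :: childDiffs g z.2 τ)) (by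
        have := contDiff_listDeriv_childDiffs hg (E := W × W) (contDiff_const (c := a)) contDiff_snd
          (l.map (fun v _ => v) ++ [fun z => elemDiffP g ε z.1]) (by
            intro f hf
            rcases List.mem_append.1 hf with hf | hf
            · obtain ⟨f, hf, rfl⟩ := List.mem_map.1 hf
              exact contDiff_const
            · rw [List.mem_singleton.1 hf]
              exact (contDiff_elemDiffP hg ε).comp contDiff_fst) τ
        simpa [Function.comp_def] using this) x (elemDiffP g δ x)
    simp only [childDiffs_graft]
    refine h2.trans ?_
    simp only [listDeriv_slot hg]
    have h3 : fderiv ℝ (fun b => fderiv ℝ (fun y => listDeriv g y (l ++ childDiffs g x τ)) a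
        (elemDiffP g ε b)) x (elemDiffP g δ x) =
        fderiv ℝ (fun y => listDeriv g y (l ++ childDiffs g x τ)) a
          (fderiv ℝ (elemDiffP g ε) x (elemDiffP g δ x)) :=
      congrArg (fun L : W →L[ℝ] W => L (elemDiffP g δ x))
        ((fderiv ℝ (fun y => listDeriv g y (l ++ childDiffs g x τ)) a).hasFDerivAt.comp x
          ((contDiff_elemDiffP hg ε).differentiable (by simp) x).hasFDerivAt).fderiv
    have h4 := ih.2 a (l ++ [elemDiffP g ε x])
    simp only [List.append_assoc, List.singleton_append] at h4
    simp only [← listDeriv_slot hg (v := elemDiffP g ε x)]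
    rw [h3, h4, ih'.1, map_list_sum, PTree.innerAttach, List.map_append, List.sum_append,
      List.map_map, List.map_map, List.map_map, add_comm]
    congr 2
    refine List.map_congr_left fun σ _ => ?_
    simp only [Function.comp_def, childDiffs_graft, listDeriv_slot hg]

theorem fderiv_elemDiffP (hg : ContDiff ℝ ∞ g) (x : W) (τ δ : PTree) :
    fderiv ℝ (elemDiffP g τ) x (elemDiffP g δ x) =
      ((τ.attach δ).map fun σ => elemDiffP g σ x).sum := (fderiv_elemDiffP_aux hg x τ δ).1

/-! ### Substituting a B-series into the vector field -/

/-- The trees whose root has exactly `m` children, all of them with at most `n` vertices. -/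
noncomputable def PTree.bushes (n : ℕ) : ℕ → Finset PTree
  | 0 => {.leaf}
  | m + 1 => (PTree.bushes n m ×ˢ PTree.treesLE n).map
      ⟨fun q => .graft q.1 q.2, PTree.graft_injective⟩

theorem PTree.numChildren_of_mem_bushes {n m : ℕ} {τ : PTree} (h : τ ∈ bushes n m) :
    τ.numChildren = m := by
  induction m generalizing τ with
  | zero => rw [bushes, Finset.mem_singleton] at h; subst h; rfl
  | succ m ih =>
    simp only [bushes, Finset.mem_map, Finset.mem_product, Function.Embedding.coeFn_mk] at h
    obtain ⟨q, hq, rfl⟩ := h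
    simp only [numChildren, ih hq.1]

theorem PTree.mem_bushes {n : ℕ} {τ : PTree} (h : τ.order ≤ n + 1) :
    τ ∈ bushes n τ.numChildren := by
  induction τ with
  | leaf => simp [numChildren, bushes]
  | graft τ δ ih _ =>
    simp only [order] at h
    have := τ.order_pos
    have := δ.order_pos
    simp only [numChildren, bushes, Finset.mem_map, Finset.mem_product,
      Function.Embedding.coeFn_mk]
    exact ⟨(τ, δ), ⟨ih (by omega), mem_treesLE.2 (by simp only; omega)⟩, rfl⟩

theorem PTree.numChildren_lt_order (τ : PTree) : τ.numChildren < τ.order := by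
  induction τ with
  | leaf => simp [numChildren, order]
  | graft τ δ ih _ =>
    have := δ.order_pos
    simp only [numChildren, order]
    omega

open PTree in
/-- The multinomial theorem behind B-series: the `m`-th Taylor term `g⁽ᵐ⁾(u, …, u) / m!` for a
B-series `u` is the part of a B-series that consists of the trees with `m` children at the root. -/
theorem sum_bushes (hg : ContDiff ℝ ∞ g) (ψ χ : PTree → ℝ) (hleaf : χ .leaf = 1)
    (hgraft : ∀ θ δ : PTree, χ (.graft θ δ) = χ θ * ψ δ) (n m : ℕ) (a x : W) (l : List W) :
    ∑ θ ∈ bushes n m, (θ.weight * χ θ) • listDeriv g a (childDiffs g x θ ++ l) =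
      (1 / (m.factorial : ℝ)) • listDeriv g a
        (List.replicate m (∑ δ ∈ treesLE n, (δ.weight * ψ δ) • elemDiffP g δ x) ++ l) := by
  induction m generalizing l with
  | zero => simp [bushes, weight, hleaf, childDiffs]
  | succ m ih =>
    set u := ∑ δ ∈ treesLE n, (δ.weight * ψ δ) • elemDiffP g δ x with hu
    rw [bushes, Finset.sum_map, Finset.sum_product]
    simp only [Function.Embedding.coeFn_mk, weight, hgraft, childDiffs_graft, List.cons_append]
    have h1 : ∀ θ ∈ bushes n m, ∑ δ ∈ treesLE n,
        (θ.weight * δ.weight / (θ.numChildren + 1) * (χ θ * ψ δ)) •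
          listDeriv g a (elemDiffP g δ x :: (childDiffs g x θ ++ l)) =
        (1 / ((m : ℝ) + 1)) •
          ((θ.weight * χ θ) • listDeriv g a (childDiffs g x θ ++ (u :: l))) := by
      intro θ hθ
      rw [listDeriv_perm hg a (List.perm_middle (l₁ := childDiffs g x θ) (a := u) (l₂ := l)),
        listDeriv_cons hg, hu, map_sum, Finset.smul_sum, Finset.smul_sum]
      refine Finset.sum_congr rfl fun δ _ => ?_
      rw [map_smul, smul_smul, smul_smul, listDeriv_cons hg, numChildren_of_mem_bushes hθ]
      congr 1
      ring
    rw [Finset.sum_congr rfl h1, ← Finset.smul_sum, ih, smul_smul,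
      listDeriv_perm hg a (l' := List.replicate (m + 1) u ++ l)]
    · congr 1
      rw [Nat.factorial_succ]
      push_cast
      field_simp
    · rw [List.replicate_succ]
      exact List.perm_middle

end ListDeriv

/-! ### Remainders of high order in the step size -/

section HighOrder

variable {W : Type u} [NormedAddCommGroup W] [NormedSpace ℝ W]

/-- The function `R` of a step size `h` and a point `x` is `h ^ n` times a smooth function of
`(h, x)`. -/
def HighOrder (n : ℕ) (R : ℝ → W → W) : Prop :=
  ∃ S : ℝ × W → W, ContDiff ℝ ∞ S ∧ ∀ h x, R h x = h ^ n • S (h, x)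

namespace HighOrder

variable {n : ℕ} {R R' : ℝ → W → W}

theorem zero : HighOrder n (fun _ _ => (0 : W)) := ⟨fun _ => 0, contDiff_const, by simp⟩

theorem add (hR : HighOrder n R) (hR' : HighOrder n R') :
    HighOrder n fun h x => R h x + R' h x := by
  obtain ⟨S, hS, h⟩ := hR
  obtain ⟨S', hS', h'⟩ := hR'
  exact ⟨fun z => S z + S' z, hS.add hS', fun _ _ => by simp only [h, h', smul_add]⟩

theorem const_smul (c : ℝ) (hR : HighOrder n R) : HighOrder n fun h x => c • R h x := by
  obtain ⟨S, hS, h⟩ := hR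
  exact ⟨fun z => c • S z, contDiff_const.smul hS, fun t x => by simp only [h, smul_comm c]⟩

theorem sum {ι : Type*} (s : Finset ι) (R : ι → ℝ → W → W) (hR : ∀ i ∈ s, HighOrder n (R i)) :
    HighOrder n fun h x => ∑ i ∈ s, R i h x := by
  classical
  induction s using Finset.induction_on with
  | empty => simpa using zero
  | insert i s hi ih =>
    simp only [Finset.sum_insert hi]
    exact (hR i (by simp)).add (ih fun j hj => hR j (by simp [hj]))

theorem pow_smul {m : ℕ} (hm : n ≤ m) {G : W → W} (hG : ContDiff ℝ ∞ G) :
    HighOrder n fun h x => h ^ m • G x :=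
  ⟨fun z => z.1 ^ (m - n) • G z.2, (contDiff_fst.pow _).smul (hG.comp contDiff_snd), fun h x => by
    rw [smul_smul, ← pow_add, Nat.add_sub_cancel' hm]⟩

theorem fderiv_apply (hR : HighOrder n R) {φ : ℝ → W → W}
    (hφ : ContDiff ℝ ∞ fun z : ℝ × W => φ z.1 z.2) :
    HighOrder n fun h x => fderiv ℝ (R h) x (φ h x) := by
  obtain ⟨S, hS, h⟩ := hR
  refine ⟨fun z => fderiv ℝ (fun x => S (z.1, x)) z.2 (φ z.1 z.2), ?_, fun t x => ?_⟩
  · refine ContDiff.clm_apply ?_ hφ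
    exact ContDiff.fderiv (n := ∞) (f := fun (z : ℝ × W) x => S (z.1, x))
      (hS.comp ((contDiff_fst.comp contDiff_fst).prodMk contDiff_snd)) contDiff_snd (by simp)
  · have hd : DifferentiableAt ℝ (fun x => S (t, x)) x :=
      (hS.comp (contDiff_const.prodMk contDiff_id)).differentiable (by simp) x
    have hR : R t = fun x => t ^ n • S (t, x) := funext fun x => h t x
    simp only [hR, fderiv_fun_const_smul hd]
    rfl

end HighOrder

/-! ### The modified equation -/

/-- The B-series of `c` without the term `c(∅) x`, truncated after the trees with `N` vertices. -/
noncomputable def bSeries (g : W → W) (N : ℕ) (c : Coeff) (h : ℝ) (x : W) : W :=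
  ∑ τ ∈ PTree.treesLE N,
    (h ^ τ.order * (τ.weight * (c (some (mk τ)) / τ.density))) • elemDiffP g τ x

/-- The truncated vector field `(1 / h) B(b, x)` of the modified equation. -/
noncomputable def modifiedField (g : W → W) (N : ℕ) (b : Coeff) (h : ℝ) (x : W) : W :=
  ∑ τ ∈ PTree.treesLE N,
    (h ^ (τ.order - 1) * (τ.weight * (b (some (mk τ)) / τ.density))) • elemDiffP g τ x

/-- The iterated Lie derivatives of the identity along the vector field `φ`: the `j`-th one,
evaluated along a solution of `x' = φ(x)`, is the `j`-th derivative of the solution. -/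
noncomputable def flowDeriv (φ : W → W) : ℕ → W → W
  | 0 => id
  | j + 1 => fun x => fderiv ℝ (flowDeriv φ j) x (φ x)

variable {g : W → W}

theorem smul_modifiedField (N : ℕ) (b : Coeff) (h : ℝ) (x : W) :
    h • modifiedField g N b h x = bSeries g N b h x := by
  rw [modifiedField, bSeries, Finset.smul_sum]
  refine Finset.sum_congr rfl fun τ _ => ?_
  rw [smul_smul, ← mul_assoc, ← pow_succ', Nat.sub_add_cancel τ.order_pos]

theorem contDiff_modifiedField (hg : ContDiff ℝ ∞ g) (N : ℕ) (b : Coeff) :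
    ContDiff ℝ ∞ fun z : ℝ × W => modifiedField g N b z.1 z.2 :=
  ContDiff.sum fun τ _ => ((contDiff_fst.pow _).mul contDiff_const).smul
    ((contDiff_elemDiffP hg τ).comp contDiff_snd)

theorem contDiff_bSeries (hg : ContDiff ℝ ∞ g) (N : ℕ) (c : Coeff) :
    ContDiff ℝ ∞ fun z : ℝ × W => bSeries g N c z.1 z.2 :=
  ContDiff.sum fun τ _ => ((contDiff_fst.pow _).mul contDiff_const).smul
    ((contDiff_elemDiffP hg τ).comp contDiff_snd)

theorem contDiff_flowDeriv {φ : ℝ → W → W} (hφ : ContDiff ℝ ∞ fun z : ℝ × W => φ z.1 z.2) (j : ℕ) :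
    ContDiff ℝ ∞ fun z : ℝ × W => flowDeriv (φ z.1) j z.2 := by
  induction j with
  | zero => exact contDiff_snd
  | succ j ih =>
    refine ContDiff.clm_apply ?_ hφ
    exact ContDiff.fderiv (n := ∞) (f := fun (z : ℝ × W) x => flowDeriv (φ z.1) j x)
      (ih.comp ((contDiff_fst.comp contDiff_fst).prodMk contDiff_snd)) contDiff_snd (by simp)

theorem fderiv_bSeries (hg : ContDiff ℝ ∞ g) (N : ℕ) (c : Coeff) (h : ℝ) (x v : W) :
    fderiv ℝ (bSeries g N c h) x v = ∑ τ ∈ PTree.treesLE N,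
      (h ^ τ.order * (τ.weight * (c (some (mk τ)) / τ.density))) •
        fderiv ℝ (elemDiffP g τ) x v := by
  have hd : ∀ τ, DifferentiableAt ℝ (elemDiffP g τ) x := fun τ =>
    (contDiff_elemDiffP hg τ).differentiable (by simp) x
  have := HasFDerivAt.fun_sum (u := PTree.treesLE N) (x := x) fun τ _ =>
    ((hd τ).hasFDerivAt.const_smul (h ^ τ.order * (τ.weight * (c (some (mk τ)) / τ.density))))
  rw [show bSeries g N c h = _ from rfl] at *
  refine (congrArg (fun L : W →L[ℝ] W => L v) this.fderiv).trans ?_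
  simp

theorem cast_density_ne_zero (τ : PTree) : (τ.density : ℝ) ≠ 0 :=
  Nat.cast_ne_zero.2 τ.density_pos.ne'

theorem multiset_sum_smul {ι : Type*} (s : Multiset ι) (r : ι → ℝ) (e : W) :
    (s.map fun q => r q • e).sum = (s.map r).sum • e := by
  rw [Multiset.sum_smul, Multiset.map_map]
  rfl

theorem list_sum_smul {ι : Type*} (l : List ι) (r : ℝ) (f : ι → W) :
    (l.map fun q => r • f q).sum = r • (l.map f).sum := by
  rw [List.smul_sum, List.map_map]
  rfl

/-- The Lie derivative of a B-series along a B-series is the B-series with the coefficients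
`lieDeriv b c`. -/
theorem highOrder_lieDeriv (hg : ContDiff ℝ ∞ g) (N : ℕ) (b c : Coeff) (hc : c none = 0) :
    HighOrder (N + 1) fun h x => fderiv ℝ (bSeries g N c h) x (bSeries g N b h x) -
      bSeries g N (lieDeriv b c) h x := by
  have h1 : ∀ h x, fderiv ℝ (bSeries g N c h) x (bSeries g N b h x) =
      ∑ θ ∈ PTree.treesLE N, ∑ δ ∈ PTree.treesLE N, (θ.weight * δ.weight *
        (c (some (mk θ)) / θ.density * (b (some (mk δ)) / δ.density)) *
        h ^ (θ.order + δ.order)) • ((θ.attach δ).map fun σ => elemDiffP g σ x).sum := by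
    intro h x
    rw [fderiv_bSeries hg]
    refine Finset.sum_congr rfl fun θ _ => ?_
    rw [bSeries, map_sum, Finset.smul_sum]
    refine Finset.sum_congr rfl fun δ _ => ?_
    rw [map_smul, fderiv_elemDiffP hg, smul_smul]
    congr 1
    ring
  have h2 : ∀ h x, bSeries g N (lieDeriv b c) h x =
      ∑ θ ∈ PTree.treesLE N, ∑ δ ∈ PTree.treesLE N, if θ.order + δ.order ≤ N then
        (θ.weight * δ.weight * (c (some (mk θ)) / θ.density * (b (some (mk δ)) / δ.density)) *
          h ^ (θ.order + δ.order)) • ((θ.attach δ).map fun σ => elemDiffP g σ x).sum else 0 := by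
    intro h x
    have h3 := PTree.sum_cuts N (fun θ δ τ => if τ.order ≤ N then (h ^ τ.order *
      (c (some θ) / θ.density * (b (some δ) / δ.density))) • elemDiff g τ x else 0)
      fun _ _ τ hτ => if_neg (by omega)
    refine Eq.trans (Finset.sum_congr rfl fun τ hτ => ?_) (h3.trans
      (Finset.sum_congr rfl fun θ _ => Finset.sum_congr rfl fun δ _ => ?_))
    · have hτ' : (mk τ).order ≤ N := PTree.mem_treesLE.1 hτ
      simp only [hτ', if_true, elemDiff_mk hg]
      have h4 : ∀ q : RTree × RTree, (h ^ (mk τ).order * (c (some q.1) / q.1.density *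
          (b (some q.2) / q.2.density))) • elemDiffP g τ x = (c (some q.1) / q.1.density *
          (b (some q.2) / q.2.density)) • h ^ (mk τ).order • elemDiffP g τ x := fun q => by
        rw [smul_smul, mul_comm]
      simp only [h4]
      have h5 := cast_density_ne_zero τ
      rw [multiset_sum_smul, smul_smul, smul_smul]
      simp only [lieDeriv, hc, zero_mul, zero_add, RTree.cuts_mk, RTree.density_mk, RTree.order_mk]
      congr 1
      field_simp
    · rw [List.map_congr_left (g := fun σ => if θ.order + δ.order ≤ N then
        (h ^ (θ.order + δ.order) * (c (some (mk θ)) / θ.density *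
          (b (some (mk δ)) / δ.density))) • elemDiffP g σ x else 0)]
      · split_ifs
        · rw [list_sum_smul, smul_smul]
          congr 1
          ring
        · simp
      · intro σ hσ
        have := PTree.order_of_mem_attach hσ
        simp only [RTree.order_mk, this, elemDiff_mk hg, RTree.density_mk]
  simp only [h1, h2, ← Finset.sum_sub_distrib]
  refine HighOrder.sum _ _ fun θ _ => HighOrder.sum _ _ fun δ _ => ?_
  split_ifs with h
  · simpa using HighOrder.zero
  · simp only [sub_zero, mul_smul]
    refine ((HighOrder.pow_smul (by omega) ?_).const_smul _).const_smul _
      |>.const_smul _ |>.const_smul _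
    have : ∀ l : List PTree, ContDiff ℝ ∞ fun x => (l.map fun σ => elemDiffP g σ x).sum := by
      intro l
      induction l with
      | nil => exact contDiff_const
      | cons σ l ih =>
        simp only [List.map_cons, List.sum_cons]
        exact (contDiff_elemDiffP hg σ).add ih
    exact this _

theorem iterate_lieDeriv_none {b : Coeff} (hb : b none = 0) (k : ℕ) :
    ((lieDeriv b)^[k] b) none = 0 := by
  cases k with
  | zero => exact hb
  | succ k => rw [Function.iterate_succ_apply']; rfl

/-- The Taylor coefficients of the solutions of the modified equation. -/
theorem highOrder_flowDeriv (hg : ContDiff ℝ ∞ g) (N : ℕ) (b : Coeff) (hb : b none = 0) (j : ℕ) :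
    HighOrder (N + 1) fun h x => h ^ (j + 1) • flowDeriv (modifiedField g N b h) (j + 1) x -
      bSeries g N ((lieDeriv b)^[j] b) h x := by
  induction j with
  | zero =>
    simp only [flowDeriv, fderiv_id, zero_add, pow_one, Function.iterate_zero, id,
      ContinuousLinearMap.id_apply, smul_modifiedField, sub_self]
    exact HighOrder.zero
  | succ j ih =>
    have h1 := ih.fderiv_apply (contDiff_bSeries hg N b)
    have h2 := h1.add (highOrder_lieDeriv hg N b ((lieDeriv b)^[j] b) (iterate_lieDeriv_none hb j))
    convert h2 using 3 with h x
    have hd1 : DifferentiableAt ℝ (flowDeriv (modifiedField g N b h) (j + 1)) x :=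
      ((contDiff_flowDeriv (contDiff_modifiedField hg N b) (j + 1)).comp
        (contDiff_const (c := h) |>.prodMk contDiff_id)).differentiable (by simp) x
    have hd2 : DifferentiableAt ℝ (bSeries g N ((lieDeriv b)^[j] b) h) x :=
      ((contDiff_bSeries hg N ((lieDeriv b)^[j] b)).comp
        (contDiff_const (c := h) |>.prodMk contDiff_id)).differentiable (by simp) x
    rw [fderiv_fun_sub (hd1.fun_const_smul _) hd2, fderiv_fun_const_smul hd1,
      Function.iterate_succ_apply', flowDeriv, pow_succ, mul_smul, ← map_smul, smul_modifiedField]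
    simp

theorem iterate_lieDeriv_eq_zero {b : Coeff} (hb : b none = 0) (k : ℕ) (τ : RTree)
    (hτ : τ.order ≤ k) : ((lieDeriv b)^[k] b) (some τ) = 0 := by
  induction k generalizing τ with
  | zero => have := τ.order_pos; omega
  | succ k ih =>
    rw [Function.iterate_succ_apply']
    simp only [lieDeriv, iterate_lieDeriv_none hb, zero_mul, zero_add]
    rw [Multiset.map_congr (g := fun _ => (0 : ℝ)) rfl]
    · simp
    · intro q hq
      rw [ih q.1 (by have := τ.order_of_mem_cuts q hq; omega)]
      simp

/-- The coefficients of the method are those of the time-`h` map of the modified equation. -/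
theorem sum_iterate_lieDeriv (a : Coeff) (ha : a (some RTree.leaf) = 1) (N : ℕ) (τ : RTree)
    (hτ : τ.order ≤ N) :
    ∑ j ∈ Finset.range N, 1 / ((j + 1).factorial : ℝ) *
      ((lieDeriv (modifiedCoeff a))^[j] (modifiedCoeff a)) (some τ) = a (some τ) := by
  have hp := τ.order_pos
  obtain ⟨n, hn⟩ : ∃ n, τ.order = n + 1 := ⟨τ.order - 1, by omega⟩
  have h0 : modifiedCoeff a none = 0 := rfl
  rw [← Finset.sum_subset (s₁ := Finset.range τ.order) (by simpa using hτ) (fun j _ hj => by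
    rw [iterate_lieDeriv_eq_zero h0 j τ (by simpa using hj), mul_zero]), hn,
    Finset.sum_range_succ']
  rcases Nat.eq_zero_or_pos n with rfl | hn0
  · rw [RTree.eq_leaf_of_order hn]
    simp [modifiedCoeff_leaf, ha]
  · have h1 := modifiedCoeff_rec a τ (by omega)
    have h2 : ∑ j ∈ Finset.Icc 2 τ.order, 1 / (j.factorial : ℝ) *
        ((lieDeriv (modifiedCoeff a))^[j - 1] (modifiedCoeff a)) (some τ) =
        ∑ j ∈ Finset.range n, 1 / ((j + 1 + 1).factorial : ℝ) *
        ((lieDeriv (modifiedCoeff a))^[j + 1] (modifiedCoeff a)) (some τ) := by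
      rw [hn, ← Finset.Ico_succ_right_eq_Icc, Finset.sum_Ico_eq_sum_range]
      refine Finset.sum_congr (by congr 1) fun j _ => ?_
      rw [show 2 + j = j + 1 + 1 by omega]
      rfl
    rw [← h2]
    simp only [zero_add, Nat.factorial_one, Nat.cast_one, div_one, one_mul, Function.iterate_zero,
      id]
    rw [h1]
    ring

/-- The time-`h` map of the modified equation reproduces the B-series of the method. -/
theorem highOrder_modified (hg : ContDiff ℝ ∞ g) (N : ℕ) (a : Coeff)
    (ha : a (some RTree.leaf) = 1) :
    HighOrder (N + 1) fun h x =>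
      ∑ j ∈ Finset.range (N + 1), (h ^ j / (j.factorial : ℝ)) •
        flowDeriv (modifiedField g N (modifiedCoeff a) h) j x - (x + bSeries g N a h x) := by
  have h1 := HighOrder.sum (Finset.range N) _ fun j _ =>
    (highOrder_flowDeriv hg N (modifiedCoeff a) rfl j).const_smul (1 / ((j + 1).factorial : ℝ))
  convert h1 using 3 with h x
  have h2 : bSeries g N a h x = ∑ j ∈ Finset.range N, (1 / ((j + 1).factorial : ℝ)) •
      bSeries g N ((lieDeriv (modifiedCoeff a))^[j] (modifiedCoeff a)) h x := by
    simp only [bSeries, Finset.smul_sum, smul_smul]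
    rw [Finset.sum_comm]
    refine Finset.sum_congr rfl fun τ hτ => ?_
    rw [← sum_iterate_lieDeriv a ha N (mk τ) (PTree.mem_treesLE.1 hτ), ← Finset.sum_smul]
    congr 1
    simp only [Finset.sum_div, Finset.mul_sum]
    refine Finset.sum_congr rfl fun j _ => ?_
    ring
  rw [h2, Finset.sum_range_succ', add_comm _ ((h ^ 0 / _) • _), add_sub_add_comm]
  simp only [flowDeriv, smul_sub, Finset.sum_sub_distrib, smul_smul]
  simp [div_eq_inv_mul]

end HighOrder

/-! ### Uniform estimates on bounded sets -/

theorem exists_norm_le {W E : Type*} [NormedAddCommGroup W] [ProperSpace W]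
    [NormedAddCommGroup E] {F : W → E} (hF : Continuous F) (r : ℝ) :
    ∃ C, 0 ≤ C ∧ ∀ x, ‖x‖ ≤ r → ‖F x‖ ≤ C := by
  obtain ⟨C, hC⟩ := (isCompact_closedBall (0 : W) r).exists_bound_of_continuousOn hF.continuousOn
  exact ⟨max C 0, le_max_right _ _, fun x hx =>
    (hC x (by simpa using hx)).trans (le_max_left _ _)⟩

theorem exists_norm_le_param {W E : Type*} [NormedAddCommGroup W] [ProperSpace W]
    [NormedAddCommGroup E] {S : ℝ × W → E} (hS : Continuous S) (r : ℝ) :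
    ∃ C, 0 ≤ C ∧ ∀ h ∈ Icc (0 : ℝ) 1, ∀ x, ‖x‖ ≤ r → ‖S (h, x)‖ ≤ C := by
  obtain ⟨C, hC0, hC⟩ := exists_norm_le hS (max 1 r)
  refine ⟨C, hC0, fun h hh x hx => hC _ ?_⟩
  rw [Prod.norm_def]
  exact max_le_max (by rw [Real.norm_eq_abs, abs_of_nonneg hh.1]; exact hh.2) hx

section Estimates

variable {W : Type u} [NormedAddCommGroup W] [NormedSpace ℝ W] [ProperSpace W]
  {E : Type*} [NormedAddCommGroup E] [NormedSpace ℝ E]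

theorem HighOrder.exists_norm_le {n : ℕ} {R : ℝ → W → W} (hR : HighOrder n R) (r : ℝ) :
    ∃ C, 0 ≤ C ∧ ∀ h ∈ Icc (0 : ℝ) 1, ∀ x, ‖x‖ ≤ r → ‖R h x‖ ≤ C * h ^ n := by
  obtain ⟨S, hS, h⟩ := hR
  obtain ⟨C, hC0, hC⟩ := exists_norm_le_param hS.continuous r
  refine ⟨C, hC0, fun t ht x hx => ?_⟩
  rw [h, norm_smul, norm_pow, Real.norm_eq_abs, abs_of_nonneg ht.1, mul_comm]
  exact mul_le_mul_of_nonneg_right (hC t ht x hx) (pow_nonneg ht.1 _)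

theorem exists_lipschitz {F : W → E} (hF : ContDiff ℝ ∞ F) (r : ℝ) :
    ∃ L, 0 ≤ L ∧ ∀ x y, ‖x‖ ≤ r → ‖y‖ ≤ r → ‖F x - F y‖ ≤ L * ‖x - y‖ := by
  obtain ⟨L, hL0, hL⟩ := BSeries.exists_norm_le (hF.continuous_fderiv (by simp)) r
  refine ⟨L, hL0, fun x y hx hy => ?_⟩
  exact (convex_closedBall (0 : W) r).norm_image_sub_le_of_norm_fderiv_le
    (fun z _ => hF.differentiable (by simp) z) (fun z hz => hL z (by simpa using hz))
    (by simpa using hy) (by simpa using hx)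

theorem exists_lipschitz_param {S : ℝ × W → E} (hS : ContDiff ℝ ∞ S) (r : ℝ) :
    ∃ L, 0 ≤ L ∧ ∀ h ∈ Icc (0 : ℝ) 1, ∀ x y, ‖x‖ ≤ r → ‖y‖ ≤ r →
      ‖S (h, x) - S (h, y)‖ ≤ L * ‖x - y‖ := by
  obtain ⟨L, hL0, hL⟩ := exists_lipschitz hS (max 1 r)
  have hn : ∀ h ∈ Icc (0 : ℝ) 1, ∀ x : W, ‖x‖ ≤ r → ‖(h, x)‖ ≤ max 1 r := by
    intro h hh x hx
    rw [Prod.norm_def]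
    exact max_le_max (by rw [Real.norm_eq_abs, abs_of_nonneg hh.1]; exact hh.2) hx
  refine ⟨L, hL0, fun h hh x y hx hy => (hL _ _ (hn h hh x hx) (hn h hh y hy)).trans_eq ?_⟩
  simp [Prod.norm_def]

theorem exists_taylor_two {F : W → E} (hF : ContDiff ℝ ∞ F) (r : ℝ) :
    ∃ C, 0 ≤ C ∧ ∀ x y, ‖x‖ ≤ r → ‖y‖ ≤ r →
      ‖F y - F x - fderiv ℝ F x (y - x)‖ ≤ C * ‖y - x‖ ^ 2 := by
  obtain ⟨L, hL0, hL⟩ := exists_lipschitz (hF.fderiv_right (m := ∞) (by simp)) r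
  refine ⟨L, hL0, fun x y hx hy => ?_⟩
  have hseg : segment ℝ x y ⊆ Metric.closedBall 0 r :=
    (convex_closedBall (0 : W) r).segment_subset (by simpa using hx) (by simpa using hy)
  have := (convex_segment (𝕜 := ℝ) x y).norm_image_sub_le_of_norm_fderiv_le'
    (f := F) (φ := fderiv ℝ F x) (C := L * ‖y - x‖)
    (fun z _ => hF.differentiable (by simp) z) (fun z hz => by
      refine (hL z x (by simpa using hseg hz) hx).trans ?_
      refine mul_le_mul_of_nonneg_left ?_ hL0
      obtain ⟨t, ht, rfl⟩ := (segment_eq_image' ℝ x y ▸ hz :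
        z ∈ (fun t : ℝ => x + t • (y - x)) '' Icc 0 1)
      simp only [add_sub_cancel_left, norm_smul, Real.norm_eq_abs, abs_of_nonneg ht.1]
      exact mul_le_of_le_one_left (norm_nonneg _) ht.2)
    (left_mem_segment ℝ x y) (right_mem_segment ℝ x y)
  exact this.trans_eq (by ring)

end Estimates

/-- Taylor's formula for a sequence `d 0, d 1, …` of functions, each of which is the derivative of
its predecessor up to an error `ε`. -/
theorem norm_sub_taylor_le {E : Type*} [NormedAddCommGroup E] [NormedSpace ℝ E] (N : ℕ)
    (d e : ℕ → ℝ → E) {a h M ε : ℝ} (h0 : 0 ≤ h) (h1 : h ≤ 1)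
    (hd : ∀ j, ∀ σ ∈ Icc a (a + h), HasDerivWithinAt (d j) (e j σ) (Icc a (a + h)) σ)
    (hM : ∀ σ ∈ Icc a (a + h), ‖d (N + 1) σ‖ ≤ M)
    (hε : ∀ j ≤ N, ∀ σ ∈ Icc a (a + h), ‖e j σ - d (j + 1) σ‖ ≤ ε) :
    ‖d 0 (a + h) - ∑ j ∈ Finset.range (N + 1), (h ^ j / (j.factorial : ℝ)) • d j a‖ ≤
      h * (h ^ N * M + (N + 1) * ε) := by
  -- `G σ` is the Taylor polynomial at `σ`, evaluated at `a + h`; its derivative telescopes up to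
  -- the last term and the errors.
  set G : ℝ → E := fun σ => ∑ j ∈ Finset.range (N + 1),
    ((a + h - σ) ^ j / (j.factorial : ℝ)) • d j σ with hG
  set G' : ℝ → E := fun σ => ∑ j ∈ Finset.range (N + 1),
    ((a + h - σ) ^ j / (j.factorial : ℝ)) • (e j σ - d (j + 1) σ) +
      ((a + h - σ) ^ N / (N.factorial : ℝ)) • d (N + 1) σ with hG'
  have htel : ∀ (s : ℝ) (σ : ℝ) (n : ℕ),
      ∑ j ∈ Finset.range (n + 1), (-(j * s ^ (j - 1)) / (j.factorial : ℝ)) • d j σ =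
        ∑ j ∈ Finset.range (n + 1), (s ^ j / (j.factorial : ℝ)) • (-d (j + 1) σ) +
          (s ^ n / (n.factorial : ℝ)) • d (n + 1) σ := by
    intro s σ n
    rw [Finset.sum_range_succ', Finset.sum_range_succ]
    simp only [CharP.cast_eq_zero, zero_mul, neg_zero, zero_div, zero_smul, add_zero,
      add_tsub_cancel_right, smul_neg, neg_add_cancel_right]
    refine Finset.sum_congr rfl fun j _ => ?_
    rw [← neg_smul, Nat.factorial_succ]
    congr 1
    push_cast
    field_simp
  have hder : ∀ σ ∈ Icc a (a + h), HasDerivWithinAt G (G' σ) (Icc a (a + h)) σ := by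
    intro σ hσ
    have h2 := HasDerivWithinAt.fun_sum (u := Finset.range (N + 1)) fun j _ =>
      ((((hasDerivAt_id σ).const_sub (a + h)).pow j).div_const
        (j.factorial : ℝ)).hasDerivWithinAt.smul (hd j σ hσ)
    refine h2.congr_deriv ?_
    have h3 := htel (a + h - σ) σ N
    simp only [Finset.sum_add_distrib, id, Pi.pow_apply]
    rw [hG']
    simp only [smul_sub, Finset.sum_sub_distrib, smul_neg, Finset.sum_neg_distrib] at h3 ⊢
    rw [show ∀ A B C : E, A - B + C = A + (-B + C) from fun A B C => by abel, ← h3]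
    congr 1
    refine Finset.sum_congr rfl fun j _ => ?_
    congr 1
    ring
  have hbound : ∀ σ ∈ Icc a (a + h), ‖G' σ‖ ≤ h ^ N * M + (N + 1) * ε := by
    intro σ hσ
    have hs0 : 0 ≤ a + h - σ := by linarith [hσ.2]
    have hs1 : a + h - σ ≤ h := by linarith [hσ.1]
    have hfac : ∀ j : ℕ, (1 : ℝ) ≤ j.factorial := fun j => by exact_mod_cast j.factorial_pos
    refine (norm_add_le _ _).trans ?_
    rw [add_comm]
    refine add_le_add ?_ ?_
    · rw [norm_smul, Real.norm_eq_abs, abs_of_nonneg (by positivity)]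
      refine mul_le_mul ?_ (hM σ hσ) (norm_nonneg _) (by positivity)
      exact (div_le_self (by positivity) (hfac N)).trans (pow_le_pow_left₀ hs0 hs1 N)
    · refine (norm_sum_le_of_le (n := fun _ => ε) _ fun j hj => ?_).trans_eq (by simp)
      rw [norm_smul, Real.norm_eq_abs, abs_of_nonneg (by positivity)]
      refine (mul_le_of_le_one_left (norm_nonneg _) ?_).trans
        (hε j (by simpa [Nat.lt_succ_iff] using hj) σ hσ)
      exact (div_le_self (by positivity) (hfac j)).trans (pow_le_one₀ hs0 (hs1.trans h1))
  have h2 := (convex_Icc a (a + h)).norm_image_sub_le_of_norm_hasDerivWithin_le hder hbound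
    (left_mem_Icc.2 (by linarith)) (right_mem_Icc.2 (by linarith))
  have h3 : G (a + h) = d 0 (a + h) := by
    simp only [hG, sub_self]
    rw [Finset.sum_range_succ']
    simp
  have h4 : G a = ∑ j ∈ Finset.range (N + 1), (h ^ j / (j.factorial : ℝ)) • d j a := by
    simp only [hG, add_sub_cancel_left]
  rw [h3, h4, add_sub_cancel_left, Real.norm_eq_abs, abs_of_nonneg h0, mul_comm] at h2
  exact h2

section OneStep

variable {W : Type u} [NormedAddCommGroup W] [NormedSpace ℝ W] [ProperSpace W] {g : W → W}

/-- A curve that solves the modified equation up to a defect `ε` satisfies the B-series of the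
method with coefficients `c` up to an error `O(h ^ (N + 1) + h ε)`. -/
theorem exists_oneStep_le (hg : ContDiff ℝ ∞ g) (N : ℕ) (c : Coeff)
    (hc : c (some RTree.leaf) = 1) (r : ℝ) :
    ∃ C, 0 ≤ C ∧ ∀ h : ℝ, 0 < h → h ≤ 1 → ∀ (a ε : ℝ) (w w' : ℝ → W),
      (∀ σ ∈ Icc a (a + h), HasDerivWithinAt w (w' σ) (Icc a (a + h)) σ ∧ ‖w σ‖ ≤ r ∧
        ‖w' σ - modifiedField g N (modifiedCoeff c) h (w σ)‖ ≤ ε) →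
      ‖w (a + h) - (w a + bSeries g N c h (w a))‖ ≤ C * (h * (h ^ N + ε)) := by
  set φ := modifiedField g N (modifiedCoeff c) with hφ
  have hφs : ContDiff ℝ ∞ fun z : ℝ × W => φ z.1 z.2 := contDiff_modifiedField hg N _
  have hfs : ∀ j, ContDiff ℝ ∞ fun z : ℝ × W => flowDeriv (φ z.1) j z.2 := contDiff_flowDeriv hφs
  obtain ⟨C₁, hC₁0, hC₁⟩ := (highOrder_modified hg N c hc).exists_norm_le r
  obtain ⟨C₂, hC₂0, hC₂⟩ := exists_norm_le_param (hfs (N + 1)).continuous r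
  have hD : ∀ j, ∃ C, 0 ≤ C ∧ ∀ h ∈ Icc (0 : ℝ) 1, ∀ x, ‖x‖ ≤ r →
      ‖fderiv ℝ (flowDeriv (φ h) j) x‖ ≤ C := by
    intro j
    have : ContDiff ℝ ∞ fun z : ℝ × W => fderiv ℝ (flowDeriv (φ z.1) j) z.2 :=
      ContDiff.fderiv (n := ∞) (f := fun (z : ℝ × W) x => flowDeriv (φ z.1) j x)
        ((hfs j).comp ((contDiff_fst.comp contDiff_fst).prodMk contDiff_snd)) contDiff_snd (by simp)
    exact exists_norm_le_param this.continuous r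
  choose D hD0 hD using hD
  set C₃ := ∑ j ∈ Finset.range (N + 1), D j with hC₃
  have hC₃0 : 0 ≤ C₃ := Finset.sum_nonneg fun j _ => hD0 j
  refine ⟨C₁ + C₂ + (N + 1) * C₃, by positivity, fun h h0 h1 a ε w w' hw => ?_⟩
  have hh : h ∈ Icc (0 : ℝ) 1 := ⟨h0.le, h1⟩
  have ha : a ∈ Icc a (a + h) := ⟨le_rfl, by linarith⟩
  have hε : 0 ≤ ε := (norm_nonneg _).trans (hw a ha).2.2
  have hdiff : ∀ j x, DifferentiableAt ℝ (flowDeriv (φ h) j) x := fun j x =>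
    ((hfs j).comp (contDiff_const (c := h) |>.prodMk contDiff_id)).differentiable (by simp) x
  have ht := norm_sub_taylor_le N (fun j σ => flowDeriv (φ h) j (w σ))
    (fun j σ => fderiv ℝ (flowDeriv (φ h) j) (w σ) (w' σ)) (a := a) (M := C₂) (ε := C₃ * ε) h0.le h1
    (fun j σ hσ => (hdiff j (w σ)).hasFDerivAt.comp_hasDerivWithinAt σ (hw σ hσ).1)
    (fun σ hσ => hC₂ h hh (w σ) (hw σ hσ).2.1)
    (fun j hj σ hσ => by
      simp only [flowDeriv]
      rw [← map_sub]
      refine (ContinuousLinearMap.le_opNorm _ _).trans (mul_le_mul ?_ (hw σ hσ).2.2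
        (norm_nonneg _) hC₃0)
      refine (hD j h hh _ (hw σ hσ).2.1).trans ?_
      exact Finset.single_le_sum (f := D) (fun j _ => hD0 j) (by simpa [Nat.lt_succ_iff] using hj))
  have h2 := hC₁ h hh (w a) (hw a ha).2.1
  have h3 := (norm_add_le _ _).trans (add_le_add ht h2)
  rw [← add_sub_assoc, sub_add_cancel] at h3
  refine h3.trans ?_
  have h4 : 0 ≤ h * ε := by positivity
  have h5 : 0 ≤ h * h ^ N := by positivity
  have h6 : 0 ≤ ((N : ℝ) + 1) * C₃ := by positivity
  rw [pow_succ]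
  nlinarith [mul_nonneg hC₁0 h4, mul_nonneg hC₂0 h4, mul_nonneg h6 h5]

/-- Taylor's formula for `g` at `x` with increments `u`. -/
theorem exists_taylor_le (hg : ContDiff ℝ ∞ g) (n : ℕ) (r : ℝ) :
    ∃ C, 0 ≤ C ∧ ∀ x u : W, ‖x‖ ≤ r → ‖x + u‖ ≤ r →
      ‖g (x + u) - ∑ m ∈ Finset.range (n + 1), (1 / (m.factorial : ℝ)) •
        listDeriv g x (List.replicate m u)‖ ≤ C * ‖u‖ ^ (n + 1) := by
  obtain ⟨C, hC0, hC⟩ := exists_norm_le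
    (hg.continuous_iteratedFDeriv (m := n + 1) (by exact_mod_cast le_top)) r
  refine ⟨C, hC0, fun x u hx hu => ?_⟩
  have hmem : ∀ σ ∈ Icc (0 : ℝ) (0 + 1), ‖x + σ • u‖ ≤ r := by
    intro σ hσ
    have h1 := (convex_closedBall (0 : W) r) (x := x) (y := x + u) (by simpa using hx)
      (by simpa using hu) (a := 1 - σ) (b := σ) (by linarith [hσ.2]) hσ.1 (by ring)
    have h2 : (1 - σ) • x + σ • (x + u) = x + σ • u := by module
    rw [h2] at h1
    simpa using h1
  have h := norm_sub_taylor_le n (fun j σ => listDeriv g (x + σ • u) (List.replicate j u))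
    (fun j σ => listDeriv g (x + σ • u) (List.replicate (j + 1) u)) (a := 0) (h := 1)
    (M := C * ‖u‖ ^ (n + 1)) (ε := 0) zero_le_one le_rfl
    (fun j σ _ => by
      rw [List.replicate_succ, listDeriv_cons hg]
      have h1 : HasDerivWithinAt (fun σ : ℝ => x + σ • u) u (Icc 0 (0 + 1)) σ := by
        simpa using (((hasDerivAt_id σ).smul_const u).const_add x).hasDerivWithinAt
      have h2 : ContDiff ℝ ∞ fun z => listDeriv g z (List.replicate j u) := by
        have := contDiff_listDeriv hg _ (List.replicate j (fun _ : W => u)) rfl (by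
          intro f hf
          rw [List.eq_of_mem_replicate hf]
          exact contDiff_const) (contDiff_id (𝕜 := ℝ) (E := W))
        simpa using this
      exact (h2.differentiable (by simp) _).hasFDerivAt.comp_hasDerivWithinAt σ h1)
    (fun σ hσ => (norm_listDeriv_replicate_le g _ u (n + 1)).trans
      (mul_le_mul_of_nonneg_right (hC _ (hmem σ hσ)) (by positivity)))
    (fun j _ σ _ => by simp)
  simpa [listDeriv_nil] using h

end OneStep

/-! ### The B-series of a Runge–Kutta step -/

namespace RungeKutta

variable {s : ℕ} (M : RungeKutta s)

section Autonomous

variable {W : Type u} [NormedAddCommGroup W] [NormedSpace ℝ W]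

/-- The truncated expansion of the `i`-th stage of the method, applied to `x' = g(x)`. -/
noncomputable def stageSeries (g : W → W) (n : ℕ) (h : ℝ) (x : W) (i : Fin s) : W :=
  ∑ τ ∈ PTree.treesLE n, (h ^ (τ.order - 1) * (τ.weight * M.stageWeightP τ i)) • elemDiffP g τ x

variable {g : W → W}

theorem contDiff_stageSeries (hg : ContDiff ℝ ∞ g) (n : ℕ) (i : Fin s) :
    ContDiff ℝ ∞ fun z : ℝ × W => M.stageSeries g n z.1 z.2 i :=
  ContDiff.sum fun τ _ => ((contDiff_fst.pow _).mul contDiff_const).smul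
    ((contDiff_elemDiffP hg τ).comp contDiff_snd)

theorem stageWeight_mk (τ : PTree) : M.stageWeight (RTree.mk τ) = M.stageWeightP τ := rfl

theorem smul_sum_stageSeries (n : ℕ) (h : ℝ) (x : W) (v : Fin s → ℝ) :
    h • ∑ i, v i • M.stageSeries g n h x i = ∑ τ ∈ PTree.treesLE n,
      (τ.weight * (h ^ τ.order * ∑ i, v i * M.stageWeightP τ i)) • elemDiffP g τ x := by
  simp only [stageSeries, Finset.smul_sum, smul_smul]
  rw [Finset.sum_comm]
  refine Finset.sum_congr rfl fun τ _ => ?_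
  rw [← Finset.sum_smul]
  congr 1
  simp only [Finset.mul_sum]
  refine Finset.sum_congr rfl fun i _ => ?_
  rw [← Nat.sub_add_cancel τ.order_pos, pow_succ, Nat.add_sub_cancel]
  ring

theorem smul_sum_b_stageSeries (n : ℕ) (h : ℝ) (x : W) :
    h • ∑ i, M.b i • M.stageSeries g n h x i = bSeries g n M.coeff h x := by
  rw [smul_sum_stageSeries, bSeries]
  refine Finset.sum_congr rfl fun τ _ => ?_
  have := cast_density_ne_zero τ
  simp only [coeff, RTree.density_mk, stageWeight_mk]
  congr 1
  field_simp

/-- The terms of the Taylor expansion of a stage that are not in its truncated B-series are of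
higher order. -/
theorem highOrder_sum_bushes (hg : ContDiff ℝ ∞ g) (n : ℕ) (i : Fin s) :
    HighOrder (n + 1) fun h x => ∑ m ∈ Finset.range (n + 1), (1 / (m.factorial : ℝ)) •
      listDeriv g x (List.replicate m (h • ∑ j, M.A i j • M.stageSeries g (n + 1) h x j)) -
        M.stageSeries g (n + 1) h x i := by
  classical
  have h1 : ∀ (h : ℝ) (x : W) (m : ℕ), (1 / (m.factorial : ℝ)) •
      listDeriv g x (List.replicate m (h • ∑ j, M.A i j • M.stageSeries g (n + 1) h x j)) =
      ∑ θ ∈ PTree.bushes (n + 1) m,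
        (h ^ (θ.order - 1) * (θ.weight * M.stageWeightP θ i)) • elemDiffP g θ x := by
    intro h x m
    rw [smul_sum_stageSeries]
    have h2 := sum_bushes hg (fun τ => h ^ τ.order * ∑ j, M.A i j * M.stageWeightP τ j)
      (fun θ => h ^ (θ.order - 1) * M.stageWeightP θ i) (by simp [PTree.order, stageWeightP])
      (by
        intro θ δ
        have := θ.order_pos
        simp only [PTree.order, stageWeightP]
        rw [show θ.order + δ.order - 1 = (θ.order - 1) + δ.order by omega, pow_add]
        ring) (n + 1) m x x []
    simp only [List.append_nil] at h2
    rw [← h2]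
    refine Finset.sum_congr rfl fun θ _ => ?_
    rw [elemDiffP_eq]
    congr 1
    ring
  have hdisj : ((Finset.range (n + 1) : Finset ℕ) : Set ℕ).PairwiseDisjoint
      (PTree.bushes (n + 1)) := by
    intro m _ m' _ hne
    refine Finset.disjoint_left.2 fun τ hτ hτ' => hne ?_
    rw [← PTree.numChildren_of_mem_bushes hτ, PTree.numChildren_of_mem_bushes hτ']
  have hsub : PTree.treesLE (n + 1) ⊆ (Finset.range (n + 1)).biUnion (PTree.bushes (n + 1)) := by
    intro τ hτ
    have h2 := PTree.mem_treesLE.1 hτ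
    have h3 := τ.numChildren_lt_order
    exact Finset.mem_biUnion.2 ⟨τ.numChildren, Finset.mem_range.2 (by omega),
      PTree.mem_bushes (by omega)⟩
  have hrest : HighOrder (n + 1) fun h x =>
      ∑ θ ∈ (Finset.range (n + 1)).biUnion (PTree.bushes (n + 1)) \ PTree.treesLE (n + 1),
        (h ^ (θ.order - 1) * (θ.weight * M.stageWeightP θ i)) • elemDiffP g θ x := by
    refine HighOrder.sum _ _ fun θ hθ => ?_
    have h2 : n + 1 ≤ θ.order - 1 := by
      have h3 := (Finset.mem_sdiff.1 hθ).2
      rw [PTree.mem_treesLE] at h3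
      omega
    simp only [mul_smul _ (θ.weight * _)]
    exact HighOrder.pow_smul h2 (contDiff_const.smul (contDiff_elemDiffP hg θ))
  convert hrest using 3 with h x
  rw [Finset.sum_congr rfl fun m _ => h1 h x m, ← Finset.sum_biUnion hdisj,
    ← Finset.sum_sdiff hsub, ← stageSeries, add_sub_cancel_right]

/-- The B-series of the stages satisfy the stage equations up to a high order of `h`. -/
theorem exists_stage_defect_le [ProperSpace W] (hg : ContDiff ℝ ∞ g) (n : ℕ) (r : ℝ) :
    ∃ C, 0 ≤ C ∧ ∃ h₀ > 0, h₀ ≤ 1 ∧ ∀ h : ℝ, 0 < h → h ≤ h₀ → ∀ x, ‖x‖ ≤ r → ∀ i : Fin s,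
      ‖x + h • ∑ j, M.A i j • M.stageSeries g (n + 1) h x j‖ ≤ r + 1 ∧
      ‖g (x + h • ∑ j, M.A i j • M.stageSeries g (n + 1) h x j) -
        M.stageSeries g (n + 1) h x i‖ ≤ C * h ^ (n + 1) := by
  choose C₁ hC₁0 hC₁ using fun i => (M.highOrder_sum_bushes hg n i).exists_norm_le r
  have hsm : ∀ i, ContDiff ℝ ∞ fun z : ℝ × W =>
      ∑ j, M.A i j • M.stageSeries g (n + 1) z.1 z.2 j := fun i =>
    ContDiff.sum fun j _ => contDiff_const.smul (M.contDiff_stageSeries hg (n + 1) j)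
  choose B hB0 hB using fun i => exists_norm_le_param (hsm i).continuous r
  obtain ⟨C₂, hC₂0, hC₂⟩ := exists_taylor_le hg n (r + 1)
  set B' := ∑ i, B i with hB'
  have hB'0 : 0 ≤ B' := Finset.sum_nonneg fun i _ => hB0 i
  have hBB : ∀ i, B i ≤ B' := fun i => Finset.single_le_sum (fun i _ => hB0 i) (Finset.mem_univ i)
  set C₁' := ∑ i, C₁ i with hC₁'
  have hC₁'0 : 0 ≤ C₁' := Finset.sum_nonneg fun i _ => hC₁0 i
  have hCC : ∀ i, C₁ i ≤ C₁' := fun i =>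
    Finset.single_le_sum (fun i _ => hC₁0 i) (Finset.mem_univ i)
  refine ⟨C₂ * B' ^ (n + 1) + C₁', by positivity, 1 / (1 + B'), by positivity, ?_,
    fun h h0 h1 x hx i => ?_⟩
  · rw [div_le_one (by positivity)]; linarith
  have hh1 : h ≤ 1 := h1.trans (by rw [div_le_one (by positivity)]; linarith)
  have hh : h ∈ Icc (0 : ℝ) 1 := ⟨h0.le, hh1⟩
  set u := h • ∑ j, M.A i j • M.stageSeries g (n + 1) h x j with hu
  have hun : ‖u‖ ≤ h * B' := by
    rw [hu, norm_smul, Real.norm_eq_abs, abs_of_pos h0]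
    exact mul_le_mul_of_nonneg_left ((hB i h hh x hx).trans (hBB i)) h0.le
  have hhB : h * B' ≤ 1 := by
    rw [le_div_iff₀ (by positivity)] at h1
    nlinarith
  have hxu : ‖x + u‖ ≤ r + 1 := (norm_add_le _ _).trans (add_le_add hx (hun.trans hhB))
  refine ⟨hxu, ?_⟩
  have h2 := (norm_add_le _ _).trans
    (add_le_add (hC₂ x u (by linarith) hxu) (hC₁ i h hh x hx))
  rw [sub_add_sub_cancel] at h2
  refine h2.trans ?_
  have h3 : ‖u‖ ^ (n + 1) ≤ h ^ (n + 1) * B' ^ (n + 1) := by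
    rw [← mul_pow]
    exact pow_le_pow_left₀ (norm_nonneg _) hun _
  have h4 : C₁ i * h ^ (n + 1) ≤ C₁' * h ^ (n + 1) :=
    mul_le_mul_of_nonneg_right (hCC i) (by positivity)
  nlinarith [mul_le_mul_of_nonneg_left h3 hC₂0]

end Autonomous

section NonAutonomous

variable {V : Type u} [NormedAddCommGroup V] [NormedSpace ℝ V]

/-- The vector field `(t, y) ↦ (1, f(t, y))` of the autonomous system equivalent to
`y' = f(t, y)`. -/
def extendedField (f : ℝ → V → V) (q : ℝ × V) : ℝ × V := (1, f q.1 q.2)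

theorem contDiff_extendedField {f : ℝ → V → V} (hf : ContDiff ℝ ∞ fun q : ℝ × V => f q.1 q.2) :
    ContDiff ℝ ∞ (extendedField f) := contDiff_const.prodMk hf

theorem listDeriv_extendedField_fst {f : ℝ → V → V}
    (hf : ContDiff ℝ ∞ fun q : ℝ × V => f q.1 q.2) (l : List (ℝ × V)) (x : ℝ × V) :
    (listDeriv (extendedField f) x l).1 = if l = [] then 1 else 0 := by
  have hg := contDiff_extendedField hf
  induction l generalizing x with
  | nil => simp [listDeriv_nil, extendedField]
  | cons v l ih =>
    rw [listDeriv_cons hg, if_neg (by simp)]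
    have hd : DifferentiableAt ℝ (fun x => listDeriv (extendedField f) x l) x := by
      have := contDiff_listDeriv hg _ (l.map fun v => fun _ : ℝ × V => v) rfl (by
        intro f hf
        obtain ⟨v, _, rfl⟩ := List.mem_map.1 hf
        exact contDiff_const) (contDiff_id (𝕜 := ℝ) (E := ℝ × V))
      simp only [List.map_map, Function.comp_def, List.map_id', id] at this
      exact this.differentiable (by simp) x
    have h1 := hd.hasFDerivAt.fst
    simp only [ih] at h1
    exact congrArg (fun L : ℝ × V →L[ℝ] ℝ => L v) (h1.unique (hasFDerivAt_const _ _))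

open Classical in
theorem elemDiffP_extendedField_fst {f : ℝ → V → V}
    (hf : ContDiff ℝ ∞ fun q : ℝ × V => f q.1 q.2) (τ : PTree) (x : ℝ × V) :
    (elemDiffP (extendedField f) τ x).1 = if τ = .leaf then 1 else 0 := by
  rw [elemDiffP_eq, listDeriv_extendedField_fst hf]
  cases τ <;> simp [childDiffs]

theorem sum_elemDiffP_fst {f : ℝ → V → V} (hf : ContDiff ℝ ∞ fun q : ℝ × V => f q.1 q.2) (n : ℕ)
    (x : ℝ × V) (v : PTree → ℝ) :
    (∑ τ ∈ PTree.treesLE (n + 1), v τ • elemDiffP (extendedField f) τ x).1 = v .leaf := by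
  classical
  rw [Prod.fst_sum, Finset.sum_eq_single .leaf]
  · simp [elemDiffP_extendedField_fst hf]
  · intro τ _ hτ
    simp [elemDiffP_extendedField_fst hf, hτ]
  · intro h
    exact absurd (PTree.mem_treesLE.2 (by simp [PTree.order])) h

theorem stageSeries_fst {f : ℝ → V → V} (hf : ContDiff ℝ ∞ fun q : ℝ × V => f q.1 q.2) (n : ℕ)
    (h : ℝ) (x : ℝ × V) (i : Fin s) :
    (M.stageSeries (extendedField f) (n + 1) h x i).1 = 1 := by
  rw [stageSeries, sum_elemDiffP_fst hf]
  simp [PTree.order, PTree.weight, stageWeightP]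

/-- The sum of the absolute values of all coefficients of the method, plus one. -/
noncomputable def coeffBound : ℝ := 1 + ∑ i, ∑ j, |M.A i j| + ∑ i, |M.b i|

theorem sum_abs_A_le (i : Fin s) : ∑ j, |M.A i j| ≤ M.coeffBound := by
  have h1 : ∑ j, |M.A i j| ≤ ∑ i, ∑ j, |M.A i j| :=
    Finset.single_le_sum (f := fun i => ∑ j, |M.A i j|)
      (fun i _ => Finset.sum_nonneg fun j _ => abs_nonneg _) (Finset.mem_univ i)
  have h2 : 0 ≤ ∑ i, |M.b i| := Finset.sum_nonneg fun j _ => abs_nonneg _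
  unfold coeffBound
  linarith

theorem sum_abs_b_le : ∑ i, |M.b i| ≤ M.coeffBound := by
  have h1 : 0 ≤ ∑ i, ∑ j, |M.A i j| :=
    Finset.sum_nonneg fun i _ => Finset.sum_nonneg fun j _ => abs_nonneg _
  unfold coeffBound
  linarith

theorem one_le_coeffBound : 1 ≤ M.coeffBound := by
  have h1 : 0 ≤ ∑ i, ∑ j, |M.A i j| :=
    Finset.sum_nonneg fun i _ => Finset.sum_nonneg fun j _ => abs_nonneg _
  have h2 : 0 ≤ ∑ i, |M.b i| := Finset.sum_nonneg fun j _ => abs_nonneg _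
  unfold coeffBound
  linarith

theorem abs_c_le (i : Fin s) : |M.c i| ≤ M.coeffBound :=
  (Finset.abs_sum_le_sum_abs _ _).trans (M.sum_abs_A_le i)

theorem norm_sum_A_le (i : Fin s) (k : Fin s → V) : ‖∑ j, M.A i j • k j‖ ≤ M.coeffBound * ‖k‖ := by
  refine (norm_sum_le_of_le (n := fun j => |M.A i j| * ‖k‖) _ fun j _ => ?_).trans ?_
  · rw [norm_smul, Real.norm_eq_abs]
    exact mul_le_mul_of_nonneg_left (norm_le_pi_norm k j) (abs_nonneg _)
  · rw [← Finset.sum_mul]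
    exact mul_le_mul_of_nonneg_right (M.sum_abs_A_le i) (norm_nonneg _)

theorem norm_sum_b_le (k : Fin s → V) : ‖∑ j, M.b j • k j‖ ≤ M.coeffBound * ‖k‖ := by
  refine (norm_sum_le_of_le (n := fun j => |M.b j| * ‖k‖) _ fun j _ => ?_).trans ?_
  · rw [norm_smul, Real.norm_eq_abs]
    exact mul_le_mul_of_nonneg_left (norm_le_pi_norm k j) (abs_nonneg _)
  · rw [← Finset.sum_mul]
    exact mul_le_mul_of_nonneg_right M.sum_abs_b_le (norm_nonneg _)

/-- The argument `(t + cᵢ h, y + h ∑ⱼ aᵢⱼ kⱼ)` of `f` in the stage equations. -/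
def stagePoint (h t : ℝ) (y : V) (k : Fin s → V) (i : Fin s) : ℝ × V :=
  (t + M.c i * h, y + h • ∑ j, M.A i j • k j)

theorem norm_stagePoint_sub_le {h t : ℝ} (h0 : 0 ≤ h) (y y' : V) (k k' : Fin s → V) (i : Fin s) :
    ‖M.stagePoint h t y k i - M.stagePoint h t y' k' i‖ ≤
      ‖y - y'‖ + h * (M.coeffBound * ‖k - k'‖) := by
  have h1 : M.stagePoint h t y k i - M.stagePoint h t y' k' i =
      (0, (y - y') + h • ∑ j, M.A i j • (k - k') j) := by
    simp only [stagePoint, Prod.mk_sub_mk, sub_self, Pi.sub_apply, smul_sub,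
      Finset.sum_sub_distrib]
    congr 1
    abel
  rw [h1, Prod.norm_def]
  simp only [norm_zero]
  rw [max_eq_right (norm_nonneg _)]
  refine (norm_add_le _ _).trans (add_le_add le_rfl ?_)
  rw [norm_smul, Real.norm_eq_abs, abs_of_nonneg h0]
  exact mul_le_mul_of_nonneg_left (M.norm_sum_A_le i _) h0

theorem norm_stagePoint_sub_base_le {h t : ℝ} (h0 : 0 ≤ h) (y : V) (k : Fin s → V) (i : Fin s) :
    ‖M.stagePoint h t y k i - (t, y)‖ ≤ h * (M.coeffBound * (‖k‖ + 1)) := by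
  have hb := M.one_le_coeffBound
  have h1 : M.stagePoint h t y k i - (t, y) = (M.c i * h, h • ∑ j, M.A i j • k j) := by
    simp [stagePoint]
  rw [h1, Prod.norm_def]
  refine max_le ?_ ?_
  · simp only [Real.norm_eq_abs, abs_mul, abs_of_nonneg h0]
    have := M.abs_c_le i
    have h2 : M.coeffBound ≤ M.coeffBound * (‖k‖ + 1) :=
      le_mul_of_one_le_right (by linarith) (by linarith [norm_nonneg k])
    rw [mul_comm]
    exact mul_le_mul_of_nonneg_left (this.trans h2) h0
  · simp only [norm_smul, Real.norm_eq_abs, abs_of_nonneg h0]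
    refine mul_le_mul_of_nonneg_left ((M.norm_sum_A_le i k).trans ?_) h0
    exact mul_le_mul_of_nonneg_left (by linarith) (by linarith)

variable [ProperSpace V]

/-- For small `h` the stage equations are solved by the fixed point of a contraction near
`f(t, y)`; hence the stages, which are the solution closest to `f(t, y)`, are well defined and close
to `f(t, y)`. -/
theorem exists_stages_spec {f : ℝ → V → V} (hf : ContDiff ℝ ∞ fun q : ℝ × V => f q.1 q.2) (r : ℝ) :
    ∃ h₀ > 0, h₀ ≤ 1 ∧ ∀ h : ℝ, 0 < h → h ≤ h₀ → ∀ (t : ℝ) (y : V), ‖(t, y)‖ ≤ r →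
      M.IsStages f h t y (M.stages f h t y) ∧
        ∀ i, ‖M.stagePoint h t y (M.stages f h t y) i‖ ≤ r + 1 := by
  obtain ⟨L, hL0, hL⟩ := exists_lipschitz hf (r + 1)
  obtain ⟨B, hB0, hB⟩ := exists_norm_le hf.continuous r
  have hb := M.one_le_coeffBound
  set a := M.coeffBound
  set D := a * (B + 2) * (L + 1) with hD
  have hD0 : 0 < D := by positivity
  refine ⟨1 / (2 * (D + 1)), by positivity, ?_, fun h h0 h1 t y hty => ?_⟩
  · rw [div_le_one (by positivity)]; linarith
  have hhD : h * D ≤ 1 / 2 := by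
    rw [le_div_iff₀ (by positivity)] at h1
    nlinarith
  set K : Fin s → V := fun _ => f t y with hK
  have hKB : ‖K‖ ≤ B := (pi_norm_le_iff_of_nonneg hB0).2 fun _ => hB (t, y) hty
  have hha : h * (a * (B + 2)) ≤ 1 / 2 := by
    have : h * (a * (B + 2)) ≤ h * D := mul_le_mul_of_nonneg_left
      (le_mul_of_one_le_right (by positivity) (by linarith)) h0.le
    linarith
  have hhL : L * (h * (a * (B + 2))) ≤ 1 / 2 := by
    have : L * (h * (a * (B + 2))) ≤ h * D := by
      rw [hD]
      nlinarith [show 0 ≤ h * (a * (B + 2)) by positivity]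
    linarith
  have hpt : ∀ k : Fin s → V, ‖k - K‖ ≤ 1 → ∀ i,
      ‖M.stagePoint h t y k i - (t, y)‖ ≤ h * (a * (B + 2)) ∧
        ‖M.stagePoint h t y k i‖ ≤ r + 1 := by
    intro k hk i
    have h2 : ‖k‖ ≤ B + 1 := by
      have := norm_add_le (k - K) K
      rw [sub_add_cancel] at this
      linarith
    have h3 := M.norm_stagePoint_sub_base_le (t := t) h0.le y k i
    have h4 : h * (a * (‖k‖ + 1)) ≤ h * (a * (B + 2)) :=
      mul_le_mul_of_nonneg_left (mul_le_mul_of_nonneg_left (by linarith) (by linarith)) h0.le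
    refine ⟨h3.trans h4, ?_⟩
    have := norm_add_le (M.stagePoint h t y k i - (t, y)) (t, y)
    rw [sub_add_cancel] at this
    linarith
  set F : (Fin s → V) → (Fin s → V) := fun k i =>
    f (M.stagePoint h t y k i).1 (M.stagePoint h t y k i).2 with hF
  have hmaps : MapsTo F (Metric.closedBall K 1) (Metric.closedBall K 1) := by
    intro k hk
    rw [mem_closedBall_iff_norm] at hk ⊢
    refine (pi_norm_le_iff_of_nonneg zero_le_one).2 fun i => ?_
    have h2 := hL _ (t, y) (hpt k hk i).2 (by linarith)
    have h3 := mul_le_mul_of_nonneg_left (hpt k hk i).1 hL0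
    exact h2.trans (by linarith)
  have hcontr : ContractingWith (1 / 2) (hmaps.restrict F _ _) := by
    refine ⟨by rw [← NNReal.coe_lt_coe]; norm_num, LipschitzWith.of_dist_le_mul fun k k' => ?_⟩
    rw [Subtype.dist_eq, Subtype.dist_eq, dist_eq_norm, dist_eq_norm]
    refine (pi_norm_le_iff_of_nonneg (by positivity)).2 fun i => ?_
    have hk := hpt k (mem_closedBall_iff_norm.1 k.2) i
    have hk' := hpt k' (mem_closedBall_iff_norm.1 k'.2) i
    have h2 := hL _ _ hk.2 hk'.2
    have h3 := M.norm_stagePoint_sub_le (t := t) h0.le y y k.1 k'.1 i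
    rw [sub_self, norm_zero, zero_add] at h3
    have h4 := mul_le_mul_of_nonneg_left h3 hL0
    refine (h2.trans h4).trans ?_
    have h5 : L * (h * a) ≤ 1 / 2 := by
      have : L * (h * a) ≤ L * (h * (a * (B + 2))) := mul_le_mul_of_nonneg_left
        (mul_le_mul_of_nonneg_left (le_mul_of_one_le_right (by linarith) (by linarith)) h0.le) hL0
      linarith
    have h6 := mul_le_mul_of_nonneg_right h5 (norm_nonneg (k.1 - k'.1))
    push_cast
    calc L * (h * (M.coeffBound * ‖k.1 - k'.1‖)) = L * (h * a) * ‖k.1 - k'.1‖ := by ring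
      _ ≤ _ := h6
  obtain ⟨k, hk, hfix, -⟩ := hcontr.exists_fixedPoint' Metric.isClosed_closedBall.isComplete hmaps
    (Metric.mem_closedBall_self zero_le_one) (edist_ne_top _ _)
  have hkS : M.IsStages f h t y k := fun i => (congrFun hfix i).symm
  -- A solution that is at least as close as `k` lies in the ball in which `k` is the only one.
  have huniq : ∀ k', M.IsStages f h t y k' → ‖k' - K‖ ≤ 1 → k' = k := by
    intro k' hk' hk'1
    have h2 : Function.IsFixedPt (hmaps.restrict F _ _)
        ⟨k', mem_closedBall_iff_norm.2 hk'1⟩ := Subtype.ext (funext fun i => (hk' i).symm)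
    have h3 : Function.IsFixedPt (hmaps.restrict F _ _) ⟨k, hk⟩ := Subtype.ext hfix
    exact congrArg Subtype.val (hcontr.fixedPoint_unique' h2 h3)
  have hspec := Classical.epsilon_spec (p := fun k => M.IsStages f h t y k ∧
    ∀ k', M.IsStages f h t y k' → ‖k - fun _ => f t y‖ ≤ ‖k' - fun _ => f t y‖)
    ⟨k, hkS, fun k' hk' => by
      by_cases h2 : ‖k' - K‖ ≤ 1
      · rw [huniq k' hk' h2]
      · exact (mem_closedBall_iff_norm.1 hk).trans (not_le.1 h2).le⟩
  refine ⟨hspec.1, fun i => (hpt _ ((hspec.2 k hkS).trans (mem_closedBall_iff_norm.1 hk)) i).2⟩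

theorem exists_step_lipschitz {f : ℝ → V → V} (hf : ContDiff ℝ ∞ fun q : ℝ × V => f q.1 q.2)
    (r : ℝ) : ∃ L, 0 ≤ L ∧ ∃ h₀ > 0, ∀ h : ℝ, 0 < h → h ≤ h₀ → ∀ (t : ℝ) (y y' : V),
      ‖(t, y)‖ ≤ r → ‖(t, y')‖ ≤ r →
        ‖M.step f h t y - M.step f h t y'‖ ≤ (1 + L * h) * ‖y - y'‖ := by
  obtain ⟨h₁, h₁0, -, hs⟩ := M.exists_stages_spec hf r
  obtain ⟨L, hL0, hL⟩ := exists_lipschitz hf (r + 1)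
  have hb := M.one_le_coeffBound
  set a := M.coeffBound
  refine ⟨a * (2 * L), by positivity, min h₁ (1 / (2 * (L * a + 1))), by positivity,
    fun h h0 h1 t y y' hy hy' => ?_⟩
  obtain ⟨hk, hkr⟩ := hs h h0 (h1.trans (min_le_left _ _)) t y hy
  obtain ⟨hk', hkr'⟩ := hs h h0 (h1.trans (min_le_left _ _)) t y' hy'
  have h2 := h1.trans (min_le_right _ _)
  rw [le_div_iff₀ (by positivity)] at h2
  rw [step, step]
  set k := M.stages f h t y
  set k' := M.stages f h t y'
  have h3 : ‖k - k'‖ ≤ L * (‖y - y'‖ + h * (a * ‖k - k'‖)) := by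
    refine (pi_norm_le_iff_of_nonneg (by positivity)).2 fun i => ?_
    rw [Pi.sub_apply, hk i, hk' i]
    exact (hL _ _ (hkr i) (hkr' i)).trans
      (mul_le_mul_of_nonneg_left (M.norm_stagePoint_sub_le h0.le y y' k k' i) hL0)
  have h4 : ‖k - k'‖ ≤ 2 * L * ‖y - y'‖ := by nlinarith [norm_nonneg (k - k')]
  have h5 : y + h • ∑ i, M.b i • k i - (y' + h • ∑ i, M.b i • k' i) =
      (y - y') + h • ∑ i, M.b i • (k - k') i := by
    simp only [Pi.sub_apply, smul_sub, Finset.sum_sub_distrib]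
    abel
  rw [h5]
  refine (norm_add_le _ _).trans ?_
  rw [norm_smul, Real.norm_eq_abs, abs_of_pos h0]
  have h6 := mul_le_mul_of_nonneg_left ((M.norm_sum_b_le (k - k')).trans
    (mul_le_mul_of_nonneg_left h4 (by positivity))) h0.le
  calc _ ≤ ‖y - y'‖ + h * (a * (2 * L * ‖y - y'‖)) := add_le_add le_rfl h6
    _ = _ := by ring

/-- One step of the method is given by its B-series. -/
theorem exists_step_sub_bSeries_le {f : ℝ → V → V}
    (hf : ContDiff ℝ ∞ fun q : ℝ × V => f q.1 q.2) (n : ℕ) (r : ℝ) :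
    ∃ C, 0 ≤ C ∧ ∃ h₀ > 0, ∀ h : ℝ, 0 < h → h ≤ h₀ → ∀ (t : ℝ) (y : V), ‖(t, y)‖ ≤ r →
      ‖M.step f h t y - (y + (bSeries (extendedField f) (n + 1) M.coeff h (t, y)).2)‖ ≤
        C * h ^ (n + 2) := by
  have hg := contDiff_extendedField hf
  obtain ⟨h₁, h₁0, -, hs⟩ := M.exists_stages_spec hf r
  obtain ⟨L, hL0, hL⟩ := exists_lipschitz hf (r + 1)
  obtain ⟨C, hC0, h₂, h₂0, -, hC⟩ := M.exists_stage_defect_le hg n r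
  have hb := M.one_le_coeffBound
  set a := M.coeffBound
  refine ⟨a * (2 * C), by positivity, min (min h₁ h₂) (1 / (2 * (L * a + 1))), by positivity,
    fun h h0 h1 t y hy => ?_⟩
  obtain ⟨hk, hkr⟩ := hs h h0 (h1.trans ((min_le_left _ _).trans (min_le_left _ _))) t y hy
  have hC := hC h h0 (h1.trans ((min_le_left _ _).trans (min_le_right _ _))) (t, y) hy
  have h2 := h1.trans (min_le_right _ _)
  rw [le_div_iff₀ (by positivity)] at h2
  rw [← smul_sum_b_stageSeries, step]
  set k := M.stages f h t y
  set k' : Fin s → V := fun i => (M.stageSeries (extendedField f) (n + 1) h (t, y) i).2 with hk'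
  have hpt : ∀ i, (t, y) + h • ∑ j, M.A i j • M.stageSeries (extendedField f) (n + 1) h (t, y) j =
      M.stagePoint h t y k' i := by
    intro i
    refine Prod.ext ?_ ?_
    · simp [stagePoint, Prod.fst_sum, M.stageSeries_fst hf, c, mul_comm]
    · simp [stagePoint, Prod.snd_sum, hk']
  have h3 : ‖k - k'‖ ≤ L * (h * (a * ‖k - k'‖)) + C * h ^ (n + 1) := by
    refine (pi_norm_le_iff_of_nonneg (by positivity)).2 fun i => ?_
    obtain ⟨h4, h5⟩ := hC i
    rw [hpt] at h4 h5
    have h6 := hL _ _ (hkr i) h4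
    have h7 := M.norm_stagePoint_sub_le (t := t) h0.le y y k k' i
    rw [sub_self, norm_zero, zero_add] at h7
    have h8 := (norm_snd_le _).trans h5
    have h9 := norm_add_le (k i - f (M.stagePoint h t y k' i).1 (M.stagePoint h t y k' i).2)
      (f (M.stagePoint h t y k' i).1 (M.stagePoint h t y k' i).2 - k' i)
    rw [sub_add_sub_cancel] at h9
    refine h9.trans (add_le_add ?_ h8)
    rw [hk i]
    exact h6.trans (mul_le_mul_of_nonneg_left h7 hL0)
  have h4 : ‖k - k'‖ ≤ 2 * C * h ^ (n + 1) := by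
    nlinarith [norm_nonneg (k - k'), pow_pos h0 (n + 1)]
  have h5 : y + h • ∑ i, M.b i • k i -
      (y + (h • ∑ i, M.b i • M.stageSeries (extendedField f) (n + 1) h (t, y) i).2) =
      h • ∑ i, M.b i • (k - k') i := by
    simp only [Pi.sub_apply, smul_sub, Finset.sum_sub_distrib, Prod.smul_snd, Prod.snd_sum, hk']
    abel
  rw [h5, norm_smul, Real.norm_eq_abs, abs_of_pos h0]
  have h6 := mul_le_mul_of_nonneg_left ((M.norm_sum_b_le (k - k')).trans
    (mul_le_mul_of_nonneg_left h4 (by positivity))) h0.le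
  refine h6.trans_eq ?_
  rw [pow_succ h (n + 1)]
  ring

end NonAutonomous

end RungeKutta

/-! ### Linear and nonlinear initial value problems -/

section Existence

variable {E : Type*} [NormedAddCommGroup E] [NormedSpace ℝ E]

theorem norm_le_gronwallBound_of_hasDerivWithinAt {u u' : ℝ → E} {a b δ K ε : ℝ}
    (hu : ∀ r ∈ Icc a b, HasDerivWithinAt u (u' r) (Icc a b) r) (ha : ‖u a‖ ≤ δ)
    (hb : ∀ r ∈ Icc a b, ‖u' r‖ ≤ K * ‖u r‖ + ε) :
    ∀ r ∈ Icc a b, ‖u r‖ ≤ gronwallBound δ K ε (r - a) :=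
  norm_le_gronwallBound_of_norm_deriv_right_le (fun r hr => (hu r hr).continuousWithinAt)
    (fun r hr => (hu r (Ico_subset_Icc_self hr)).mono_of_mem_nhdsWithin (Icc_mem_nhdsGE_of_mem hr))
    ha (fun r hr => hb r (Ico_subset_Icc_self hr))

/-- The radial retraction of a normed space onto a ball. -/
noncomputable def radialRetraction (R : ℝ) (x : E) : E := (R / max R ‖x‖) • x

theorem norm_radialRetraction_le {R : ℝ} (hR : 0 < R) (x : E) :
    ‖radialRetraction R x‖ ≤ R ∧ ‖radialRetraction R x‖ ≤ ‖x‖ := by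
  have hm : 0 < max R ‖x‖ := lt_max_of_lt_left hR
  rw [radialRetraction, norm_smul, Real.norm_eq_abs, abs_of_pos (by positivity)]
  constructor
  · rw [div_mul_eq_mul_div, div_le_iff₀ hm]
    exact mul_le_mul_of_nonneg_left (le_max_right _ _) hR.le
  · exact mul_le_of_le_one_left (norm_nonneg _) ((div_le_one hm).2 (le_max_left _ _))

theorem radialRetraction_of_norm_le {R : ℝ} (hR : 0 < R) {x : E} (hx : ‖x‖ ≤ R) :
    radialRetraction R x = x := by
  rw [radialRetraction, max_eq_left hx, div_self hR.ne', one_smul]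

theorem norm_radialRetraction_sub_le {R : ℝ} (hR : 0 < R) (x y : E) :
    ‖radialRetraction R x - radialRetraction R y‖ ≤ 2 * ‖x - y‖ := by
  have hx : 0 < max R ‖x‖ := lt_max_of_lt_left hR
  have hy : 0 < max R ‖y‖ := lt_max_of_lt_left hR
  have h1 : radialRetraction R x - radialRetraction R y =
      (R / max R ‖x‖) • (x - y) + (R / max R ‖x‖ - R / max R ‖y‖) • y := by
    simp only [radialRetraction]
    module
  have h2 : R / max R ‖x‖ ≤ 1 := (div_le_one hx).2 (le_max_left _ _)
  have h3 : |max R ‖y‖ - max R ‖x‖| ≤ ‖x - y‖ := by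
    refine (abs_max_sub_max_le_max _ _ _ _).trans ?_
    rw [sub_self, abs_zero, max_eq_right (abs_nonneg _), norm_sub_rev]
    exact abs_norm_sub_norm_le y x
  have h4 : R / max R ‖x‖ - R / max R ‖y‖ =
      (R / max R ‖x‖) * ((max R ‖y‖ - max R ‖x‖) / max R ‖y‖) := by
    field_simp
  rw [h1, two_mul]
  refine (norm_add_le _ _).trans (add_le_add ?_ ?_)
  · rw [norm_smul, Real.norm_eq_abs, abs_of_pos (by positivity)]
    exact mul_le_of_le_one_left (norm_nonneg _) h2
  · rw [norm_smul, h4, Real.norm_eq_abs, abs_mul, abs_of_pos (by positivity : 0 < R / max R ‖x‖),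
      abs_div, abs_of_pos hy, mul_assoc]
    refine (mul_le_of_le_one_left (by positivity) h2).trans ?_
    rw [div_mul_eq_mul_div, div_le_iff₀ hy]
    exact mul_le_mul h3 (le_max_right _ _) (norm_nonneg _) (norm_nonneg _)

variable [CompleteSpace E]

/-- An initial value problem with a field that is Lipschitz on a ball and vanishes at the centre has
a solution as long as Gronwall's inequality keeps the solution inside the ball. The field is
truncated outside of the ball, so that the Picard–Lindelöf theorem applies on the whole interval. -/
theorem exists_solution_of_lipschitz_ball {F : ℝ → E → E} {a b K R : ℝ} (hab : a ≤ b) (hK : 0 ≤ K)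
    (hR : 0 < R)
    (hF : ∀ r ∈ Icc a b, ∀ x y, ‖x‖ ≤ R → ‖y‖ ≤ R → ‖F r x - F r y‖ ≤ K * ‖x - y‖)
    (hF0 : ∀ r ∈ Icc a b, F r 0 = 0)
    (hFc : ∀ x, ‖x‖ ≤ R → ContinuousOn (fun r => F r x) (Icc a b))
    (v₀ : E) (hv₀ : ‖v₀‖ * Real.exp (K * (b - a)) ≤ R) :
    ∃ v : ℝ → E, v a = v₀ ∧ ∀ r ∈ Icc a b, HasDerivWithinAt v (F r (v r)) (Icc a b) r ∧
      ‖v r‖ ≤ ‖v₀‖ * Real.exp (K * (r - a)) ∧ ‖v r‖ ≤ R := by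
  have hFn : ∀ r ∈ Icc a b, ∀ x, ‖F r (radialRetraction R x)‖ ≤ K * ‖radialRetraction R x‖ := by
    intro r hr x
    have := hF r hr (radialRetraction R x) 0 (norm_radialRetraction_le hR x).1
      (by simpa using hR.le)
    simpa [hF0 r hr] using this
  have hpl : IsPicardLindelof (fun r x => F r (radialRetraction R x))
      (tmin := a) (tmax := b) ⟨a, le_rfl, hab⟩ v₀
      (Real.toNNReal (K * R * (b - a))) 0 (Real.toNNReal (K * R)) (Real.toNNReal (K * 2)) := by
    refine ⟨fun r hr => ?_, fun x _ => hFc _ (norm_radialRetraction_le hR x).1, fun r hr x _ => ?_,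
      ?_⟩
    · refine LipschitzOnWith.of_dist_le_mul fun x _ y _ => ?_
      rw [dist_eq_norm, dist_eq_norm, Real.coe_toNNReal _ (by positivity), mul_assoc]
      exact (hF r hr _ _ (norm_radialRetraction_le hR x).1 (norm_radialRetraction_le hR y).1).trans
        (mul_le_mul_of_nonneg_left (norm_radialRetraction_sub_le hR x y) hK)
    · rw [Real.coe_toNNReal _ (by positivity)]
      exact (hFn r hr x).trans (mul_le_mul_of_nonneg_left (norm_radialRetraction_le hR x).1 hK)
    · have h1 : 0 ≤ b - a := by linarith
      rw [Real.coe_toNNReal _ (by positivity), Real.coe_toNNReal _ (by positivity)]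
      simp [h1]
  obtain ⟨v, hva, hv⟩ := hpl.exists_eq_forall_mem_Icc_hasDerivWithinAt₀
  have hg := norm_le_gronwallBound_of_hasDerivWithinAt (K := K) (ε := 0) hv
    (by rw [hva] : ‖v a‖ ≤ ‖v₀‖) (fun r hr => by
      rw [add_zero]
      exact (hFn r hr _).trans
        (mul_le_mul_of_nonneg_left (norm_radialRetraction_le hR _).2 hK))
  refine ⟨v, hva, fun r hr => ?_⟩
  have h1 := hg r hr
  rw [gronwallBound_ε0] at h1
  have h2 : ‖v r‖ ≤ R := by
    refine (h1.trans (mul_le_mul_of_nonneg_left (Real.exp_le_exp.2 ?_) (norm_nonneg _))).trans hv₀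
    exact mul_le_mul_of_nonneg_left (by linarith [hr.2]) hK
  have h3 := hv r hr
  rw [radialRetraction_of_norm_le hR h2] at h3
  exact ⟨h3, h1, h2⟩

/-- Fundamental solutions `X` of `X' = A X` and `Y` of the adjoint equation `Y' = -Y A`. -/
theorem exists_fundamental {A : ℝ → E →L[ℝ] E} {a b : ℝ} (hab : a ≤ b)
    (hA : ContinuousOn A (Icc a b)) :
    ∃ X Y : ℝ → E →L[ℝ] E, (∀ r ∈ Icc a b, HasDerivWithinAt X (A r * X r) (Icc a b) r) ∧
      (∀ r ∈ Icc a b, HasDerivWithinAt Y (-(Y r * A r)) (Icc a b) r) ∧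
      (∀ r ∈ Icc a b, X r * Y r = 1) := by
  obtain ⟨K, hK⟩ := isCompact_Icc.exists_bound_of_continuousOn hA
  have hK0 : 0 ≤ K := (norm_nonneg _).trans (hK a ⟨le_rfl, hab⟩)
  set R := ‖(1 : E →L[ℝ] E)‖ * Real.exp (K * (b - a)) + 1 with hRdef
  have hR : 0 < R := by positivity
  obtain ⟨X, hXa, hX⟩ := exists_solution_of_lipschitz_ball (F := fun r X => A r * X) hab hK0 hR
    (fun r hr x y _ _ => by
      rw [← mul_sub]
      exact (norm_mul_le _ _).trans (mul_le_mul_of_nonneg_right (hK r hr) (norm_nonneg _)))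
    (fun r _ => mul_zero _) (fun x _ => hA.mul continuousOn_const) 1 (by linarith)
  obtain ⟨Y, hYa, hY⟩ := exists_solution_of_lipschitz_ball (F := fun r Y => -(Y * A r)) hab hK0 hR
    (fun r hr x y _ _ => by
      rw [neg_sub_neg, ← sub_mul, mul_comm K, norm_sub_rev x y]
      exact (norm_mul_le _ _).trans (mul_le_mul_of_nonneg_left (hK r hr) (norm_nonneg _)))
    (fun r _ => by simp) (fun x _ => (continuousOn_const.mul hA).neg) 1 (by linarith)
  refine ⟨X, Y, fun r hr => (hX r hr).1, fun r hr => (hY r hr).1, fun r hr => ?_⟩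
  have hZ : ∀ r ∈ Icc a b, HasDerivWithinAt (fun r => X r * Y r - 1)
      (A r * (X r * Y r - 1) - (X r * Y r - 1) * A r) (Icc a b) r := by
    intro r hr
    refine (((hX r hr).1.mul (hY r hr).1).sub_const 1).congr_deriv ?_
    noncomm_ring
  have := norm_le_gronwallBound_of_hasDerivWithinAt (δ := 0) (K := 2 * K) (ε := 0) hZ
    (by simp [hXa, hYa]) (fun r hr => by
      refine (norm_sub_le _ _).trans ?_
      have h1 := norm_mul_le (A r) (X r * Y r - 1)
      have h2 := norm_mul_le (X r * Y r - 1) (A r)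
      have h3 := mul_le_mul_of_nonneg_right (hK r hr) (norm_nonneg (X r * Y r - 1))
      linarith) r hr
  rw [gronwallBound_ε0_δ0] at this
  exact sub_eq_zero.1 (norm_le_zero_iff.1 this)

/-- Variation of constants. -/
theorem hasDerivWithinAt_duhamel {A X Y : ℝ → E →L[ℝ] E} {ℓ : ℝ → E} {a b : ℝ}
    (hX : ∀ r ∈ Icc a b, HasDerivWithinAt X (A r * X r) (Icc a b) r)
    (hY : ContinuousOn Y (Icc a b)) (hXY : ∀ r ∈ Icc a b, X r * Y r = 1)
    (hℓ : ContinuousOn ℓ (Icc a b)) {t : ℝ} (ht : t ∈ Icc a b) :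
    HasDerivWithinAt (fun t => X t (∫ r in a..t, Y r (ℓ r)))
      (A t (X t (∫ r in a..t, Y r (ℓ r))) + ℓ t) (Icc a b) t := by
  have hc : ContinuousOn (fun r => Y r (ℓ r)) (Icc a b) := hY.clm_apply hℓ
  have h1 : HasDerivWithinAt (fun t => ∫ r in a..t, Y r (ℓ r)) (Y t (ℓ t)) (Icc a b) t := by
    have := ODE.hasDerivWithinAt_picard_Icc (f := fun r (_ : E) => Y r (ℓ r))
      (α := fun _ => (0 : E)) (u := univ) (t₀ := a) ⟨le_rfl, ht.1.trans ht.2⟩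
      (hc.comp continuousOn_fst fun q hq => hq.1) continuousOn_const (fun _ _ => mem_univ _) 0 ht
    exact this.congr (fun r _ => by simp) (by simp)
  refine ((hX t ht).clm_apply h1).congr_deriv ?_
  congr 1
  exact congrArg (fun L : E →L[ℝ] E => L (ℓ t)) (hXY t ht)

end Existence

/-! ### The flow and its derivative -/

section Flow

variable {V : Type u} [NormedAddCommGroup V] [NormedSpace ℝ V] {f : ℝ → V → V}

theorem exists_norm_le_of_isSolutionOn {t₀ T : ℝ} {y : ℝ → V} (hy : IsSolutionOn f y (Icc t₀ T)) :
    ∃ r, 0 ≤ r ∧ ∀ t ∈ Icc t₀ T, ‖(t, y t)‖ ≤ r := by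
  have hc : ContinuousOn (fun t => (t, y t)) (Icc t₀ T) :=
    continuousOn_id.prodMk fun t ht => (hy t ht).continuousWithinAt
  obtain ⟨C, hC⟩ := isCompact_Icc.exists_bound_of_continuousOn hc
  exact ⟨max C 0, le_max_right _ _, fun t ht => (hC t ht).trans (le_max_left _ _)⟩

/-- The derivative of the right-hand side with respect to `y`, along the solution `y`. -/
noncomputable def linearization (f : ℝ → V → V) (y : ℝ → V) (t : ℝ) : V →L[ℝ] V :=
  (fderiv ℝ (fun q : ℝ × V => f q.1 q.2) (t, y t)).comp (ContinuousLinearMap.inr ℝ ℝ V)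

theorem continuousOn_linearization (hf : ContDiff ℝ ∞ fun q : ℝ × V => f q.1 q.2) {S : Set ℝ}
    {y : ℝ → V} (hy : IsSolutionOn f y S) : ContinuousOn (linearization f y) S := by
  have hc : ContinuousOn (fun t => (t, y t)) S :=
    continuousOn_id.prodMk fun t ht => (hy t ht).continuousWithinAt
  exact ((hf.continuous_fderiv (by simp)).comp_continuousOn hc).clm_comp continuousOn_const

variable [ProperSpace V]

theorem IsSolutionOn.eqOn (hf : ContDiff ℝ ∞ fun q : ℝ × V => f q.1 q.2) {a b : ℝ} {u v : ℝ → V}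
    (hu : IsSolutionOn f u (Icc a b)) (hv : IsSolutionOn f v (Icc a b)) (h : u a = v a) :
    EqOn u v (Icc a b) := by
  obtain ⟨r₁, -, hr₁⟩ := exists_norm_le_of_isSolutionOn hu
  obtain ⟨r₂, -, hr₂⟩ := exists_norm_le_of_isSolutionOn hv
  obtain ⟨L, hL0, hL⟩ := exists_lipschitz hf (max r₁ r₂)
  intro t ht
  have := norm_le_gronwallBound_of_hasDerivWithinAt (u := fun r => u r - v r) (δ := 0) (K := L)
    (ε := 0) (fun r hr => (hu r hr).sub (hv r hr)) (by simp [h]) (fun r hr => by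
      have := hL (r, u r) (r, v r) ((hr₁ r hr).trans (le_max_left _ _))
        ((hr₂ r hr).trans (le_max_right _ _))
      simpa [Prod.norm_def] using this) t ht
  rw [gronwallBound_ε0_δ0] at this
  exact sub_eq_zero.1 (norm_le_zero_iff.1 this)

theorem flowMap_eq (hf : ContDiff ℝ ∞ fun q : ℝ × V => f q.1 q.2) {s t : ℝ} (hst : s ≤ t)
    {u : ℝ → V} (hu : IsSolutionOn f u (Icc s t)) : flowMap f s t (u s) = u t := by
  have h := Classical.epsilon_spec (p := fun z => ∃ v : ℝ → V,
    IsSolutionOn f v (uIcc s t) ∧ v s = u s ∧ v t = z)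
    ⟨u t, u, by rwa [uIcc_of_le hst], rfl, rfl⟩
  obtain ⟨v, hv, hvs, hvt⟩ := h
  rw [uIcc_of_le hst] at hv
  exact hvt.symm.trans (hv.eqOn hf hu hvs ⟨hst, le_rfl⟩)

/-- The derivative of the flow along a solution is given by the fundamental solutions of the
linearized equation. -/
theorem hasFDerivAt_flowMap (hf : ContDiff ℝ ∞ fun q : ℝ × V => f q.1 q.2) {t₀ T : ℝ} {y : ℝ → V}
    (hy : IsSolutionOn f y (Icc t₀ T)) {X Y : ℝ → V →L[ℝ] V}
    (hX : ∀ r ∈ Icc t₀ T, HasDerivWithinAt X (linearization f y r * X r) (Icc t₀ T) r)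
    (hXY : ∀ r ∈ Icc t₀ T, X r * Y r = 1) {s t : ℝ} (hs : t₀ ≤ s) (hst : s ≤ t) (ht : t ≤ T) :
    HasFDerivAt (flowMap f s t) (X t * Y s) (y s) := by
  obtain ⟨ρ, hρ0, hρ⟩ := exists_norm_le_of_isSolutionOn hy
  obtain ⟨K, hK0, hK⟩ := exists_lipschitz hf (ρ + 1)
  obtain ⟨C, hC0, hC⟩ := exists_taylor_two hf (ρ + 1)
  have hsub : Icc s t ⊆ Icc t₀ T := Icc_subset_Icc hs ht
  have hyst : IsSolutionOn f y (Icc s t) := fun r hr => (hy r (hsub hr)).mono hsub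
  obtain ⟨B, hB⟩ := isCompact_Icc.exists_bound_of_continuousOn (continuousOn_linearization hf hy)
  set m := Real.exp (K * (t - s)) with hm
  have hm0 : 0 < m := Real.exp_pos _
  set B' := max B 1 with hB'
  have hB'0 : 0 < B' := lt_max_of_lt_right zero_lt_one
  have hpt : ∀ r ∈ Icc s t, ∀ v : V, ‖v‖ ≤ 1 → ‖(r, y r + v)‖ ≤ ρ + 1 := by
    intro r hr v hv
    have h1 : (r, y r + v) = (r, y r) + (0, v) := by simp
    rw [h1]
    refine (norm_add_le _ _).trans (add_le_add (hρ r (hsub hr)) ?_)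
    rw [Prod.norm_def]
    simpa using hv
  have hpt0 : ∀ r ∈ Icc s t, ‖(r, y r)‖ ≤ ρ + 1 := fun r hr => (hρ r (hsub hr)).trans (by linarith)
  set D : V → V := fun x => flowMap f s t x - (y t + (X t * Y s) (x - y s)) with hD
  have hbound : ∀ᶠ x in nhds (y s), ‖D x‖ ≤
      (C * m ^ 2 / B' * (Real.exp (B' * (t - s)) - 1)) * ‖‖x - y s‖ ^ 2‖ := by
    have hball : Metric.ball (y s) (1 / m) ∈ nhds (y s) := Metric.ball_mem_nhds _ (by positivity)
    filter_upwards [hball] with x hx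
    rw [mem_ball_iff_norm, lt_div_iff₀ hm0] at hx
    -- The difference `v` of the solution through `x` and of `y` satisfies the linearized equation
    -- up to a defect that is quadratic in `x - y s`.
    obtain ⟨v, hvs, hv⟩ := exists_solution_of_lipschitz_ball (a := s) (b := t) (K := K) (R := 1)
      (F := fun r v => f r (y r + v) - f r (y r)) hst hK0 one_pos
      (fun r hr v w hv hw => by
        have := hK (r, y r + v) (r, y r + w) (hpt r hr v hv) (hpt r hr w hw)
        simpa [Prod.norm_def] using this)
      (fun r _ => by simp) (fun v _ => by
        have hyc : ContinuousOn y (Icc s t) := fun r hr => (hyst r hr).continuousWithinAt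
        exact (hf.continuous.comp_continuousOn
          (continuousOn_id.prodMk (hyc.add continuousOn_const))).sub
          (hf.continuous.comp_continuousOn (continuousOn_id.prodMk hyc)))
      (x - y s) hx.le
    have hu : IsSolutionOn f (fun r => y r + v r) (Icc s t) := fun r hr =>
      ((hyst r hr).add (hv r hr).1).congr_deriv (by abel)
    have hflow := flowMap_eq hf hst hu
    simp only [hvs, add_sub_cancel] at hflow
    have hder : ∀ r ∈ Icc s t, HasDerivWithinAt (fun r => v r - (X r * Y s) (x - y s))
        (f r (y r + v r) - f r (y r) - linearization f y r ((X r * Y s) (x - y s)))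
        (Icc s t) r := by
      intro r hr
      have h1 := (((hX r (hsub hr)).mono hsub).clm_comp
        (hasDerivWithinAt_const r (Icc s t) (Y s))).clm_apply
        (hasDerivWithinAt_const r (Icc s t) (x - y s))
      refine ((hv r hr).1.sub h1).congr_deriv ?_
      simp
    have hg := norm_le_gronwallBound_of_hasDerivWithinAt (δ := 0) (K := B')
      (ε := C * (m * ‖x - y s‖) ^ 2) hder (by
        have h1 : X s * Y s = 1 := hXY s ⟨hs, hst.trans ht⟩
        simp [h1, hvs]) (fun r hr => by
      have h1 := hC (r, y r) (r, y r + v r) (hpt0 r hr) (hpt r hr _ (hv r hr).2.2)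
      have h2 : ((r, y r + v r) - (r, y r) : ℝ × V) = (0, v r) := by simp
      have h3 : ‖((0, v r) : ℝ × V)‖ = ‖v r‖ := by simp [Prod.norm_def]
      rw [h2, h3] at h1
      have h4 : ‖v r‖ ≤ m * ‖x - y s‖ := by
        refine (hv r hr).2.1.trans ?_
        rw [mul_comm]
        refine mul_le_mul_of_nonneg_right (Real.exp_le_exp.2 ?_) (norm_nonneg _)
        exact mul_le_mul_of_nonneg_left (by linarith [hr.2]) hK0
      have h5 := mul_le_mul_of_nonneg_left (pow_le_pow_left₀ (norm_nonneg _) h4 2) hC0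
      have h6 : f r (y r + v r) - f r (y r) - linearization f y r ((X r * Y s) (x - y s)) =
          (f r (y r + v r) - f r (y r) -
            fderiv ℝ (fun q : ℝ × V => f q.1 q.2) (r, y r) (0, v r)) +
          linearization f y r (v r - (X r * Y s) (x - y s)) := by
        have h7 : linearization f y r (v r) =
            fderiv ℝ (fun q : ℝ × V => f q.1 q.2) (r, y r) (0, v r) := by simp [linearization]
        rw [map_sub (linearization f y r) (v r), h7]
        abel
      rw [h6, add_comm]
      refine (norm_add_le _ _).trans (add_le_add ?_ (h1.trans h5))
      refine (ContinuousLinearMap.le_opNorm _ _).trans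
        (mul_le_mul_of_nonneg_right ?_ (norm_nonneg _))
      exact (hB r (hsub hr)).trans (le_max_left _ _)) t ⟨hst, le_rfl⟩
    have h1 : D x = v t - (X t * Y s) (x - y s) := by
      simp only [hD, hflow]
      abel
    rw [h1]
    refine hg.trans_eq ?_
    rw [gronwallBound_of_K_ne_0 hB'0.ne', Real.norm_eq_abs, abs_of_nonneg (by positivity)]
    ring
  have hD' : HasFDerivAt D (0 : V →L[ℝ] V) (y s) :=
    (Asymptotics.IsBigO.of_bound _ hbound).hasFDerivAt (n := 2) one_lt_two
  have h1 : HasFDerivAt (fun x => y t + (X t * Y s) (x - y s)) (X t * Y s) (y s) :=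
    (((X t * Y s).hasFDerivAt.comp (y s) ((hasFDerivAt_id (y s)).sub_const (y s))).const_add
      (y t)).congr_fderiv (by ext; simp)
  have h2 := hD'.add h1
  rw [zero_add] at h2
  refine h2.congr_of_eventuallyEq (Filter.Eventually.of_forall fun x => ?_)
  simp [hD]

/-- Local existence of solutions. -/
theorem exists_isSolutionOn (hf : ContDiff ℝ ∞ fun q : ℝ × V => f q.1 q.2) (t₀ : ℝ) (x₀ : V) :
    ∃ T > t₀, ∃ u : ℝ → V, u t₀ = x₀ ∧ IsSolutionOn f u (Icc t₀ T) := by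
  have hg := RungeKutta.contDiff_extendedField hf
  obtain ⟨α, hα0, ε, hε, hα⟩ :=
    ContDiffAt.exists_forall_mem_closedBall_exists_eq_forall_mem_Ioo_hasDerivAt₀
      (x₀ := (t₀, x₀)) (hg.of_le (by simp)).contDiffAt t₀
  have hsub : Icc t₀ (t₀ + ε / 2) ⊆ Ioo (t₀ - ε) (t₀ + ε) := fun r hr =>
    ⟨by linarith [hr.1], by linarith [hr.2]⟩
  have h1 : ∀ r ∈ Icc t₀ (t₀ + ε / 2), (α r).1 = r := by
    intro r hr
    have := norm_le_gronwallBound_of_hasDerivWithinAt (u := fun r => (α r).1 - r) (u' := fun _ => 0)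
      (a := t₀) (b := t₀ + ε / 2) (δ := 0) (K := 0) (ε := 0) (fun r hr => by
        have h2 : HasDerivAt (fun r => (α r).1) 1 r :=
          (ContinuousLinearMap.fst ℝ ℝ V).hasFDerivAt.comp_hasDerivAt r (hα r (hsub hr))
        exact ((h2.sub (hasDerivAt_id r)).congr_deriv (sub_self _)).hasDerivWithinAt)
      (by simp [hα0]) (by simp) r hr
    rw [gronwallBound_ε0_δ0] at this
    exact sub_eq_zero.1 (norm_le_zero_iff.1 this)
  refine ⟨t₀ + ε / 2, by linarith, fun r => (α r).2, by simp [hα0], fun r hr => ?_⟩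
  have h2 : HasDerivAt (fun r => (α r).2) (f (α r).1 (α r).2) r :=
    (ContinuousLinearMap.snd ℝ ℝ V).hasFDerivAt.comp_hasDerivAt r (hα r (hsub hr))
  rw [h1 r hr] at h2
  exact h2.hasDerivWithinAt

end Flow

open RungeKutta

/-! ### The perturbation in the modified equation -/

/-- Sums over trees, sorted by powers of `h`. -/
theorem PTree.sum_treesLE_pow_smul {E : Type*} [AddCommGroup E] [Module ℝ E] (h : ℝ)
    (φ : PTree → E) (n : ℕ) :
    ∑ τ ∈ treesLE (n + 1), h ^ (τ.order - 1) • φ τ = φ leaf + ∑ j ∈ Finset.Icc 1 n, h ^ j •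
      ∑ τ ∈ treesLE (j + 1), if τ.order = j + 1 then φ τ else 0 := by
  induction n with
  | zero =>
    have h1 : treesLE (0 + 1) = {leaf} := by
      ext τ
      rw [mem_treesLE, Finset.mem_singleton]
      cases τ with
      | leaf => simp [order]
      | graft θ δ =>
        have h1 := θ.order_pos
        have h2 := δ.order_pos
        simp only [order, reduceCtorEq, iff_false]
        omega
    simp [h1, order]
  | succ n ih =>
    have h1 : ((treesLE (n + 1 + 1)).filter fun τ => ¬ τ.order = n + 1 + 1) = treesLE (n + 1) := by
      ext τ
      simp only [Finset.mem_filter, mem_treesLE]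
      omega
    rw [Finset.sum_Icc_succ_top (by omega), ← add_assoc, ← ih,
      ← Finset.sum_filter_add_sum_filter_not _ (fun τ : PTree => τ.order = n + 1 + 1), h1, add_comm]
    congr 1
    rw [Finset.sum_filter, Finset.smul_sum]
    refine Finset.sum_congr rfl fun τ _ => ?_
    split_ifs with h2
    · rw [h2, Nat.add_sub_cancel]
    · rw [smul_zero]

section Perturbation

variable {V : Type u} [NormedAddCommGroup V] [NormedSpace ℝ V]

/-- The coefficient of `h ^ j` in the `y`-component of the modified vector field of
`y' = f(t, y)`. -/
noncomputable def perturbationTerm (f : ℝ → V → V) (b : Coeff) (j : ℕ) (q : ℝ × V) : V :=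
  ∑ τ ∈ PTree.treesLE (j + 1), if τ.order = j + 1 then
    (τ.weight * (b (some (RTree.mk τ)) / τ.density)) • (elemDiffP (extendedField f) τ q).2 else 0

/-- The difference of the `y`-components of the truncated modified vector field and of the original
one. -/
noncomputable def perturbation (f : ℝ → V → V) (b : Coeff) (n : ℕ) (h : ℝ) (q : ℝ × V) : V :=
  ∑ j ∈ Finset.Icc 1 n, h ^ j • perturbationTerm f b j q

variable {f : ℝ → V → V}

theorem contDiff_perturbationTerm (hf : ContDiff ℝ ∞ fun q : ℝ × V => f q.1 q.2) (b : Coeff)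
    (j : ℕ) : ContDiff ℝ ∞ (perturbationTerm f b j) := by
  refine ContDiff.sum fun τ _ => ?_
  split_ifs
  · exact contDiff_const.smul
      (contDiff_snd.comp (contDiff_elemDiffP (contDiff_extendedField hf) τ))
  · exact contDiff_const

theorem contDiff_perturbation (hf : ContDiff ℝ ∞ fun q : ℝ × V => f q.1 q.2) (b : Coeff)
    (n : ℕ) (h : ℝ) : ContDiff ℝ ∞ (perturbation f b n h) :=
  ContDiff.sum fun j _ => contDiff_const.smul (contDiff_perturbationTerm hf b j)

theorem modifiedField_extendedField (hf : ContDiff ℝ ∞ fun q : ℝ × V => f q.1 q.2) {b : Coeff}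
    (hb : b (some RTree.leaf) = 1) (n : ℕ) (h : ℝ) (q : ℝ × V) :
    modifiedField (extendedField f) (n + 1) b h q = (1, f q.1 q.2 + perturbation f b n h q) := by
  have hleaf : PTree.weight .leaf * (b (some (RTree.mk .leaf)) / PTree.density .leaf) = 1 := by
    have : b (some (RTree.mk .leaf)) = 1 := hb
    simp [this, PTree.weight, PTree.density, PTree.order, PTree.childDensity]
  refine Prod.ext ?_ ?_
  · rw [modifiedField, sum_elemDiffP_fst hf, hleaf]
    simp [PTree.order]
  · have h1 := PTree.sum_treesLE_pow_smul h (fun τ =>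
      (τ.weight * (b (some (RTree.mk τ)) / τ.density)) • (elemDiffP (extendedField f) τ q).2) n
    simp only [modifiedField, Prod.snd_sum, Prod.smul_snd, mul_smul (h ^ _)]
    rw [h1, hleaf, one_smul, elemDiffP_leaf]
    rfl

/-- The perturbation as a sum over rooted trees. -/
theorem sum_treesTwoTo_odeElemDiff (hf : ContDiff ℝ ∞ fun q : ℝ × V => f q.1 q.2) (b : Coeff)
    (n : ℕ) (h : ℝ) (q : ℝ × V) :
    ∑ τ ∈ RTree.treesTwoTo (n + 1), (h ^ (τ.order - 1) * b (some τ) *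
      ((τ.numLabellings : ℝ) / (τ.order.factorial : ℝ))) • odeElemDiff f τ q.1 q.2 =
      perturbation f b n h q := by
  have h1 := RTree.sum_treesTwoTo (n + 1) fun τ =>
    (h ^ (τ.order - 1) * b (some τ)) • odeElemDiff f τ q.1 q.2
  simp only [smul_smul] at h1
  simp only [mul_comm _ ((RTree.numLabellings _ : ℝ) / _), h1]
  have h2 := PTree.sum_treesLE_pow_smul h (fun τ => if 2 ≤ τ.order then
    (τ.weight * (b (some (RTree.mk τ)) / τ.density)) • (elemDiffP (extendedField f) τ q).2 else 0) n
  have h3 : ∀ τ : PTree, odeElemDiff f (RTree.mk τ) q.1 q.2 = (elemDiffP (extendedField f) τ q).2 :=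
    fun τ => congrArg Prod.snd (elemDiff_mk (contDiff_extendedField hf) τ q)
  rw [if_neg (by simp [PTree.order]), zero_add] at h2
  refine Eq.trans (Finset.sum_congr rfl fun τ _ => ?_) (h2.trans ?_)
  · rw [h3, RTree.order_mk]
    split_ifs
    · rw [smul_smul]
      congr 1
      ring
    · rw [smul_zero]
  · refine Finset.sum_congr rfl fun j hj => ?_
    rw [perturbationTerm]
    congr 1
    refine Finset.sum_congr rfl fun τ _ => ?_
    have := (Finset.mem_Icc.1 hj).1
    split_ifs <;> first | rfl | omega

end Perturbation

/-! ### The linearized global error -/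

section Duhamel

variable {E : Type*} [NormedAddCommGroup E] [NormedSpace ℝ E]

/-- The solution of `e' = A e + ℓ` with `e(a) = 0`, by variation of constants: `X` is a fundamental
solution of the homogeneous equation and `Y` its inverse. -/
noncomputable def duhamel (X Y : ℝ → E →L[ℝ] E) (a : ℝ) (ℓ : ℝ → E) (t : ℝ) : E :=
  X t (∫ r in a..t, Y r (ℓ r))

theorem duhamel_self (X Y : ℝ → E →L[ℝ] E) (a : ℝ) (ℓ : ℝ → E) : duhamel X Y a ℓ a = 0 := by
  simp [duhamel]

variable {X Y : ℝ → E →L[ℝ] E} {a b : ℝ}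

theorem duhamel_sum (hY : ContinuousOn Y (Icc a b)) {ι : Type*} (S : Finset ι) (c : ι → ℝ)
    {ℓ : ι → ℝ → E} (hℓ : ∀ i ∈ S, ContinuousOn (ℓ i) (Icc a b)) {t : ℝ} (ht : t ∈ Icc a b) :
    duhamel X Y a (fun r => ∑ i ∈ S, c i • ℓ i r) t = ∑ i ∈ S, c i • duhamel X Y a (ℓ i) t := by
  simp only [duhamel, map_sum, map_smul]
  rw [intervalIntegral.integral_finsetSum]
  · simp only [intervalIntegral.integral_smul, map_sum, map_smul]
  · intro i hi
    refine ContinuousOn.intervalIntegrable ?_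
    rw [uIcc_of_le ht.1]
    exact (continuousOn_const.smul (hY.clm_apply (hℓ i hi))).mono (Icc_subset_Icc_right ht.2)

theorem exists_norm_duhamel_le (hX : ContinuousOn X (Icc a b)) (hY : ContinuousOn Y (Icc a b)) :
    ∃ C, 0 ≤ C ∧ ∀ (ℓ : ℝ → E) (B : ℝ), (∀ r ∈ Icc a b, ‖ℓ r‖ ≤ B) → ∀ t ∈ Icc a b,
      ‖duhamel X Y a ℓ t‖ ≤ C * B := by
  obtain ⟨C₁, hC₁⟩ := isCompact_Icc.exists_bound_of_continuousOn hX
  obtain ⟨C₂, hC₂⟩ := isCompact_Icc.exists_bound_of_continuousOn hY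
  refine ⟨|C₁| * (|C₂| * |b - a|), by positivity, fun ℓ B hB t ht => ?_⟩
  have hB0 : 0 ≤ B := (norm_nonneg _).trans (hB t ht)
  have h1 : ‖∫ r in a..t, Y r (ℓ r)‖ ≤ |C₂| * B * |t - a| := by
    refine intervalIntegral.norm_integral_le_of_norm_le_const fun r hr => ?_
    rw [uIoc_of_le ht.1] at hr
    have hr' : r ∈ Icc a b := ⟨hr.1.le, hr.2.trans ht.2⟩
    exact (ContinuousLinearMap.le_opNorm _ _).trans
      (mul_le_mul ((hC₂ r hr').trans (le_abs_self _)) (hB r hr') (norm_nonneg _) (abs_nonneg _))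
  have h2 : |t - a| ≤ |b - a| := by
    rw [abs_of_nonneg (by linarith [ht.1]), abs_of_nonneg (by linarith [ht.1, ht.2])]
    linarith [ht.2]
  have h3 : |C₂| * B * |t - a| ≤ |C₂| * B * |b - a| :=
    mul_le_mul_of_nonneg_left h2 (by positivity)
  calc ‖duhamel X Y a ℓ t‖ ≤ ‖X t‖ * ‖∫ r in a..t, Y r (ℓ r)‖ := ContinuousLinearMap.le_opNorm _ _
    _ ≤ |C₁| * (|C₂| * B * |b - a|) := mul_le_mul ((hC₁ t ht).trans (le_abs_self _)) (h1.trans h3)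
        (norm_nonneg _) (abs_nonneg _)
    _ = |C₁| * (|C₂| * |b - a|) * B := by ring

end Duhamel

section ElementaryIntegrals

variable {V : Type u} [NormedAddCommGroup V] [NormedSpace ℝ V] {f : ℝ → V → V} {t₀ T : ℝ}
  {y : ℝ → V}

theorem IsSolutionOn.continuousOn_comp {F : Type*} [TopologicalSpace F] {S : Set ℝ}
    (hy : IsSolutionOn f y S) {G : ℝ × V → F} (hG : Continuous G) :
    ContinuousOn (fun r => G (r, y r)) S :=
  hG.comp_continuousOn (continuousOn_id.prodMk fun r hr => (hy r hr).continuousWithinAt)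

theorem continuousOn_odeElemDiff (hf : ContDiff ℝ ∞ fun q : ℝ × V => f q.1 q.2) {S : Set ℝ}
    (hy : IsSolutionOn f y S) (τ : RTree) : ContinuousOn (fun r => odeElemDiff f τ r (y r)) S :=
  hy.continuousOn_comp (G := fun q => (elemDiff (extendedField f) τ q).2)
    (contDiff_elemDiffP (contDiff_extendedField hf) (Quotient.out τ)).continuous.snd

variable [ProperSpace V] {X Y : ℝ → V →L[ℝ] V}

theorem elemIntegrand_eq (hf : ContDiff ℝ ∞ fun q : ℝ × V => f q.1 q.2)
    (hy : IsSolutionOn f y (Icc t₀ T))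
    (hX : ∀ r ∈ Icc t₀ T, HasDerivWithinAt X (linearization f y r * X r) (Icc t₀ T) r)
    (hXY : ∀ r ∈ Icc t₀ T, X r * Y r = 1) (τ : RTree) {t : ℝ} (ht : t ∈ Icc t₀ T) :
    EqOn (elemIntegrand f y τ t) (fun r => X t (Y r (odeElemDiff f τ r (y r)))) (uIcc t₀ t) := by
  intro r hr
  rw [uIcc_of_le ht.1] at hr
  rw [elemIntegrand, (hasFDerivAt_flowMap hf hy hX hXY hr.1 hr.2 ht.2).fderiv]
  rfl

theorem intervalIntegrable_elemIntegrand (hf : ContDiff ℝ ∞ fun q : ℝ × V => f q.1 q.2)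
    (hy : IsSolutionOn f y (Icc t₀ T))
    (hX : ∀ r ∈ Icc t₀ T, HasDerivWithinAt X (linearization f y r * X r) (Icc t₀ T) r)
    (hY : ContinuousOn Y (Icc t₀ T))
    (hXY : ∀ r ∈ Icc t₀ T, X r * Y r = 1) (τ : RTree) {t : ℝ} (ht : t ∈ Icc t₀ T) :
    IntervalIntegrable (elemIntegrand f y τ t) MeasureTheory.volume t₀ t := by
  refine ContinuousOn.intervalIntegrable
    (ContinuousOn.congr ?_ (elemIntegrand_eq hf hy hX hXY τ ht))
  rw [uIcc_of_le ht.1]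
  exact (continuousOn_const.clm_apply (hY.clm_apply (continuousOn_odeElemDiff hf hy τ))).mono
    (Icc_subset_Icc_right ht.2)

theorem elemIntegral_eq_duhamel (hf : ContDiff ℝ ∞ fun q : ℝ × V => f q.1 q.2)
    (hy : IsSolutionOn f y (Icc t₀ T))
    (hX : ∀ r ∈ Icc t₀ T, HasDerivWithinAt X (linearization f y r * X r) (Icc t₀ T) r)
    (hY : ContinuousOn Y (Icc t₀ T))
    (hXY : ∀ r ∈ Icc t₀ T, X r * Y r = 1) (τ : RTree) {t : ℝ} (ht : t ∈ Icc t₀ T) :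
    elemIntegral f y t₀ τ t = duhamel X Y t₀ (fun r => odeElemDiff f τ r (y r)) t := by
  rw [elemIntegral, intervalIntegral.integral_congr (elemIntegrand_eq hf hy hX hXY τ ht), duhamel]
  refine ContinuousLinearMap.intervalIntegral_comp_comm _ (ContinuousOn.intervalIntegrable ?_)
  rw [uIcc_of_le ht.1]
  exact (hY.clm_apply (continuousOn_odeElemDiff hf hy τ)).mono (Icc_subset_Icc_right ht.2)

/-- The sum over trees in the error expansion is the solution of the linearized equation, with the
perturbation of the modified equation as inhomogeneity. -/
theorem sum_elemIntegral_eq_duhamel (hf : ContDiff ℝ ∞ fun q : ℝ × V => f q.1 q.2)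
    (hy : IsSolutionOn f y (Icc t₀ T))
    (hX : ∀ r ∈ Icc t₀ T, HasDerivWithinAt X (linearization f y r * X r) (Icc t₀ T) r)
    (hY : ContinuousOn Y (Icc t₀ T))
    (hXY : ∀ r ∈ Icc t₀ T, X r * Y r = 1) (b : Coeff) (n : ℕ) (h : ℝ) {t : ℝ}
    (ht : t ∈ Icc t₀ T) :
    ∑ τ ∈ RTree.treesTwoTo (n + 1), (h ^ (τ.order - 1) * b (some τ) *
      ((τ.numLabellings : ℝ) / (τ.order.factorial : ℝ))) • elemIntegral f y t₀ τ t =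
      duhamel X Y t₀ (fun r => perturbation f b n h (r, y r)) t := by
  simp only [← sum_treesTwoTo_odeElemDiff hf]
  rw [duhamel_sum hY _ _ (fun τ _ => continuousOn_odeElemDiff hf hy τ) ht]
  exact Finset.sum_congr rfl fun τ _ => by rw [elemIntegral_eq_duhamel hf hy hX hY hXY τ ht]

end ElementaryIntegrals

/-! ### Accumulation of local errors -/

namespace RungeKutta

variable {s : ℕ} (M : RungeKutta s) {V : Type u} [NormedAddCommGroup V] [NormedSpace ℝ V]
  [ProperSpace V] {f : ℝ → V → V}

/-- A curve that the method reproduces up to `O(h ^ (m + 1))` in each step is reproduced up to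
`O(h ^ m)` on the whole interval. -/
theorem exists_norm_results_sub_le (hf : ContDiff ℝ ∞ fun q : ℝ × V => f q.1 q.2) (r t₀ T : ℝ)
    {D : ℝ} (hD : 0 ≤ D) {m : ℕ} (hm : 1 ≤ m) :
    ∃ C, 0 ≤ C ∧ ∃ h₀ > 0, ∀ h : ℝ, 0 < h → h ≤ h₀ → ∀ u : ℝ → V,
      (∀ t ∈ Icc t₀ T, ‖(t, u t)‖ ≤ r) →
      (∀ t, t₀ ≤ t → t + h ≤ T → ‖M.step f h t (u t) - u (t + h)‖ ≤ D * (h * h ^ m)) →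
      ∀ k : ℕ, t₀ + k * h ≤ T →
        ‖M.results f t₀ (u t₀) h k - u (t₀ + k * h)‖ ≤ C * h ^ m := by
  obtain ⟨L, hL0, h₁, h₁0, hL⟩ := M.exists_step_lipschitz hf (r + 1)
  set C := D * |T - t₀| * Real.exp (L * |T - t₀|) with hC
  have hC0 : 0 ≤ C := by positivity
  refine ⟨C, hC0, min h₁ (1 / (C + 1)), by positivity, fun h h0 hh u hu hstep => ?_⟩
  have hle1 : h ≤ 1 / (C + 1) := hh.trans (min_le_right _ _)
  have hh1 : h ≤ 1 := hle1.trans ((div_le_one (by positivity)).2 (by linarith))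
  have hCm : C * h ^ m ≤ 1 := by
    have h2 : h ^ m ≤ h := pow_le_of_le_one h0.le hh1 (by omega)
    rw [le_div_iff₀ (by positivity)] at hle1
    have h3 := mul_le_mul_of_nonneg_left h2 hC0
    linarith
  have hbd : ∀ k : ℕ, t₀ + k * h ≤ T →
      D * h ^ m * (k * h) * Real.exp (L * (k * h)) ≤ C * h ^ m := by
    intro k hk
    have h2 : k * h ≤ |T - t₀| := by linarith [le_abs_self (T - t₀)]
    have h3 : Real.exp (L * (k * h)) ≤ Real.exp (L * |T - t₀|) :=
      Real.exp_le_exp.2 (mul_le_mul_of_nonneg_left h2 hL0)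
    calc D * h ^ m * (k * h) * Real.exp (L * (k * h))
        ≤ D * h ^ m * |T - t₀| * Real.exp (L * |T - t₀|) := by gcongr
      _ = C * h ^ m := by rw [hC]; ring
  -- By `hbd` and `hCm`, the bound for `k` keeps the numerical result in the tube on which the step
  -- is Lipschitz.
  have key : ∀ k : ℕ, t₀ + k * h ≤ T → ‖M.results f t₀ (u t₀) h k - u (t₀ + k * h)‖ ≤
      D * h ^ m * (k * h) * Real.exp (L * (k * h)) := by
    intro k
    induction k with
    | zero => intro _; simp [results]
    | succ k ih =>
      intro hk
      push_cast at hk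
      have hk' : t₀ + k * h ≤ T := by linarith
      have ht : t₀ ≤ t₀ + k * h := by have : 0 ≤ k * h := by positivity
                                      linarith
      have ih' := ih hk'
      have hut := hu (t₀ + k * h) ⟨ht, hk'⟩
      have hres : ‖(t₀ + k * h, M.results f t₀ (u t₀) h k)‖ ≤ r + 1 := by
        have h2 : ((t₀ + k * h, M.results f t₀ (u t₀) h k) : ℝ × V) = (t₀ + k * h, u (t₀ + k * h)) +
            (0, M.results f t₀ (u t₀) h k - u (t₀ + k * h)) := by simp
        rw [h2]
        refine (norm_add_le _ _).trans (add_le_add hut ?_)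
        rw [Prod.norm_def]
        simpa using (ih'.trans (hbd k hk')).trans hCm
      have h2 := hL h h0 (hh.trans (min_le_left _ _)) (t₀ + k * h) _ _ hres
        (hut.trans (by linarith))
      have h3 := hstep (t₀ + k * h) ht (by linarith)
      have h4 : t₀ + ((k + 1 : ℕ) : ℝ) * h = t₀ + k * h + h := by push_cast; ring
      have h5 : 1 + L * h ≤ Real.exp (L * h) := by linarith [Real.add_one_le_exp (L * h)]
      have h6 : Real.exp (L * ((k + 1 : ℕ) * h)) = Real.exp (L * (k * h)) * Real.exp (L * h) := by
        rw [← Real.exp_add]; push_cast; ring_nf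
      have h7 : 1 ≤ Real.exp (L * (k * h)) * Real.exp (L * h) := by
        rw [← Real.exp_add]; exact Real.one_le_exp (by positivity)
      rw [h4, results, ← sub_add_sub_cancel _ (M.step f h (t₀ + k * h) (u (t₀ + k * h)))]
      calc _ ≤ _ := norm_add_le _ _
        _ ≤ (1 + L * h) * (D * h ^ m * (k * h) * Real.exp (L * (k * h))) + D * (h * h ^ m) * 1 := by
            refine add_le_add (h2.trans (mul_le_mul_of_nonneg_left ih' (by positivity))) ?_
            rwa [mul_one]
        _ ≤ Real.exp (L * h) * (D * h ^ m * (k * h) * Real.exp (L * (k * h))) +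
            D * (h * h ^ m) * (Real.exp (L * (k * h)) * Real.exp (L * h)) := by gcongr
        _ = D * h ^ m * ((k + 1 : ℕ) * h) * Real.exp (L * ((k + 1 : ℕ) * h)) := by
            rw [h6]; push_cast; ring
  exact fun k hk => (key k hk).trans (hbd k hk)

end RungeKutta

/-! ### The error expansion -/

section Expansion

variable {V : Type u} [NormedAddCommGroup V] [NormedSpace ℝ V] {f : ℝ → V → V}

/-- If the modified equation has no terms in `h, …, h ^ (q - 1)`, then the perturbation is divisible
by `h ^ q`. -/
theorem exists_perturbation_eq_pow_smul (hf : ContDiff ℝ ∞ fun q : ℝ × V => f q.1 q.2) {b : Coeff}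
    {q : ℕ} (hq : 1 ≤ q) (hvan : ∀ j, 1 ≤ j → j < q → ∀ x, perturbationTerm f b j x = 0) (n : ℕ) :
    ∃ S : ℝ × (ℝ × V) → V, ContDiff ℝ ∞ S ∧ ∀ h x, perturbation f b n h x = h ^ q • S (h, x) := by
  refine ⟨fun z => ∑ j ∈ Finset.Icc q n, z.1 ^ (j - q) • perturbationTerm f b j z.2,
    ContDiff.sum fun j _ => (contDiff_fst.pow _).smul
      ((contDiff_perturbationTerm hf b j).comp contDiff_snd), fun h x => ?_⟩
  simp only [perturbation, Finset.smul_sum]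
  rw [← Finset.sum_subset (Finset.Icc_subset_Icc_left hq)]
  · refine Finset.sum_congr rfl fun j hj => ?_
    rw [smul_smul, ← pow_add, Nat.add_sub_cancel' (Finset.mem_Icc.1 hj).1]
  · intro j hj hj'
    simp only [Finset.mem_Icc] at hj hj'
    rw [hvan j hj.1 (by omega) x, smul_zero]

variable [ProperSpace V] {t₀ T : ℝ} {y : ℝ → V} {X Y : ℝ → V →L[ℝ] V} {s : ℕ}

/-- The solution of the linearized equation, driven by the perturbation of the modified equation,
approximates the global error. Added to `y`, it solves the modified equation up to a defect of order
`2 q`: the nonlinear terms are quadratic in an error of order `q`. -/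
theorem exists_globalError_sub_duhamel_le (M : RungeKutta s) (hM : M.coeff (some RTree.leaf) = 1)
    (hf : ContDiff ℝ ∞ fun q : ℝ × V => f q.1 q.2) (hy : IsSolutionOn f y (Icc t₀ T))
    (hX : ∀ r ∈ Icc t₀ T, HasDerivWithinAt X (linearization f y r * X r) (Icc t₀ T) r)
    (hY : ContinuousOn Y (Icc t₀ T)) (hXY : ∀ r ∈ Icc t₀ T, X r * Y r = 1) {q : ℕ} (hq : 1 ≤ q)
    (hvan : ∀ j, 1 ≤ j → j < q → ∀ x, perturbationTerm f (modifiedCoeff M.coeff) j x = 0)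
    (n : ℕ) :
    ∃ C, ∃ h₀ > 0, ∀ h : ℝ, 0 < h → h ≤ h₀ → ∀ k : ℕ, t₀ + k * h ≤ T →
      ‖M.globalError f y t₀ h k - duhamel X Y t₀
        (fun r => perturbation f (modifiedCoeff M.coeff) n h (r, y r)) (t₀ + k * h)‖ ≤
        C * h ^ min (2 * q) (n + 1) := by
  have hg := contDiff_extendedField hf
  set b := modifiedCoeff M.coeff with hb
  have hbleaf : b (some RTree.leaf) = 1 := modifiedCoeff_leaf _
  obtain ⟨S, hS, hpS⟩ := exists_perturbation_eq_pow_smul hf hq hvan n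
  obtain ⟨ρ, hρ0, hρ⟩ := exists_norm_le_of_isSolutionOn hy
  obtain ⟨CS, hCS0, hCS⟩ := exists_norm_le_param hS.continuous (ρ + 1)
  obtain ⟨LS, hLS0, hLS⟩ := exists_lipschitz_param hS (ρ + 1)
  obtain ⟨CT, hCT0, hCT⟩ := exists_taylor_two hf (ρ + 1)
  obtain ⟨CX, hCX0, hCX⟩ := exists_norm_duhamel_le
    (fun r hr => (hX r hr).continuousWithinAt : ContinuousOn X (Icc t₀ T)) hY
  obtain ⟨C₁, hC₁0, hC₁⟩ := exists_oneStep_le hg (n + 1) M.coeff hM (ρ + 1)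
  obtain ⟨C₂, hC₂0, h₂, h₂0, hC₂⟩ := M.exists_step_sub_bSeries_le hf n (ρ + 1)
  set Ce := CX * CS with hCe
  have hCe0 : 0 ≤ Ce := by positivity
  set Cε := CT * Ce ^ 2 + LS * Ce with hCε
  have hCε0 : 0 ≤ Cε := by positivity
  set m := min (2 * q) (n + 1) with hm
  obtain ⟨C, hC0, h₃, h₃0, hC⟩ := M.exists_norm_results_sub_le hf (ρ + 1) t₀ T
    (D := C₁ * (1 + Cε) + C₂) (by positivity) (m := m) (le_min (by omega) (by omega))
  refine ⟨C, min (min h₂ h₃) (1 / (Ce + 1)), by positivity, fun h h0 hh k hk => ?_⟩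
  have hle1 : h ≤ 1 / (Ce + 1) := hh.trans (min_le_right _ _)
  have hh1 : h ≤ 1 := hle1.trans ((div_le_one (by positivity)).2 (by linarith))
  have hhI : h ∈ Icc (0 : ℝ) 1 := ⟨h0.le, hh1⟩
  set e : ℝ → V := duhamel X Y t₀ (fun r => perturbation f b n h (r, y r)) with he
  have hcont : ContinuousOn (fun r => perturbation f b n h (r, y r)) (Icc t₀ T) :=
    hy.continuousOn_comp (contDiff_perturbation hf b n h).continuous
  have heq : ∀ t ∈ Icc t₀ T, ‖e t‖ ≤ Ce * h ^ q := by
    intro t ht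
    refine (hCX _ (CS * h ^ q) (fun r hr => ?_) t ht).trans_eq (by rw [hCe]; ring)
    rw [hpS, norm_smul, norm_pow, Real.norm_eq_abs, abs_of_pos h0, mul_comm]
    exact mul_le_mul_of_nonneg_right (hCS h hhI _ ((hρ r hr).trans (by linarith))) (by positivity)
  have he1 : ∀ t ∈ Icc t₀ T, ‖e t‖ ≤ 1 := by
    intro t ht
    have h2 : h ^ q ≤ h := pow_le_of_le_one h0.le hh1 (by omega)
    rw [le_div_iff₀ (by positivity)] at hle1
    have h3 := mul_le_mul_of_nonneg_left h2 hCe0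
    have := heq t ht
    linarith
  have hsum : ∀ t, ((t, y t + e t) : ℝ × V) - (t, y t) = (0, e t) := fun t => by simp
  have hn0 : ∀ v : V, ‖((0, v) : ℝ × V)‖ = ‖v‖ := fun v => by simp [Prod.norm_def]
  have hwr : ∀ t ∈ Icc t₀ T, ‖(t, y t + e t)‖ ≤ ρ + 1 := by
    intro t ht
    have h1 : ((t, y t + e t) : ℝ × V) = (t, y t) + (0, e t) := by simp
    rw [h1]
    exact (norm_add_le _ _).trans (add_le_add (hρ t ht) (by rw [hn0]; exact he1 t ht))
  -- The curve `(t, y + e)` satisfies the modified equation up to `O(h ^ (2 * q))`.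
  have hdef : ∀ t ∈ Icc t₀ T, ‖((1, f t (y t) + (linearization f y t (e t) +
      perturbation f b n h (t, y t))) : ℝ × V) -
        modifiedField (extendedField f) (n + 1) b h (t, y t + e t)‖ ≤ Cε * h ^ (2 * q) := by
    intro t ht
    have h1 := hCT (t, y t) (t, y t + e t) ((hρ t ht).trans (by linarith)) (hwr t ht)
    rw [hsum, hn0] at h1
    have h2 := hLS h hhI (t, y t + e t) (t, y t) (hwr t ht) ((hρ t ht).trans (by linarith))
    rw [hsum, hn0] at h2
    rw [modifiedField_extendedField hf hbleaf, hpS, hpS, Prod.mk_sub_mk, sub_self, hn0]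
    have h3 : f t (y t) + (linearization f y t (e t) + h ^ q • S (h, (t, y t))) -
        (f t (y t + e t) + h ^ q • S (h, (t, y t + e t))) =
        -((f t (y t + e t) - f t (y t) -
          fderiv ℝ (fun q : ℝ × V => f q.1 q.2) (t, y t) (0, e t)) +
          h ^ q • (S (h, (t, y t + e t)) - S (h, (t, y t)))) := by
      have h4 : linearization f y t (e t) =
          fderiv ℝ (fun q : ℝ × V => f q.1 q.2) (t, y t) (0, e t) := by simp [linearization]
      rw [h4, smul_sub]
      abel
    rw [h3, norm_neg]
    refine (norm_add_le _ _).trans ?_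
    rw [norm_smul, norm_pow, Real.norm_eq_abs, abs_of_pos h0]
    calc _ ≤ CT * ‖e t‖ ^ 2 + h ^ q * (LS * ‖e t‖) :=
          add_le_add h1 (mul_le_mul_of_nonneg_left h2 (by positivity))
      _ ≤ CT * (Ce * h ^ q) ^ 2 + h ^ q * (LS * (Ce * h ^ q)) := by
          have := heq t ht
          gcongr
      _ = Cε * h ^ (2 * q) := by rw [hCε]; ring
  have hstep : ∀ t, t₀ ≤ t → t + h ≤ T → ‖M.step f h t (y t + e t) - (y (t + h) + e (t + h))‖ ≤
      (C₁ * (1 + Cε) + C₂) * (h * h ^ m) := by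
    intro t ht htT
    have hsub : Icc t (t + h) ⊆ Icc t₀ T := Icc_subset_Icc ht htT
    have hw := hC₁ h h0 hh1 t (Cε * h ^ (2 * q)) (fun r => (r, y r + e r))
      (fun r => (1, f r (y r) + (linearization f y r (e r) + perturbation f b n h (r, y r))))
      (fun r hr => ⟨?_, hwr r (hsub hr), hdef r (hsub hr)⟩)
    · have h1 := hC₂ h h0 (hh.trans ((min_le_left _ _).trans (min_le_left _ _))) t (y t + e t)
        (hwr t (hsub ⟨le_rfl, by linarith⟩))
      have h2 := (norm_snd_le _).trans hw
      simp only [Prod.snd_sub, Prod.snd_add] at h2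
      have hm1 : h ^ (n + 1) ≤ h ^ m := pow_le_pow_of_le_one h0.le hh1 (min_le_right _ _)
      have hm2 : h ^ (2 * q) ≤ h ^ m := pow_le_pow_of_le_one h0.le hh1 (min_le_left _ _)
      rw [norm_sub_rev, ← sub_add_sub_cancel _
        (y t + e t + (bSeries (extendedField f) (n + 1) M.coeff h (t, y t + e t)).2)]
      rw [norm_sub_rev] at h1
      calc _ ≤ _ := norm_add_le _ _
        _ ≤ C₁ * (h * (h ^ (n + 1) + Cε * h ^ (2 * q))) + C₂ * h ^ (n + 2) := add_le_add h2 h1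
        _ = C₁ * (h * (h ^ (n + 1) + Cε * h ^ (2 * q))) + C₂ * (h * h ^ (n + 1)) := by ring
        _ ≤ C₁ * (h * (h ^ m + Cε * h ^ m)) + C₂ * (h * h ^ m) := by gcongr
        _ = (C₁ * (1 + Cε) + C₂) * (h * h ^ m) := by ring
    · have h1 := (hy r (hsub hr)).add (hasDerivWithinAt_duhamel hX hY hXY hcont (hsub hr))
      exact (((hasDerivWithinAt_id r _).prodMk h1).mono hsub)
  have hfin := hC h h0 (hh.trans ((min_le_left _ _).trans (min_le_right _ _)))
    (fun t => y t + e t) hwr hstep k hk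
  have he0 : e t₀ = 0 := duhamel_self _ _ _ _
  simp only [he0, add_zero] at hfin
  rwa [globalError, sub_sub]

end Expansion

/-! ### The order of the method -/

namespace RungeKutta

variable {s : ℕ} {M : RungeKutta s} {p : ℕ}

/-- A method of positive order integrates `y' = 1` exactly. -/
theorem HasOrder.coeff_leaf (hM : M.HasOrder p) (hp : 1 ≤ p) : M.coeff (some RTree.leaf) = 1 := by
  set v : EuclideanSpace ℝ (Fin 1) := EuclideanSpace.single 0 1 with hv
  have hv1 : ‖v‖ = 1 := by simp [hv]
  set β := ∑ i, M.b i with hβ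
  have hleaf : M.coeff (some RTree.leaf) = β := by
    have h1 : M.stageWeight RTree.leaf = fun _ => 1 := rfl
    have h2 : RTree.leaf.density = 1 := rfl
    simp [coeff, h1, h2, hβ]
  have hstages : ∀ h t x, M.stages (fun _ _ => v) h t x = fun _ => v := by
    intro h t x
    have h1 := Classical.epsilon_spec (p := fun k => M.IsStages (fun _ _ => v) h t x k ∧
      ∀ k', M.IsStages (fun _ _ => v) h t x k' → ‖k - fun _ => v‖ ≤ ‖k' - fun _ => v‖)
      ⟨fun _ => v, fun _ => rfl, fun k' _ => by simp⟩
    exact funext fun i => h1.1 i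
  have hres : ∀ (h : ℝ) (k : ℕ), M.results (fun _ _ => v) 0 0 h k = (k * h * β) • v := by
    intro h k
    induction k with
    | zero => simp [results]
    | succ k ih =>
      rw [results, ih, step, hstages, ← Finset.sum_smul, ← hβ, smul_smul, ← add_smul]
      push_cast
      ring_nf
  obtain ⟨C, h₀, h₀0, hC⟩ := hM 1 (fun _ _ => v) contDiff_const 0 1 (fun t => t • v)
    fun r _ => by simpa using ((hasDerivAt_id r).smul_const v).hasDerivWithinAt
  have hlim : Filter.Tendsto (fun K : ℕ => C * (1 / ((K : ℝ) + 1)) ^ p) Filter.atTop (nhds 0) := by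
    have := (tendsto_one_div_add_atTop_nhds_zero_nat (𝕜 := ℝ)).pow p
    rw [zero_pow (by omega)] at this
    simpa using this.const_mul C
  have hsmall : ∀ᶠ K : ℕ in Filter.atTop, 1 / ((K : ℝ) + 1) < h₀ :=
    (tendsto_order.1 (tendsto_one_div_add_atTop_nhds_zero_nat (𝕜 := ℝ))).2 _ h₀0
  have hle : ‖(β - 1) • v‖ ≤ 0 := by
    refine ge_of_tendsto hlim ?_
    filter_upwards [hsmall] with K hK
    have hK0 : (0 : ℝ) < K + 1 := by positivity
    have h1 := hC (1 / ((K : ℝ) + 1)) (by positivity) hK.le (K + 1) (by push_cast; field_simp; simp)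
    have h2 : ((K + 1 : ℕ) : ℝ) * (1 / ((K : ℝ) + 1)) = 1 := by push_cast; field_simp
    simp only [globalError, zero_smul, hres, h2, zero_add] at h1
    rwa [one_mul, ← sub_smul] at h1
  rw [norm_smul, hv1, mul_one] at hle
  rw [hleaf]
  exact sub_eq_zero.1 (norm_le_zero_iff.1 hle)

/-- The modified equation of a method of order `p` has no terms in `h, …, h ^ (p - 1)`: by the error
expansion, the first non-vanishing one would show in the global error on short intervals. -/
theorem HasOrder.perturbationTerm_eq_zero (hM : M.HasOrder p) {d : ℕ}
    {f : ℝ → EuclideanSpace ℝ (Fin d) → EuclideanSpace ℝ (Fin d)}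
    (hf : ContDiff ℝ ∞ fun q : ℝ × EuclideanSpace ℝ (Fin d) => f q.1 q.2) (j : ℕ) (hj : 1 ≤ j)
    (hjp : j < p) (x : ℝ × EuclideanSpace ℝ (Fin d)) :
    perturbationTerm f (modifiedCoeff M.coeff) j x = 0 := by
  induction j using Nat.strong_induction_on generalizing x with
  | _ j ih =>
    have hvan : ∀ i, 1 ≤ i → i < j → ∀ x, perturbationTerm f (modifiedCoeff M.coeff) i x = 0 :=
      fun i h1 h2 x => ih i h2 h1 (by omega) x
    obtain ⟨t₀, x₀⟩ := x
    obtain ⟨T, hT, y, rfl, hy⟩ := exists_isSolutionOn hf t₀ x₀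
    obtain ⟨X, Y, hX, hY', hXY⟩ := exists_fundamental hT.le (continuousOn_linearization hf hy)
    have hY : ContinuousOn Y (Icc t₀ T) := fun r hr => (hY' r hr).continuousWithinAt
    obtain ⟨C, h₁, h₁0, hC⟩ := exists_globalError_sub_duhamel_le M
      (hM.coeff_leaf (by omega)) hf hy hX hY hXY hj hvan j
    obtain ⟨C', h₂, h₂0, hC'⟩ := hM d f hf t₀ T y hy
    rw [min_eq_right (by omega)] at hC
    set ℓ : ℝ → EuclideanSpace ℝ (Fin d) := fun r =>
      perturbationTerm f (modifiedCoeff M.coeff) j (r, y r) with hℓ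
    have hℓc : ContinuousOn ℓ (Icc t₀ T) :=
      hy.continuousOn_comp (contDiff_perturbationTerm hf _ j).continuous
    have hpert : ∀ h : ℝ, (fun r => perturbation f (modifiedCoeff M.coeff) j h (r, y r)) =
        fun r => ∑ _i ∈ {()}, h ^ j • ℓ r := by
      intro h
      funext r
      rw [perturbation, Finset.sum_eq_single j, Finset.sum_singleton]
      · intro i hi hij
        have := Finset.mem_Icc.1 hi
        rw [hvan i this.1 (by omega), smul_zero]
      · intro h
        exact absurd (Finset.mem_Icc.2 ⟨hj, le_rfl⟩) h
    -- With `h = (t - t₀) / (K + 1)` and `K → ∞`, the leading error term at `t` is `O(h)`.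
    have hzero : ∀ t ∈ Icc t₀ T, duhamel X Y t₀ ℓ t = 0 := by
      intro t ht
      rcases ht.1.eq_or_lt with rfl | htlt
      · exact duhamel_self _ _ _ _
      have hpos : 0 < t - t₀ := by linarith
      have hlim1 : Filter.Tendsto (fun K : ℕ => (t - t₀) * (1 / ((K : ℝ) + 1))) Filter.atTop
          (nhds 0) := by
        simpa using (tendsto_one_div_add_atTop_nhds_zero_nat (𝕜 := ℝ)).const_mul (t - t₀)
      have hlim2 : Filter.Tendsto (fun K : ℕ => (|C'| + C) * ((t - t₀) * (1 / ((K : ℝ) + 1))))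
          Filter.atTop (nhds 0) := by
        simpa using hlim1.const_mul (|C'| + C)
      refine norm_le_zero_iff.1 (ge_of_tendsto hlim2 ?_)
      filter_upwards [(tendsto_order.1 hlim1).2 _ h₁0, (tendsto_order.1 hlim1).2 _ h₂0,
        (tendsto_order.1 hlim1).2 _ one_pos] with K hK₁ hK₂ hK1
      have hh0 : 0 < (t - t₀) * (1 / ((K : ℝ) + 1)) := by positivity
      have htk : t₀ + ((K + 1 : ℕ) : ℝ) * ((t - t₀) * (1 / ((K : ℝ) + 1))) = t := by
        push_cast
        field_simp
        ring
      set h := (t - t₀) * (1 / ((K : ℝ) + 1))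
      have h3 := hC h hh0 hK₁.le (K + 1) (by rw [htk]; exact ht.2)
      have h4 := hC' h hh0 hK₂.le (K + 1) (by rw [htk]; exact ht.2)
      rw [htk, hpert, duhamel_sum hY _ (fun _ => h ^ j) (fun _ _ => hℓc) ht, Finset.sum_singleton]
        at h3
      have h5 : h ^ p ≤ h ^ (j + 1) := pow_le_pow_of_le_one hh0.le hK1.le (by omega)
      have h6 : C' * h ^ p ≤ |C'| * h ^ (j + 1) :=
        (mul_le_mul_of_nonneg_right (le_abs_self _) (by positivity)).trans
          (mul_le_mul_of_nonneg_left h5 (abs_nonneg _))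
      have h7 : ‖h ^ j • duhamel X Y t₀ ℓ t‖ ≤ h ^ j * ((|C'| + C) * h) := by
        have h8 := norm_sub_le (M.globalError f y t₀ h (K + 1))
          (M.globalError f y t₀ h (K + 1) - h ^ j • duhamel X Y t₀ ℓ t)
        rw [sub_sub_cancel] at h8
        calc _ ≤ _ := h8
          _ ≤ |C'| * h ^ (j + 1) + C * h ^ (j + 1) := add_le_add (h4.trans h6) h3
          _ = h ^ j * ((|C'| + C) * h) := by ring
      rw [norm_smul, norm_pow, Real.norm_eq_abs, abs_of_pos hh0] at h7
      exact le_of_mul_le_mul_left h7 (by positivity)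
    -- The derivative of the vanishing function `duhamel X Y t₀ ℓ` at `t₀` is `ℓ t₀`.
    have ht₀ : t₀ ∈ Icc t₀ T := ⟨le_rfl, hT.le⟩
    have h1 := hasDerivWithinAt_duhamel hX hY hXY hℓc ht₀
    have h2 : HasDerivWithinAt (fun t => X t (∫ r in t₀..t, Y r (ℓ r))) 0 (Icc t₀ T) t₀ :=
      (hasDerivWithinAt_const t₀ _ 0).congr hzero (hzero t₀ ht₀)
    have h3 := ((uniqueDiffOn_Icc hT) t₀ ht₀).eq_deriv _ h1 h2
    rw [intervalIntegral.integral_same, map_zero, map_zero, zero_add] at h3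
    exact h3

end RungeKutta

end BSeries

theorem mainTheorem2 {s d : ℕ} (M : BSeries.RungeKutta s) (p : ℕ) (hM : M.HasOrder p)
    (f : ℝ → EuclideanSpace ℝ (Fin d) → EuclideanSpace ℝ (Fin d))
    (hf : ContDiff ℝ ∞ (fun q : ℝ × EuclideanSpace ℝ (Fin d) => f q.1 q.2))
    (t₀ T : ℝ) (y : ℝ → EuclideanSpace ℝ (Fin d))
    (hy : BSeries.IsSolutionOn f y (Icc t₀ T)) :
    (∀ t ∈ Icc t₀ T,
      (∀ r ∈ Icc t₀ t, DifferentiableAt ℝ (BSeries.flowMap f r t) (y r)) ∧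
      ∀ τ : BSeries.RTree,
        IntervalIntegrable (BSeries.elemIntegrand f y τ t) MeasureTheory.volume t₀ t) ∧
    ∀ N : ℕ, 2 * p ≤ N →
      ∃ C : ℝ, ∃ h₀ > 0, ∀ h : ℝ, 0 < h → h ≤ h₀ → ∀ k : ℕ, t₀ + k * h ≤ T →
        ‖M.globalError f y t₀ h k -
            ∑ τ ∈ BSeries.RTree.treesTwoTo N,
              (h ^ (τ.order - 1) * BSeries.modifiedCoeff M.coeff (some τ) *
                ((τ.numLabellings : ℝ) / (τ.order.factorial : ℝ))) •
                BSeries.elemIntegral f y t₀ τ (t₀ + k * h)‖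
          ≤ C * h ^ (2 * p) := by
  rcases lt_or_ge T t₀ with hT | hT
  · refine ⟨fun t ht => absurd (ht.1.trans ht.2) (not_le.2 hT), fun N _ =>
      ⟨0, 1, one_pos, fun h h0 _ k hk => absurd hk (not_le.2 ?_)⟩⟩
    have : 0 ≤ k * h := by positivity
    linarith
  obtain ⟨X, Y, hX, hY', hXY⟩ :=
    BSeries.exists_fundamental hT (BSeries.continuousOn_linearization hf hy)
  have hY : ContinuousOn Y (Icc t₀ T) := fun r hr => (hY' r hr).continuousWithinAt
  have hmem : ∀ h : ℝ, 0 < h → ∀ k : ℕ, t₀ + k * h ≤ T → t₀ + k * h ∈ Icc t₀ T := by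
    intro h h0 k hk
    have : 0 ≤ k * h := by positivity
    exact ⟨by linarith, hk⟩
  refine ⟨fun t ht => ⟨fun r hr =>
    (BSeries.hasFDerivAt_flowMap hf hy hX hXY hr.1 hr.2 ht.2).differentiableAt, fun τ =>
    BSeries.intervalIntegrable_elemIntegrand hf hy hX hY hXY τ ht⟩, fun N hN => ?_⟩
  rcases Nat.eq_zero_or_pos p with rfl | hp
  · -- For `p = 0` the global error and the sum are both bounded.
    obtain ⟨C, h₀, h₀0, hC⟩ := hM d f hf t₀ T y hy
    have hI : ∀ τ : BSeries.RTree, ∃ B, ∀ t ∈ Icc t₀ T, ‖BSeries.elemIntegral f y t₀ τ t‖ ≤ B := by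
      intro τ
      obtain ⟨B, hB⟩ := isCompact_Icc.exists_bound_of_continuousOn
        (BSeries.continuousOn_odeElemDiff hf hy τ)
      obtain ⟨CX, -, hCX⟩ := BSeries.exists_norm_duhamel_le
        (fun r hr => (hX r hr).continuousWithinAt : ContinuousOn X (Icc t₀ T)) hY
      refine ⟨CX * B, fun t ht => ?_⟩
      rw [BSeries.elemIntegral_eq_duhamel hf hy hX hY hXY τ ht]
      exact hCX _ _ hB t ht
    choose B hB using hI
    refine ⟨C + ∑ τ ∈ BSeries.RTree.treesTwoTo N, |BSeries.modifiedCoeff M.coeff (some τ) *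
      ((τ.numLabellings : ℝ) / (τ.order.factorial : ℝ))| * B τ, min h₀ 1, by positivity,
      fun h h0 hh k hk => ?_⟩
    rw [mul_zero, pow_zero, mul_one]
    refine (norm_sub_le _ _).trans (add_le_add ?_ ((norm_sum_le _ _).trans ?_))
    · simpa using hC h h0 (hh.trans (min_le_left _ _)) k hk
    · refine Finset.sum_le_sum fun τ _ => ?_
      rw [norm_smul, mul_assoc, norm_mul, norm_pow, Real.norm_eq_abs, Real.norm_eq_abs,
        abs_of_pos h0]
      refine mul_le_mul ?_ (hB τ _ (hmem h h0 k hk)) (norm_nonneg _) (abs_nonneg _)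
      exact mul_le_of_le_one_left (abs_nonneg _)
        (pow_le_one₀ h0.le (hh.trans (min_le_right _ _)))
  · obtain ⟨n, rfl⟩ : ∃ n, N = n + 1 := ⟨N - 1, by omega⟩
    obtain ⟨C, h₀, h₀0, hC⟩ := BSeries.exists_globalError_sub_duhamel_le M
      (hM.coeff_leaf hp) hf hy hX hY hXY hp (fun j => hM.perturbationTerm_eq_zero hf j) n
    rw [min_eq_left hN] at hC
    refine ⟨C, h₀, h₀0, fun h h0 hh k hk => ?_⟩
    rw [BSeries.sum_elemIntegral_eq_duhamel hf hy hX hY hXY _ n h (hmem h h0 k hk)]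
    exact hC h h0 hh k hk
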